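/- **Definitions.** Let $\mathbf B_3=\langle\sigma_0,\sigma_1,\sigma_2\mid\sigma_2\sigma_1=\sigma_1\sigma_0=\sigma_0\sigma_2\rangle$ be the group of 3-braids (Birman–Ko–Lee presentation), let $\delta=\sigma_2\sigma_1$, $\mathcal A=\{\sigma_0,\sigma_1,\sigma_2\}$ and $\hat{\mathcal A}=\mathcal A\cup\{\hat\sigma_0,\hat\sigma_1,\hat\sigma_2\}$, and let $\mathcal A^*$, $\hat{\mathcal A}^*$ be the free monoids on these alphabets; below, $=$ between words over $\mathcal A$ means equality of the braids that they represent. For $W\in\hat{\mathcal A}^*$ let $W'\in\mathcal A^*$ be obtained from $W$ by erasing all letters $\hat\sigma_i$, and $\bar W\in\mathcal A^*$ by replacing each $\hat\sigma_i$ with $\sigma_i$. A quasipositive factorization of $X\in\mathbf B_3$ is a finite sequence $(X_1,\dots,X_k)$ of conjugates of $\sigma_1$ with $X=X_1\cdots X_k$; $\mathcal Q(X)$ is the set of these. The braid group $\mathbf B_k$ acts on the factorizations of length $k$ (Hurwitz action): its standard generator $\Sigma_i$ replaces $(X_i,X_{i+1})$ with $(X_iX_{i+1}X_i^{-1},X_i)$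 and keeps the other entries. The right Garside normal form of $X$ is the presentation $X=U\delta^{-p}$ with $U\in\mathcal A^*$, $p\in\mathbb Z$, such that no subword (block of consecutive letters) of $U$ is equal to $\delta$ in $\mathbf B_3$. Given it, let $\mathcal G_0(X)$ be the graph with vertex set $\mathcal V_0(X)=\{W\in\hat{\mathcal A}^*\mid W'=\delta^p,\ \bar W=U\}$ in which two vertices are joined by an (undirected) edge if they have the form $A\hat xByC$ and $AxB\hat yC$ with $A,B,C\in\hat{\mathcal A}^*$, $x,y\in\mathcal A$, where $xB'=B'y$ and, for some integer $q\ge0$, either $B'=\delta^q$ (type (h1)) or $xB'=\delta^q$ (type (h2)). For a vertex $W=W_1\hat x_1W_2\hat x_2\cdots W_k\hat x_kW_{k+1}$ with $W_i\in\mathcal A^*$, $x_i\in\mathcal A$, put $[W]=(X_1,\dots,X_k)$, where $X_i=A_ix_iA_i^{-1}$ and $A_i=W_1\cdots W_i$. **Theorem 1.** Let $X\in\mathbf B_3$ have right Garside normal form $X=U\delta^{-p}$ with $p\ge0$. Then $\mathcal G_0(X)$ is a finite graph, $[W]\in\mathcal Q(X)$ for every $W\in\mathcal V_0(X)$, and every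 orbit of the Hurwitz action on $\mathcal Q(X)$ contains an element of the form $[W]$ with $W\in\mathcal V_0(X)$. For $W,V\in\mathcal V_0(X)$, the factorizations $[W]$ and $[V]$ belong to the same orbit if and only if $W$ and $V$ belong to the same connected component of $\mathcal G_0(X)$. -/

import Mathlib

/-! ### The Artin braid groups and the Hurwitz action -/

/-- The defining relators of the braid group on `k` strings in the generators `Σ_0, …, Σ_{k-2}`:
far commutativity and the braid relation. -/
def artinRelators (k : ℕ) : Set (FreeGroup (Fin (k - 1))) :=
  {r | (∃ i j : Fin (k - 1), i.val + 2 ≤ j.val ∧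
          r = FreeGroup.of i * FreeGroup.of j * (FreeGroup.of j * FreeGroup.of i)⁻¹) ∨
       (∃ i j : Fin (k - 1), i.val + 1 = j.val ∧
          r = FreeGroup.of i * FreeGroup.of j * FreeGroup.of i *
            (FreeGroup.of j * FreeGroup.of i * FreeGroup.of j)⁻¹)}

/-- The braid group on `k` strings (Artin presentation). -/
abbrev ArtinBraidGroup (k : ℕ) : Type := PresentedGroup (artinRelators k)

section Hurwitz

/-- The position `i` in a `k`-tuple, for `i < k - 1`. -/
def posLeft {k : ℕ} (i : Fin (k - 1)) : Fin k := ⟨i.val, by have := i.isLt; omega⟩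

/-- The position `i + 1` in a `k`-tuple, for `i < k - 1`. -/
def posRight {k : ℕ} (i : Fin (k - 1)) : Fin k := ⟨i.val + 1, by have := i.isLt; omega⟩

/-- The elementary Hurwitz move `Σ_i`: it replaces the pair `(X_i, X_{i+1})` by
`(X_i X_{i+1} X_i⁻¹, X_i)` and keeps the other entries. -/
def hurwitzMove {G : Type*} [Group G] {k : ℕ} (i : Fin (k - 1)) : Equiv.Perm (Fin k → G) where
  toFun X := fun j =>
    if j = posLeft i then X (posLeft i) * X (posRight i) * (X (posLeft i))⁻¹
    else if j = posRight i then X (posLeft i)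
    else X j
  invFun X := fun j =>
    if j = posLeft i then X (posRight i)
    else if j = posRight i then (X (posRight i))⁻¹ * X (posLeft i) * X (posRight i)
    else X j
  left_inv X := by
    funext j
    have h : posRight i ≠ posLeft i := by simp [posLeft, posRight]
    by_cases h1 : j = posLeft i
    · subst h1; simp [h]
    · by_cases h2 : j = posRight i
      · subst h2; simp [h, mul_assoc]
      · simp [h1, h2]
  right_inv X := by
    funext j
    have h : posRight i ≠ posLeft i := by simp [posLeft, posRight]
    by_cases h1 : j = posLeft i
    · subst h1; simp [h, mul_assoc]
    · by_cases h2 : j = posRight i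
      · subst h2; simp [h]
      · simp [h1, h2]

theorem hurwitzMove_comm {G : Type*} [Group G] {k : ℕ} (i j : Fin (k - 1))
    (hij : i.val + 2 ≤ j.val) :
    (hurwitzMove i * hurwitzMove j : Equiv.Perm (Fin k → G)) = hurwitzMove j * hurwitzMove i := by
  ext X m
  have h1 : posRight i ≠ posLeft j := by simp [posLeft, posRight, Fin.ext_iff]; omega
  have h2 : posRight i ≠ posRight j := by simp [posRight, Fin.ext_iff]; omega
  have h3 : posLeft i ≠ posLeft j := by simp [posLeft, Fin.ext_iff]; omega
  have h4 : posLeft i ≠ posRight j := by simp [posLeft, posRight, Fin.ext_iff]; omega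
  have h5 : posLeft i ≠ posRight i := by simp [posLeft, posRight]
  have h6 : posLeft j ≠ posRight j := by simp [posLeft, posRight]
  simp only [Equiv.Perm.mul_apply, hurwitzMove, Equiv.coe_fn_mk]
  by_cases m1 : m = posLeft i
  · subst m1; simp [h1, h2, h3, h4]
  by_cases m2 : m = posRight i
  · subst m2; simp [h1, h2, h3, h4]
  by_cases m3 : m = posLeft j
  · subst m3; simp [h1.symm, h2.symm, h3.symm, h4.symm]
  by_cases m4 : m = posRight j
  · subst m4; simp [h1.symm, h2.symm, h3.symm, h4.symm]
  simp [m1, m2, m3, m4]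

theorem hurwitzMove_braid {G : Type*} [Group G] {k : ℕ} (i j : Fin (k - 1))
    (hij : i.val + 1 = j.val) :
    (hurwitzMove i * hurwitzMove j * hurwitzMove i : Equiv.Perm (Fin k → G)) =
      hurwitzMove j * hurwitzMove i * hurwitzMove j := by
  ext X m
  have h0 : posLeft j = posRight i := by simp [posLeft, posRight, Fin.ext_iff]; omega
  have h1 : posLeft i ≠ posRight i := by simp [posLeft, posRight]
  have h2 : posRight i ≠ posRight j := by simp [posRight, Fin.ext_iff]; omega
  have h3 : posLeft i ≠ posRight j := by simp [posLeft, posRight, Fin.ext_iff]; omega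
  simp only [Equiv.Perm.mul_apply, hurwitzMove, Equiv.coe_fn_mk, h0]
  by_cases m1 : m = posLeft i
  · subst m1; simp [h1, h3, h1.symm, h2.symm, h3.symm, mul_assoc]
  by_cases m2 : m = posRight i
  · subst m2; simp [h1, h3, h1.symm, h2.symm, h3.symm]
  by_cases m3 : m = posRight j
  · subst m3; simp [h1, h3, h1.symm, h2.symm, h3.symm]
  simp [m1, m2, m3]

/-- The Hurwitz action of the braid group on `k` strings on `k`-tuples of elements of a group:
the generator `Σ_i` acts by the elementary move `hurwitzMove i`. -/
def hurwitzAction (G : Type*) [Group G] (k : ℕ) :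
    ArtinBraidGroup k →* Equiv.Perm (Fin k → G) :=
  PresentedGroup.toGroup (f := fun i => hurwitzMove i) (by
    rintro r (⟨i, j, hij, rfl⟩ | ⟨i, j, hij, rfl⟩)
    · simp only [map_mul, map_inv, FreeGroup.lift_apply_of]
      rw [hurwitzMove_comm i j hij, mul_inv_cancel]
    · simp only [map_mul, map_inv, FreeGroup.lift_apply_of]
      rw [hurwitzMove_braid i j hij, mul_inv_cancel])

/-- The orbit of a finite sequence `(X_1, …, X_k)` (written as a list of length `k`) under the
Hurwitz action of the braid group on `k` strings. -/
def hurwitzOrbit {G : Type*} [Group G] (L : List G) : Set (List G) :=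
  {M | ∃ β : ArtinBraidGroup L.length, M = List.ofFn (hurwitzAction G L.length β L.get)}

end Hurwitz

/-! ### The group of 3-braids in the Birman–Ko–Lee generators -/

/-- The relators of `⟨σ₀, σ₁, σ₂ ∣ σ₂σ₁ = σ₁σ₀ = σ₀σ₂⟩`. -/
def bklRelators : Set (FreeGroup (Fin 3)) :=
  {FreeGroup.of 2 * FreeGroup.of 1 * (FreeGroup.of 1 * FreeGroup.of 0)⁻¹,
   FreeGroup.of 1 * FreeGroup.of 0 * (FreeGroup.of 0 * FreeGroup.of 2)⁻¹}

/-- The group of braids with three strings (Birman–Ko–Lee presentation). -/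
abbrev Braid3 : Type := PresentedGroup bklRelators

/-- The generators `σ₀, σ₁, σ₂`. -/
def bklGen (i : Fin 3) : Braid3 := PresentedGroup.of i

/-- `δ = σ₂σ₁ (= σ₁σ₀ = σ₀σ₂)`. -/
def bklDelta : Braid3 := bklGen 2 * bklGen 1

/-- The braid represented by a positive word (a word in the alphabet `{σ₀, σ₁, σ₂}`). -/
def braidOf (U : List (Fin 3)) : Braid3 := (U.map bklGen).prod

/-- The set of quasipositive factorizations of a braid `X`: finite sequences of conjugates of `σ₁`
with product `X`. -/
def quasipositiveFactorizations (X : Braid3) : Set (List Braid3) :=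
  {L | L.prod = X ∧ ∀ Y ∈ L, IsConj (bklGen 1) Y}

/-- `X = U δ^{-p}` is the right Garside normal form of `X`: no subword (block of consecutive
letters) of the positive word `U` represents `δ`. -/
def IsRightGarsideNormalForm (X : Braid3) (U : List (Fin 3)) (p : ℤ) : Prop :=
  X = braidOf U * bklDelta ^ (-p) ∧ ∀ P : List (Fin 3), P <:+: U → braidOf P ≠ bklDelta

/-! ### Marked words and the graph -/

/-- The extended alphabet: the letters `σ_i` (`plain i`) and the marked letters `σ̂_i` (`hat i`). -/
inductive MarkedLetter : Type
  | plain (i : Fin 3)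
  | hat (i : Fin 3)

/-- Words in the extended alphabet; `=` is letterwise coincidence. -/
abbrev MarkedWord : Type := List MarkedLetter

/-- `W'`: the word obtained by erasing all marked letters. -/
def eraseHats : MarkedWord → List (Fin 3)
  | [] => []
  | .plain i :: W => i :: eraseHats W
  | .hat _ :: W => eraseHats W

/-- `W̄`: the word obtained by replacing each marked letter `σ̂_i` with `σ_i`. -/
def forgetHats : MarkedWord → List (Fin 3)
  | [] => []
  | .plain i :: W => i :: forgetHats W
  | .hat i :: W => i :: forgetHats W

/-- The sequence of conjugates `(g A_i) x_i (g A_i)⁻¹` read off from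
`W = W_1 x̂_1 W_2 x̂_2 ⋯ W_k x̂_k W_{k+1}`, where `A_i = W_1 ⋯ W_i`. -/
def markedConjugates (g : Braid3) : MarkedWord → List Braid3
  | [] => []
  | .plain i :: W => markedConjugates (g * bklGen i) W
  | .hat i :: W => (g * bklGen i * g⁻¹) :: markedConjugates g W

/-- `[W] = (X_1, …, X_k)` with `X_i = A_i x_i A_i⁻¹`, `A_i = W_1 ⋯ W_i`. -/
def markedFactorization (W : MarkedWord) : List Braid3 := markedConjugates 1 W

/-- The vertices of the graph `𝒢₀` attached to the normal form `U δ^{-p}`: the marked words `W`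
with `W' = δ^p` and `W̄ = U` as braids. -/
def graphVertices (U : List (Fin 3)) (p : ℤ) : Set MarkedWord :=
  {W | braidOf (eraseHats W) = bklDelta ^ p ∧ braidOf (forgetHats W) = braidOf U}

/-- `(W, V) = (A x̂ B y C, A x B ŷ C)` with `x B' = B' y` where, for some `q ≥ 0`, either
`B' = δ^q` (type (h1)) or `x B' = δ^q` (type (h2)). -/
def IsHurwitzMarkMove (W V : MarkedWord) : Prop :=
  ∃ (A B C : MarkedWord) (x y : Fin 3),
    W = A ++ [.hat x] ++ B ++ [.plain y] ++ C ∧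
    V = A ++ [.plain x] ++ B ++ [.hat y] ++ C ∧
    bklGen x * braidOf (eraseHats B) = braidOf (eraseHats B) * bklGen y ∧
    ∃ q : ℕ, braidOf (eraseHats B) = bklDelta ^ q ∨
      bklGen x * braidOf (eraseHats B) = bklDelta ^ q

/-- The graph `𝒢₀` attached to the normal form `U δ^{-p}`: two vertices are joined by an
(undirected) edge if they are related by a move of type (h1) or (h2). -/
def markedGraph (U : List (Fin 3)) (p : ℤ) : SimpleGraph (graphVertices U p) :=
  SimpleGraph.fromRel fun W V => IsHurwitzMarkMove W.1 V.1

/-!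
Every braid is `U δ ^ p` for a unique integer `p` and a unique positive word `U` without subword `δ`.
Consequently the cosets of `⟨δ⟩` are the vertices of a trivalent tree, the unmarked letters of a
marked word `W` trace a walk in this tree starting at the base vertex `⟨δ⟩`, and `W' = δ ^ p` means
that this walk is closed. If `x B' = B' y`, then `B' = x ^ k δ ^ i` for some `k`: the edges of `x` and
`y` lie on the boundary of one complementary region of the plane tree, at distance `k`.

The key notion is `StableEquiv`, the equivalence relation on marked words generated by the moves
(h1), (h2) and the deletion of unmarked subwords `δ` (which conjugates what follows). It serves as a
bridge between the two sides of the theorem.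

* It is compatible with the Hurwitz action. A deletion does not change `[W]`, and a move (h1) or (h2)
  carries one entry of `[W]` over some others (`IsHurwitzMarkMove.hurwitzEquiv`). Conversely, up to
  stable equivalence every word with `W' = δ ^ p` is a concatenation of blocks `A x̂ D` with `A D` a
  power of the central element `δ ^ 3`, one for each entry `A x A⁻¹` of `[W]`, and the block is
  determined by the entry (`hat_block`). So `W` is determined by `[W]` up to stable equivalence
  (`stableEquiv_of_markedFactorization_eq`), and an elementary Hurwitz move is realized by a move (h1)
  between two such words (`HurwitzStep.exists_move`). Hence `[W]` and `[V]` are in the same orbit if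
  and only if `W` and `V` are stably equivalent.

* On words `W` whose underlying word has no subword `δ`, it is the connectedness by moves (h1), (h2)
  alone (`StableEquiv.hatConn`). To see this, read deletion as a rewriting rule modulo moves of marks.
  As long as the word underlying `W` has a subword `δ`, the assumption `0 ≤ p` of the theorem
  forces `W'` to be a positive power of `δ`, and then the marks can be moved away from this subword
  (`exists_hatConn_delta`), so it can be deleted. This terminates at a vertex of the graph. The result
  is unique up to moves of marks (`Reduces.hatConn`): deletion at a fixed place is compatible with
  moves of marks (`hatConn_delta_iff`), and deletions at different places commute.

The core is `HatConn.of_cons_delta`, the compatibility for a subword `δ` at the beginning of the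
word; other places are reduced to this one by cyclic rotation. It says that the result of the deletion
of `δ` is well defined even if one or both letters of `δ` are marked, in which case the deletion is
compensated by marking one or two letters in the rest of the word (`MarksOne`, `MarksPair`). These
letters can be found because a closed walk in a tree which leaves a vertex along an edge returns along
the same edge (`exists_crossing_out`, `exists_crossing_in`), and their choice is immaterial because
each exchange of a marked and an unmarked letter which respects `W' = δ ^ p` is a composition of moves
(`HatExchange.hatConn`).
-/

local notation "σ" => bklGen
local notation "δ" => bklDelta

/-! ### The Garside normal form of a 3-braid -/

theorem bklGen_succ_mul (i : Fin 3) : σ (i + 1) * σ i = δ := by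
  have h1 : (σ 2 * σ 1 : Braid3) = σ 1 * σ 0 := by
    have := PresentedGroup.one_of_mem (rels := bklRelators)
      (x := FreeGroup.of 2 * FreeGroup.of 1 * (FreeGroup.of 1 * FreeGroup.of 0)⁻¹)
      (by simp [bklRelators])
    rw [map_mul, map_inv, mul_inv_eq_one, map_mul, map_mul] at this
    exact this
  have h2 : (σ 1 * σ 0 : Braid3) = σ 0 * σ 2 := by
    have := PresentedGroup.one_of_mem (rels := bklRelators)
      (x := FreeGroup.of 1 * FreeGroup.of 0 * (FreeGroup.of 0 * FreeGroup.of 2)⁻¹)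
      (by simp [bklRelators])
    rw [map_mul, map_inv, mul_inv_eq_one, map_mul, map_mul] at this
    exact this
  fin_cases i
  · exact h1.symm
  · rfl
  · exact (h1.trans h2).symm

theorem bklDelta_mul_bklGen (i : Fin 3) : δ * σ i = σ (i + 2) * δ := by
  have h : σ (i + 2) * σ (i + 1) = δ := by
    rw [← bklGen_succ_mul (i + 1), add_assoc]; rfl
  calc δ * σ i = σ (i + 2) * (σ (i + 1) * σ i) := by rw [← h, mul_assoc]
    _ = σ (i + 2) * δ := by rw [bklGen_succ_mul]

theorem bklGen_mul_bklDelta (i : Fin 3) : σ i * δ = δ * σ (i + 1) := by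
  rw [bklDelta_mul_bklGen, add_assoc]
  simp

/-- Conjugation by a power of `δ` permutes the generators. -/
theorem exists_bklDelta_zpow_mul (m : ℤ) (i : Fin 3) : ∃ j, δ ^ m * σ i = σ j * δ ^ m := by
  induction m using Int.induction_on generalizing i with
  | zero => exact ⟨i, by simp⟩
  | succ n ih =>
    obtain ⟨j, hj⟩ := ih (i + 2)
    exact ⟨j, by rw [zpow_add_one, mul_assoc, bklDelta_mul_bklGen, ← mul_assoc, hj, mul_assoc]⟩
  | pred n ih =>
    obtain ⟨j, hj⟩ := ih (i + 1)
    refine ⟨j, ?_⟩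
    have h : δ⁻¹ * σ i = σ (i + 1) * δ⁻¹ := by
      rw [inv_mul_eq_iff_eq_mul, ← mul_assoc, eq_mul_inv_iff_mul_eq, bklGen_mul_bklDelta]
    rw [zpow_sub_one, mul_assoc, h, ← mul_assoc, hj, mul_assoc]

/-- The exponent sum of a braid. -/
def bklLength : Braid3 →* Multiplicative ℤ :=
  PresentedGroup.toGroup (f := fun _ => Multiplicative.ofAdd 1) (by
    rintro r (rfl | rfl) <;> simp)

theorem bklLength_bklGen (i : Fin 3) : bklLength (σ i) = Multiplicative.ofAdd 1 :=
  PresentedGroup.toGroup.of _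

theorem bklLength_bklDelta : bklLength δ = Multiplicative.ofAdd 2 := by
  rw [bklDelta, map_mul, bklLength_bklGen, bklLength_bklGen]; rfl

theorem bklLength_bklDelta_zpow (m : ℤ) : bklLength (δ ^ m) = Multiplicative.ofAdd (2 * m) := by
  rw [map_zpow, bklLength_bklDelta, ← ofAdd_zsmul, smul_eq_mul, mul_comm]

theorem braidOf_nil : braidOf [] = 1 := rfl

theorem braidOf_cons (i : Fin 3) (U : List (Fin 3)) : braidOf (i :: U) = σ i * braidOf U := by
  simp [braidOf]

theorem braidOf_append (U V : List (Fin 3)) : braidOf (U ++ V) = braidOf U * braidOf V := by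
  simp [braidOf]

theorem bklLength_braidOf (U : List (Fin 3)) :
    bklLength (braidOf U) = Multiplicative.ofAdd (U.length : ℤ) := by
  induction U with
  | nil => simp [braidOf]
  | cons i U ih =>
    rw [braidOf_cons, map_mul, ih, bklLength_bklGen, ← ofAdd_add]
    simp [add_comm]

theorem bklDelta_zpow_injective : Function.Injective fun m : ℤ => (δ ^ m : Braid3) := by
  intro m n h
  have := congrArg bklLength h
  simp only [bklLength_bklDelta_zpow] at this
  have := Multiplicative.ofAdd.injective this
  omega

theorem bklDelta_mul_braidOf (U : List (Fin 3)) :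
    δ * braidOf U = braidOf (U.map (· + 2)) * δ := by
  induction U with
  | nil => simp [braidOf]
  | cons i U ih =>
    rw [braidOf_cons, ← mul_assoc, bklDelta_mul_bklGen, mul_assoc, ih, List.map_cons, braidOf_cons,
      mul_assoc]

/-- A positive word without two consecutive letters with product `δ`. -/
def DeltaFree (U : List (Fin 3)) : Prop := U.IsChain fun a b => a ≠ b + 1

theorem DeltaFree.tail {u : Fin 3} {U : List (Fin 3)} (h : DeltaFree (u :: U)) : DeltaFree U :=
  List.IsChain.tail h

theorem DeltaFree.map_add {U : List (Fin 3)} (h : DeltaFree U) (k : Fin 3) :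
    DeltaFree (U.map (· + k)) := by
  unfold DeltaFree at *
  rw [List.isChain_map]
  refine h.imp fun a b hab e => hab ?_
  have : a + k = b + 1 + k := by rw [e]; abel
  exact add_right_cancel this

/-- The set of Garside normal forms: the pair `(U, p)` stands for the braid `U δ ^ p`. -/
abbrev BKLNormalForm : Type := {U : List (Fin 3) // DeltaFree U} × ℤ

namespace BKLNormalForm

/-- Left multiplication of a normal form by `δ`. -/
def deltaEquiv : Equiv.Perm BKLNormalForm where
  toFun x := (⟨x.1.1.map (· + 2), x.1.2.map_add 2⟩, x.2 + 1)
  invFun x := (⟨x.1.1.map (· + 1), x.1.2.map_add 1⟩, x.2 - 1)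
  left_inv x := by
    ext1
    · apply Subtype.ext
      simp only [List.map_map]
      conv_rhs => rw [← List.map_id x.1.1]
      apply List.map_congr_left
      intro a _
      simp [add_assoc]
    · simp
  right_inv x := by
    ext1
    · apply Subtype.ext
      simp only [List.map_map]
      conv_rhs => rw [← List.map_id x.1.1]
      apply List.map_congr_left
      intro a _
      simp [add_assoc]
    · simp

/-- Left multiplication of a normal form by `σ i`. -/
def genMul (i : Fin 3) : BKLNormalForm → BKLNormalForm
  | (⟨[], _⟩, p) => (⟨[i], List.isChain_singleton _⟩, p)
  | (⟨u :: U, h⟩, p) =>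
    if hi : i = u + 1 then (⟨U.map (· + 2), h.tail.map_add 2⟩, p + 1)
    else (⟨i :: u :: U, List.isChain_cons_cons.2 ⟨hi, h⟩⟩, p)

theorem genMul_succ_genMul (i : Fin 3) (x : BKLNormalForm) :
    genMul (i + 1) (genMul i x) = deltaEquiv x := by
  rcases x with ⟨⟨_ | ⟨u, U⟩, h⟩, p⟩
  · simp [genMul, deltaEquiv]
  · by_cases hi : i = u + 1
    · rcases U with _ | ⟨w, U⟩
      · subst hi
        simp [genMul, deltaEquiv, add_assoc]
      · have hw : u ≠ w + 1 := (List.isChain_cons_cons.1 h).1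
        have hne : ¬ u + 2 = w := by
          have key : ∀ u w : Fin 3, u + 2 = w → u = w + 1 := by decide
          exact fun e => hw (key u w e)
        subst hi
        simp [genMul, deltaEquiv, hne, add_assoc]
    · simp [genMul, deltaEquiv, hi]

theorem deltaEquiv_genMul (i : Fin 3) (x : BKLNormalForm) :
    deltaEquiv (genMul i x) = genMul (i + 2) (deltaEquiv x) := by
  have h1 := genMul_succ_genMul (i + 1) (genMul i x)
  rw [genMul_succ_genMul i x, add_assoc] at h1
  exact h1.symm

/-- Left multiplication by `σ i` as a permutation of the normal forms. -/
def genEquiv (i : Fin 3) : Equiv.Perm BKLNormalForm where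
  toFun := genMul i
  invFun x := deltaEquiv.symm (genMul (i + 1) x)
  left_inv x := by simp [genMul_succ_genMul]
  right_inv x := by
    apply deltaEquiv.injective
    rw [deltaEquiv_genMul, Equiv.apply_symm_apply]
    have := genMul_succ_genMul (i + 1) x
    rwa [add_assoc] at this

/-- The action of the braid group on normal forms by left multiplication. -/
def action : Braid3 →* Equiv.Perm BKLNormalForm :=
  PresentedGroup.toGroup (f := genEquiv) (by
    have h (i : Fin 3) : genEquiv (i + 1) * genEquiv i = deltaEquiv :=
      Equiv.ext fun x => genMul_succ_genMul i x
    have h0 : genEquiv 1 * genEquiv 0 = deltaEquiv := h 0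
    have h1 : genEquiv 2 * genEquiv 1 = deltaEquiv := h 1
    have h2 : genEquiv 0 * genEquiv 2 = deltaEquiv := h 2
    rintro r (rfl | rfl)
    · simp only [map_mul, map_inv, FreeGroup.lift_apply_of]
      rw [h0, h1, mul_inv_cancel]
    · simp only [map_mul, map_inv, FreeGroup.lift_apply_of]
      rw [h0, h2, mul_inv_cancel])

theorem action_bklGen (i : Fin 3) (x : BKLNormalForm) : action (σ i) x = genMul i x := by
  have : action (σ i) = genEquiv i := PresentedGroup.toGroup.of _
  rw [this]; rfl

theorem action_bklDelta (x : BKLNormalForm) : action δ x = deltaEquiv x := by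
  rw [bklDelta, map_mul, Equiv.Perm.mul_apply, action_bklGen, action_bklGen]
  exact genMul_succ_genMul 1 x

/-- The braid represented by a normal form. -/
def eval (x : BKLNormalForm) : Braid3 := braidOf x.1.1 * δ ^ x.2

theorem eval_genMul (i : Fin 3) (x : BKLNormalForm) : eval (genMul i x) = σ i * eval x := by
  rcases x with ⟨⟨_ | ⟨u, U⟩, h⟩, p⟩
  · simp [genMul, eval, braidOf]
  · by_cases hi : i = u + 1
    · subst hi
      simp only [genMul, eval, dite_true, braidOf_cons]
      rw [← mul_assoc, ← mul_assoc, bklGen_succ_mul, bklDelta_mul_braidOf, add_comm p 1,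
        zpow_add, zpow_one, mul_assoc]
    · simp [genMul, eval, hi, braidOf_cons, mul_assoc]

theorem eval_action (g : Braid3) (x : BKLNormalForm) : eval (action g x) = g * eval x := by
  have key : ∀ g ∈ Subgroup.closure (Set.range bklGen), ∀ x, eval (action g x) = g * eval x := by
    intro g hg
    induction hg using Subgroup.closure_induction with
    | mem g hg => obtain ⟨i, rfl⟩ := hg; intro x; rw [action_bklGen, eval_genMul]
    | one => simp
    | mul a b _ _ ha hb => intro x; rw [map_mul, Equiv.Perm.mul_apply, ha, hb, mul_assoc]
    | inv a _ ha =>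
      intro x
      rw [eq_inv_mul_iff_mul_eq, ← ha, ← Equiv.Perm.mul_apply, ← map_mul, mul_inv_cancel, map_one]
      rfl
  refine key g ?_ x
  have : Subgroup.closure (Set.range bklGen) = ⊤ := PresentedGroup.closure_range_of _
  rw [this]; trivial

theorem action_eval (x : BKLNormalForm) : action (eval x) (⟨[], List.isChain_nil⟩, 0) = x := by
  have hd : ∀ p : ℤ, action (δ ^ p) (⟨[], List.isChain_nil⟩, 0) = (⟨[], List.isChain_nil⟩, p) := by
    intro p
    induction p using Int.induction_on with
    | zero => simp
    | succ n ih =>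
      rw [add_comm, zpow_add, zpow_one, map_mul, Equiv.Perm.mul_apply, ih, action_bklDelta]
      simp [deltaEquiv, add_comm]
    | pred n ih =>
      apply (action δ).injective
      rw [← Equiv.Perm.mul_apply, ← map_mul, ← zpow_one_add, action_bklDelta]
      have : (1 + (-(n : ℤ) - 1)) = -n := by ring
      rw [this, ih]
      simp [deltaEquiv]
  rcases x with ⟨⟨U, h⟩, p⟩
  simp only [eval]
  induction U with
  | nil => rw [braidOf_nil, one_mul, hd]
  | cons u U ih =>
    rw [braidOf_cons, mul_assoc, map_mul, Equiv.Perm.mul_apply, ih h.tail,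
      action_bklGen]
    rcases U with _ | ⟨w, U⟩
    · rfl
    · have : ¬ u = w + 1 := (List.isChain_cons_cons.1 h).1
      simp [genMul, this]

end BKLNormalForm

/-- The reduced word of the right Garside normal form of a braid. -/
def garsideWord (g : Braid3) : List (Fin 3) :=
  (BKLNormalForm.action g (⟨[], List.isChain_nil⟩, 0)).1.1

/-- The exponent of `δ` in the right Garside normal form of a braid. -/
def garsideExponent (g : Braid3) : ℤ := (BKLNormalForm.action g (⟨[], List.isChain_nil⟩, 0)).2

theorem deltaFree_garsideWord (g : Braid3) : DeltaFree (garsideWord g) :=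
  (BKLNormalForm.action g (⟨[], List.isChain_nil⟩, 0)).1.2

theorem braidOf_garsideWord_mul (g : Braid3) :
    braidOf (garsideWord g) * δ ^ garsideExponent g = g := by
  have := BKLNormalForm.eval_action g (⟨[], List.isChain_nil⟩, 0)
  rwa [BKLNormalForm.eval, BKLNormalForm.eval, braidOf_nil, one_mul, zpow_zero, mul_one] at this

theorem garsideWord_eq {U : List (Fin 3)} (h : DeltaFree U) (p : ℤ) :
    garsideWord (braidOf U * δ ^ p) = U := by
  have := BKLNormalForm.action_eval (⟨U, h⟩, p)
  exact congrArg (fun x => x.1.1) this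

theorem garsideExponent_eq {U : List (Fin 3)} (h : DeltaFree U) (p : ℤ) :
    garsideExponent (braidOf U * δ ^ p) = p := by
  have := BKLNormalForm.action_eval (⟨U, h⟩, p)
  exact congrArg (fun x => x.2) this

/-- Uniqueness of the Garside normal form. -/
theorem DeltaFree.eq_and_eq {U V : List (Fin 3)} (hU : DeltaFree U) (hV : DeltaFree V) {p q : ℤ}
    (h : braidOf U * δ ^ p = braidOf V * δ ^ q) : U = V ∧ p = q :=
  ⟨by rw [← garsideWord_eq hU p, h, garsideWord_eq hV],
   by rw [← garsideExponent_eq hU p, h, garsideExponent_eq hV]⟩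

theorem bklGen_injective : Function.Injective bklGen := by
  intro i j h
  have := (DeltaFree.eq_and_eq (U := [i]) (V := [j]) (p := 0) (q := 0) (List.isChain_singleton _)
    (List.isChain_singleton _) (by simpa [braidOf] using h)).1
  simpa using this

/-! ### Branches of the tree of cosets of `⟨δ⟩` -/

/-- The first letter of the Garside normal form. The cosets `g⟨δ⟩` are the vertices of a trivalent
tree, two cosets being adjacent if they are of the form `g⟨δ⟩` and `g σ_i⟨δ⟩`. Removing the base
vertex `⟨δ⟩` leaves three branches, and `branch g` is the branch containing `g⟨δ⟩`; it is `none` at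
the base vertex itself. -/
def branch (g : Braid3) : Option (Fin 3) := (garsideWord g).head?

theorem branch_braidOf_mul {U : List (Fin 3)} (h : DeltaFree U) (p : ℤ) :
    branch (braidOf U * δ ^ p) = U.head? := by
  rw [branch, garsideWord_eq h]

theorem exists_deltaFree_eq (g : Braid3) :
    ∃ (U : List (Fin 3)) (p : ℤ), DeltaFree U ∧ g = braidOf U * δ ^ p :=
  ⟨garsideWord g, garsideExponent g, deltaFree_garsideWord g, (braidOf_garsideWord_mul g).symm⟩

theorem branch_mul_zpow (g : Braid3) (m : ℤ) : branch (g * δ ^ m) = branch g := by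
  obtain ⟨U, p, hU, rfl⟩ := exists_deltaFree_eq g
  rw [mul_assoc, ← zpow_add, branch_braidOf_mul hU, branch_braidOf_mul hU]

theorem branch_zpow (m : ℤ) : branch (δ ^ m) = none := by
  have := branch_braidOf_mul (U := []) List.isChain_nil m
  rwa [braidOf_nil, one_mul] at this

theorem branch_one : branch 1 = none := by
  simpa using branch_zpow 0

theorem branch_eq_none {g : Braid3} (h : branch g = none) : ∃ m : ℤ, g = δ ^ m := by
  obtain ⟨U, p, hU, rfl⟩ := exists_deltaFree_eq g
  rw [branch_braidOf_mul hU, List.head?_eq_none_iff] at h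
  exact ⟨p, by rw [h, braidOf_nil, one_mul]⟩

theorem branch_bklGen_mul {i : Fin 3} {g : Braid3} (h : branch g ≠ some (i + 2)) :
    branch (σ i * g) = some i := by
  obtain ⟨U, p, hU, rfl⟩ := exists_deltaFree_eq g
  rw [branch_braidOf_mul hU] at h
  rw [← mul_assoc, ← braidOf_cons, branch_braidOf_mul]
  · rfl
  · rcases U with _ | ⟨u, U⟩
    · exact List.isChain_singleton _
    · refine List.isChain_cons_cons.2 ⟨fun e => h ?_, hU⟩
      subst e
      simp [add_assoc]

theorem branch_bklGen_mul_zpow (c : Fin 3) (m : ℤ) : branch (σ c * δ ^ m) = some c :=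
  branch_bklGen_mul (by simp [branch_zpow])

/-- A walk in the tree changes branch only when it leaves the base vertex or returns to it. -/
theorem branch_mul_bklGen {g : Braid3} {j : Fin 3} (h : branch (g * σ j) ≠ branch g) :
    (∃ (m : ℤ) (c : Fin 3), g = δ ^ m ∧ g * σ j = σ c * δ ^ m) ∨
      ∃ (m : ℤ) (c : Fin 3), g = σ c * δ ^ m ∧ g * σ j = δ ^ (m + 1) := by
  obtain ⟨U, p, hU, rfl⟩ := exists_deltaFree_eq g
  obtain ⟨k, hk⟩ := exists_bklDelta_zpow_mul p j
  rcases List.eq_nil_or_concat' U with rfl | ⟨V, u, rfl⟩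
  · refine Or.inl ⟨p, k, by simp [braidOf_nil], by rw [braidOf_nil, one_mul, hk]⟩
  · rw [mul_assoc, hk, ← mul_assoc] at h ⊢
    by_cases hu : u = k + 1
    · have e : braidOf (V ++ [u]) * σ k = braidOf V * δ := by
        rw [braidOf_append, braidOf_cons, braidOf_nil, mul_one, hu, mul_assoc, bklGen_succ_mul]
      rw [e, mul_assoc, ← zpow_one_add] at h ⊢
      rcases V with _ | ⟨v, V⟩
      · refine Or.inr ⟨p, u, by simp [braidOf], ?_⟩
        rw [braidOf_nil, one_mul, add_comm]
      · have hV : DeltaFree (v :: V) := (List.isChain_append.1 hU).1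
        rw [branch_braidOf_mul hU, branch_braidOf_mul hV] at h
        simp at h
    · exfalso
      have hV : DeltaFree (V ++ [u] ++ [k]) := by
        refine List.isChain_append.2 ⟨hU, List.isChain_singleton _, ?_⟩
        simpa using hu
      have e : braidOf (V ++ [u]) * σ k = braidOf (V ++ [u] ++ [k]) := by
        rw [braidOf_append _ [k], braidOf_cons, braidOf_nil, mul_one]
      rw [e, branch_braidOf_mul hU, branch_braidOf_mul hV] at h
      apply h
      simp

theorem bklGen_mul_bklGen_add_two (a : Fin 3) : σ a * σ (a + 2) = δ := by
  have := bklGen_succ_mul (a + 2)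
  rw [add_assoc] at this
  simpa using this

/-- The elements conjugating a generator to a generator. -/
theorem exists_eq_zpow_mul_zpow {a b : Fin 3} {g : Braid3} (h : σ a * g = g * σ b) :
    ∃ k i : ℤ, g = σ a ^ k * δ ^ i := by
  obtain ⟨U, p, hU, rfl⟩ := exists_deltaFree_eq g
  obtain ⟨b', hb⟩ := exists_bklDelta_zpow_mul p b
  rw [mul_assoc, hb, ← mul_assoc, ← mul_assoc, mul_left_inj] at h
  clear hb
  suffices H : ∃ k i : ℤ, braidOf U = σ a ^ k * δ ^ i by
    obtain ⟨k, i, hk⟩ := H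
    exact ⟨k, i + p, by rw [hk, mul_assoc, ← zpow_add]⟩
  induction U generalizing a with
  | nil => exact ⟨0, 0, by simp [braidOf_nil]⟩
  | cons u U ih =>
    have hfin : ∀ a u : Fin 3, u = a ∨ a = u + 1 ∨ u = a + 1 := by decide
    rw [braidOf_cons] at h ⊢
    rcases hfin a u with rfl | rfl | rfl
    · rw [mul_assoc, mul_right_inj] at h
      obtain ⟨k, i, hk⟩ := ih hU.tail h
      exact ⟨1 + k, i, by rw [hk, zpow_one_add, mul_assoc]⟩
    · rw [← mul_assoc, bklGen_succ_mul, ← bklGen_mul_bklGen_add_two u, mul_assoc, mul_assoc,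
        mul_right_inj] at h
      obtain ⟨k, i, hk⟩ := ih hU.tail h
      have hc : σ u * σ (u + 2) ^ k = σ (u + 1) ^ k * σ u := by
        have : SemiconjBy (σ u) (σ (u + 2)) (σ (u + 1)) := by
          rw [SemiconjBy, bklGen_mul_bklGen_add_two, bklGen_succ_mul]
        exact this.zpow_right k
      refine ⟨k - 1, 1 + i, ?_⟩
      rw [hk, ← mul_assoc, hc, zpow_one_add, ← bklGen_succ_mul u, ← mul_assoc, ← mul_assoc,
        ← zpow_add_one]
      simp
    · exfalso
      have h1 : branch (σ a * (σ (a + 1) * braidOf U)) = some a := by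
        refine branch_bklGen_mul ?_
        have := branch_braidOf_mul hU 0
        rw [braidOf_cons, zpow_zero, mul_one] at this
        rw [this]
        simp
      have h2 : branch (σ (a + 1) * braidOf U) = some (a + 1) := by
        have := branch_braidOf_mul hU 0
        rwa [braidOf_cons, zpow_zero, mul_one] at this
      rw [h] at h1
      have hne : branch (σ (a + 1) * braidOf U * σ b') ≠ branch (σ (a + 1) * braidOf U) := by
        rw [h1, h2]; simp
      rcases branch_mul_bklGen hne with ⟨m, c, e, _⟩ | ⟨m, c, _, e⟩
      · rw [e, branch_zpow] at h2; cases h2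
      · rw [e, branch_zpow] at h1; cases h1

theorem branch_pow_succ_mul_zpow (a : Fin 3) (n : ℕ) (i : ℤ) :
    branch (σ a ^ (n + 1) * δ ^ i) = some a := by
  induction n with
  | zero => simpa using branch_bklGen_mul_zpow a i
  | succ n ih =>
    rw [pow_succ', mul_assoc]
    refine branch_bklGen_mul ?_
    rw [ih]
    simp

theorem bklGen_inv (a : Fin 3) : (σ a)⁻¹ = σ (a + 2) * δ⁻¹ := by
  rw [inv_eq_iff_mul_eq_one, ← mul_assoc, bklGen_mul_bklGen_add_two, mul_inv_cancel]

theorem branch_inv_pow_succ_mul_zpow (a : Fin 3) (n : ℕ) (i : ℤ) :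
    branch ((σ a)⁻¹ ^ (n + 1) * δ ^ i) = some (a + 2) := by
  rw [branch_mul_zpow]
  induction n generalizing a with
  | zero =>
    have := branch_bklGen_mul_zpow (a + 2) (-1)
    rwa [zpow_neg_one, ← bklGen_inv] at this
  | succ n ih =>
    have hc : δ⁻¹ * (σ a)⁻¹ ^ (n + 1) = (σ (a + 1))⁻¹ ^ (n + 1) * δ⁻¹ := by
      have : SemiconjBy δ⁻¹ (σ a)⁻¹ (σ (a + 1))⁻¹ := by
        refine SemiconjBy.inv_right ?_
        rw [SemiconjBy, inv_mul_eq_iff_eq_mul, ← mul_assoc, eq_mul_inv_iff_mul_eq,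
          bklGen_mul_bklDelta]
      exact this.pow_right _
    have e : (σ a)⁻¹ ^ (n + 1 + 1) = σ (a + 2) * ((σ (a + 1))⁻¹ ^ (n + 1) * δ⁻¹) := by
      rw [← hc, ← mul_assoc, ← bklGen_inv, pow_succ']
    rw [e]
    refine branch_bklGen_mul ?_
    rw [← zpow_neg_one δ, branch_mul_zpow, ih]
    simp [add_assoc]

/-! ### Marked words -/

/-- The braid `W'`, the product of the unmarked letters of `W`. -/
def plainBraid (W : MarkedWord) : Braid3 := braidOf (eraseHats W)

@[simp] theorem plainBraid_nil : plainBraid [] = 1 := rfl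

@[simp] theorem plainBraid_cons_plain (i : Fin 3) (W : MarkedWord) :
    plainBraid (.plain i :: W) = σ i * plainBraid W := by
  simp [plainBraid, eraseHats, braidOf_cons]

@[simp] theorem plainBraid_cons_hat (i : Fin 3) (W : MarkedWord) :
    plainBraid (.hat i :: W) = plainBraid W := rfl

@[simp] theorem plainBraid_append (V W : MarkedWord) :
    plainBraid (V ++ W) = plainBraid V * plainBraid W := by
  induction V with
  | nil => simp
  | cons l V ih => cases l <;> simp [ih, mul_assoc]

@[simp] theorem forgetHats_append (V W : MarkedWord) :
    forgetHats (V ++ W) = forgetHats V ++ forgetHats W := by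
  induction V with
  | nil => rfl
  | cons l V ih => cases l <;> simp [forgetHats, ih]

@[simp] theorem forgetHats_length (W : MarkedWord) : (forgetHats W).length = W.length := by
  induction W with
  | nil => rfl
  | cons l W ih => cases l <;> simp [forgetHats, ih]

theorem plainBraid_eq_zpow_nonneg {W : MarkedWord} {m : ℤ} (h : plainBraid W = δ ^ m) : 0 ≤ m := by
  have := congrArg bklLength h
  rw [plainBraid, bklLength_braidOf, bklLength_bklDelta_zpow] at this
  have := Multiplicative.ofAdd.injective this
  omega

/-- A walk entering the branch `c` traverses the edge from the base vertex into this branch. -/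
theorem exists_crossing_out {g : Braid3} {B : MarkedWord} {c : Fin 3} (h0 : branch g ≠ some c)
    (h1 : branch (g * plainBraid B) = some c) :
    ∃ (B₁ : MarkedWord) (s : Fin 3) (B₂ : MarkedWord) (m : ℤ), B = B₁ ++ .plain s :: B₂ ∧
      g * plainBraid B₁ = δ ^ m ∧ g * plainBraid B₁ * σ s = σ c * δ ^ m := by
  induction B generalizing g with
  | nil => simp at h1; exact absurd h1 h0
  | cons l B ih =>
    rcases l with i | i
    · by_cases h : branch (g * σ i) = some c
      · rcases branch_mul_bklGen (by rw [h]; exact h0.symm) with ⟨m, d, e1, e2⟩ | ⟨m, d, e1, e2⟩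
        · rw [e2, branch_bklGen_mul_zpow] at h
          obtain rfl : d = c := by simpa using h
          exact ⟨[], i, B, m, rfl, by simpa using e1, by simpa using e2⟩
        · rw [e2, branch_zpow] at h; cases h
      · obtain ⟨B₁, s, B₂, m, rfl, e1, e2⟩ := ih h (by simpa [mul_assoc] using h1)
        exact ⟨.plain i :: B₁, s, B₂, m, rfl, by simpa [mul_assoc] using e1,
          by simpa [mul_assoc] using e2⟩
    · obtain ⟨B₁, s, B₂, m, rfl, e1, e2⟩ := ih h0 (by simpa using h1)
      exact ⟨.hat i :: B₁, s, B₂, m, rfl, by simpa using e1, by simpa using e2⟩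

/-- A walk leaving the branch `c` traverses the edge from this branch to the base vertex. -/
theorem exists_crossing_in {g : Braid3} {B : MarkedWord} {c : Fin 3} (h0 : branch g = some c)
    (h1 : branch (g * plainBraid B) ≠ some c) :
    ∃ (B₁ : MarkedWord) (t : Fin 3) (B₂ : MarkedWord) (m : ℤ), B = B₁ ++ .plain t :: B₂ ∧
      g * plainBraid B₁ = σ c * δ ^ m ∧ g * plainBraid B₁ * σ t = δ ^ (m + 1) := by
  induction B generalizing g with
  | nil => simp at h1; exact absurd h0 h1
  | cons l B ih =>
    rcases l with i | i
    · by_cases h : branch (g * σ i) = some c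
      · obtain ⟨B₁, s, B₂, m, rfl, e1, e2⟩ := ih h (by simpa [mul_assoc] using h1)
        exact ⟨.plain i :: B₁, s, B₂, m, rfl, by simpa [mul_assoc] using e1,
          by simpa [mul_assoc] using e2⟩
      · rcases branch_mul_bklGen (by rw [h0]; exact h) with ⟨m, d, e1, e2⟩ | ⟨m, d, e1, e2⟩
        · rw [e1, branch_zpow] at h0; cases h0
        · rw [e1, branch_bklGen_mul_zpow] at h0
          obtain rfl : d = c := by simpa using h0
          exact ⟨[], i, B, m, rfl, by simpa using e1, by simpa using e2⟩
    · obtain ⟨B₁, s, B₂, m, rfl, e1, e2⟩ := ih h0 (by simpa using h1)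
      exact ⟨.hat i :: B₁, s, B₂, m, rfl, by simpa using e1, by simpa using e2⟩

/-! ### Moves of marks, twisting and cyclic rotation -/

/-- Two marked words are hat-connected if they are joined by a chain of moves of type (h1) or (h2)
and their inverses. -/
def HatConn : MarkedWord → MarkedWord → Prop := Relation.EqvGen IsHurwitzMarkMove

theorem isHurwitzMarkMove_of_zpow {A B C : MarkedWord} {x y : Fin 3} {q : ℤ}
    (h : σ x * plainBraid B = plainBraid B * σ y)
    (hq : plainBraid B = δ ^ q ∨ σ x * plainBraid B = δ ^ q) :
    IsHurwitzMarkMove (A ++ .hat x :: (B ++ .plain y :: C))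
      (A ++ .plain x :: (B ++ .hat y :: C)) := by
  have hq0 : 0 ≤ q := by
    rcases hq with hq | hq
    · exact plainBraid_eq_zpow_nonneg hq
    · exact plainBraid_eq_zpow_nonneg (W := .plain x :: B) (by simpa using hq)
  lift q to ℕ using hq0
  exact ⟨A, B, C, x, y, by simp, by simp, h, q, by simpa [plainBraid] using hq⟩

theorem IsHurwitzMarkMove.exists_eq {W V : MarkedWord} (h : IsHurwitzMarkMove W V) :
    ∃ (A B C : MarkedWord) (x y : Fin 3) (q : ℤ), W = A ++ .hat x :: (B ++ .plain y :: C) ∧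
      V = A ++ .plain x :: (B ++ .hat y :: C) ∧ σ x * plainBraid B = plainBraid B * σ y ∧
      (plainBraid B = δ ^ q ∨ σ x * plainBraid B = δ ^ q) := by
  obtain ⟨A, B, C, x, y, hW, hV, h1, q, hq⟩ := h
  exact ⟨A, B, C, x, y, q, by simp [hW], by simp [hV], h1, by simpa [plainBraid] using hq⟩

theorem IsHurwitzMarkMove.append_left {W V : MarkedWord} (h : IsHurwitzMarkMove W V)
    (P : MarkedWord) : IsHurwitzMarkMove (P ++ W) (P ++ V) := by
  obtain ⟨A, B, C, x, y, rfl, rfl, h1, hq⟩ := h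
  exact ⟨P ++ A, B, C, x, y, by simp, by simp, h1, hq⟩

theorem IsHurwitzMarkMove.plainBraid_eq {W V : MarkedWord} (h : IsHurwitzMarkMove W V) :
    plainBraid W = plainBraid V := by
  obtain ⟨A, B, C, x, y, q, rfl, rfl, h1, -⟩ := h.exists_eq
  simp only [plainBraid_append, plainBraid_cons_hat, plainBraid_cons_plain, ← mul_assoc]
  simp only [mul_assoc, mul_right_inj]
  simp only [← mul_assoc, h1]

theorem IsHurwitzMarkMove.forgetHats_eq {W V : MarkedWord} (h : IsHurwitzMarkMove W V) :
    forgetHats W = forgetHats V := by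
  obtain ⟨A, B, C, x, y, q, rfl, rfl, h1, -⟩ := h.exists_eq
  simp [forgetHats]

namespace HatConn

theorem refl (W : MarkedWord) : HatConn W W := Relation.EqvGen.refl W

theorem symm {W V : MarkedWord} (h : HatConn W V) : HatConn V W := Relation.EqvGen.symm _ _ h

theorem trans {W V Z : MarkedWord} (h : HatConn W V) (h' : HatConn V Z) : HatConn W Z :=
  Relation.EqvGen.trans _ _ _ h h'

theorem of_move {W V : MarkedWord} (h : IsHurwitzMarkMove W V) : HatConn W V := .rel _ _ h

theorem plainBraid_eq {W V : MarkedWord} (h : HatConn W V) : plainBraid W = plainBraid V := by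
  induction h with
  | rel W V h => exact h.plainBraid_eq
  | refl => rfl
  | symm _ _ _ ih => exact ih.symm
  | trans _ _ _ _ _ ih1 ih2 => exact ih1.trans ih2

theorem forgetHats_eq {W V : MarkedWord} (h : HatConn W V) : forgetHats W = forgetHats V := by
  induction h with
  | rel W V h => exact h.forgetHats_eq
  | refl => rfl
  | symm _ _ _ ih => exact ih.symm
  | trans _ _ _ _ _ ih1 ih2 => exact ih1.trans ih2

theorem length_eq {W V : MarkedWord} (h : HatConn W V) : W.length = V.length := by
  rw [← forgetHats_length, h.forgetHats_eq, forgetHats_length]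

theorem append_left {W V : MarkedWord} (h : HatConn W V) (P : MarkedWord) :
    HatConn (P ++ W) (P ++ V) := by
  induction h with
  | rel W V h => exact of_move (h.append_left P)
  | refl => exact refl _
  | symm _ _ _ ih => exact ih.symm
  | trans _ _ _ _ _ ih1 ih2 => exact ih1.trans ih2

end HatConn

/-- Adding `1` to the index of a letter: the conjugation `x ↦ δ⁻¹ x δ`. -/
def MarkedLetter.up : MarkedLetter → MarkedLetter
  | .plain i => .plain (i + 1)
  | .hat i => .hat (i + 1)

/-- The word obtained from `W` by the conjugation `x ↦ δ ^ (-n) x δ ^ n` of each letter. It depends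
only on `n` modulo `3`. -/
def twist (n : ℕ) (W : MarkedWord) : MarkedWord := W.map MarkedLetter.up^[n]

@[simp] theorem twist_append (n : ℕ) (V W : MarkedWord) :
    twist n (V ++ W) = twist n V ++ twist n W := List.map_append

@[simp] theorem twist_cons (n : ℕ) (l : MarkedLetter) (W : MarkedWord) :
    twist n (l :: W) = MarkedLetter.up^[n] l :: twist n W := rfl

@[simp] theorem twist_nil (n : ℕ) : twist n [] = [] := rfl

@[simp] theorem twist_zero (W : MarkedWord) : twist 0 W = W := List.map_id W

@[simp] theorem twist_length (n : ℕ) (W : MarkedWord) : (twist n W).length = W.length :=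
  List.length_map _

theorem twist_twist (m n : ℕ) (W : MarkedWord) : twist m (twist n W) = twist (m + n) W := by
  simp [twist, Function.iterate_add]

theorem twist_three_mul (n : ℕ) (W : MarkedWord) : twist (3 * n) W = W := by
  have h : MarkedLetter.up^[3] = id := by
    funext l
    rcases l with i | i <;> revert i <;> simp [MarkedLetter.up, add_assoc]
  rw [twist, Function.iterate_mul, h, Function.iterate_id, List.map_id]

theorem up_iterate_two_plain (i : Fin 3) : MarkedLetter.up^[2] (.plain i) = .plain (i + 2) := by
  simp [MarkedLetter.up, add_assoc]

theorem up_iterate_two_hat (i : Fin 3) : MarkedLetter.up^[2] (.hat i) = .hat (i + 2) := by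
  simp [MarkedLetter.up, add_assoc]

theorem forgetHats_twist_one (W : MarkedWord) :
    forgetHats (twist 1 W) = (forgetHats W).map (· + 1) := by
  induction W with
  | nil => rfl
  | cons l W ih => cases l <;> simpa [forgetHats, MarkedLetter.up] using ih

theorem plainBraid_twist (n : ℕ) (W : MarkedWord) :
    plainBraid W * δ ^ n = δ ^ n * plainBraid (twist n W) := by
  have h1 : ∀ W, plainBraid W * δ = δ * plainBraid (twist 1 W) := by
    intro W
    induction W with
    | nil => simp
    | cons l W ih =>
      cases l with
      | plain i =>
        simp only [plainBraid_cons_plain, twist_cons, Function.iterate_one, MarkedLetter.up]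
        rw [mul_assoc, ih, ← mul_assoc, bklGen_mul_bklDelta, mul_assoc]
      | hat i => simpa [MarkedLetter.up] using ih
  induction n with
  | zero => simp
  | succ n ih => rw [pow_succ, ← mul_assoc, ih, mul_assoc, h1, twist_twist, mul_assoc, add_comm 1]

theorem IsHurwitzMarkMove.twist {W V : MarkedWord} (h : IsHurwitzMarkMove W V) (n : ℕ) :
    IsHurwitzMarkMove (twist n W) (twist n V) := by
  have h1 : ∀ {W V}, IsHurwitzMarkMove W V →
      IsHurwitzMarkMove (_root_.twist 1 W) (_root_.twist 1 V) := by
    intro W V h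
    obtain ⟨A, B, C, x, y, q, rfl, rfl, h1, hq⟩ := h.exists_eq
    simp only [twist_append, twist_cons, Function.iterate_one, MarkedLetter.up]
    have hB : plainBraid (_root_.twist 1 B) = δ⁻¹ * plainBraid B * δ := by
      have := plainBraid_twist 1 B
      rw [pow_one] at this
      rw [mul_assoc, this, inv_mul_cancel_left]
    have hx : ∀ x, σ (x + 1) = δ⁻¹ * σ x * δ := by
      intro x; rw [mul_assoc, bklGen_mul_bklDelta, inv_mul_cancel_left]
    have hc : δ⁻¹ * δ ^ q * δ = (δ ^ q : Braid3) := by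
      rw [mul_assoc, ← zpow_add_one, ← zpow_neg_one, ← zpow_add]
      congr 1; ring
    refine isHurwitzMarkMove_of_zpow (q := q) ?_ ?_
    · rw [hB, hx, hx]
      have : δ⁻¹ * (σ x * plainBraid B) * δ = δ⁻¹ * (plainBraid B * σ y) * δ := by rw [h1]
      simpa [mul_assoc] using this
    · rcases hq with hq | hq
      · exact Or.inl (by rw [hB, hq, hc])
      · refine Or.inr ?_
        rw [hB, hx, ← hc, ← hq]
        simp [mul_assoc]
  induction n with
  | zero => simpa using h
  | succ n ih => rw [add_comm, ← twist_twist, ← twist_twist]; exact h1 ih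

theorem HatConn.twist {W V : MarkedWord} (h : HatConn W V) (n : ℕ) :
    HatConn (twist n W) (twist n V) := by
  induction h with
  | rel W V h => exact of_move (h.twist n)
  | refl => exact refl _
  | symm _ _ _ ih => exact ih.symm
  | trans _ _ _ _ _ ih1 ih2 => exact ih1.trans ih2

theorem HatConn.of_twist {W V : MarkedWord} {n : ℕ}
    (h : HatConn (_root_.twist n W) (_root_.twist n V)) :
    HatConn W V := by
  have := h.twist (2 * n)
  rw [twist_twist, twist_twist, show 2 * n + n = 3 * n by ring, twist_three_mul,
    twist_three_mul] at this
  exact this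

/-- Moving the first letter of a word to its end, conjugated by `δ ^ p`. On the words with `W' = δ ^ p`
this is a rotation of a closed walk in the tree. -/
def rotate (p : ℕ) : MarkedWord → MarkedWord
  | [] => []
  | l :: W => W ++ [MarkedLetter.up^[p] l]

theorem up_iterate_plain (p : ℕ) (i : Fin 3) : ∃ j, MarkedLetter.up^[p] (.plain i) = .plain j ∧
    MarkedLetter.up^[p] (.hat i) = .hat j ∧ σ i * δ ^ p = δ ^ p * σ j := by
  induction p with
  | zero => exact ⟨i, rfl, rfl, by simp⟩
  | succ n ih =>
    obtain ⟨j, h1, h2, h3⟩ := ih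
    refine ⟨j + 1, ?_, ?_, ?_⟩
    · rw [Function.iterate_succ_apply', h1]; rfl
    · rw [Function.iterate_succ_apply', h2]; rfl
    · rw [pow_succ, ← mul_assoc, h3, mul_assoc, bklGen_mul_bklDelta, mul_assoc]

theorem plainBraid_rotate {p : ℕ} {W : MarkedWord} (h : plainBraid W = δ ^ p) :
    plainBraid (rotate p W) = δ ^ p := by
  rcases W with _ | ⟨i | i, W⟩
  · exact h
  · obtain ⟨j, h1, -, h3⟩ := up_iterate_plain p i
    simp only [plainBraid_cons_plain] at h
    simp only [rotate, h1, plainBraid_append, plainBraid_cons_plain, plainBraid_nil, mul_one]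
    rw [← h, mul_assoc, mul_right_inj] at h3
    rw [← h3, h]
  · obtain ⟨j, -, h2, -⟩ := up_iterate_plain p i
    simpa [rotate, h2] using h

theorem IsHurwitzMarkMove.rotate {p : ℕ} {W V : MarkedWord} (h : IsHurwitzMarkMove W V)
    (hp : plainBraid W = δ ^ p) : HatConn (rotate p W) (rotate p V) := by
  obtain ⟨A, B, C, x, y, q, rfl, rfl, h1, hq⟩ := h.exists_eq
  rcases A with _ | ⟨l, A⟩
  · obtain ⟨z, e1, e2, e3⟩ := up_iterate_plain p x
    simp only [List.nil_append, _root_.rotate, e1, e2, plainBraid_cons_hat, plainBraid_append,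
      plainBraid_cons_plain] at hp ⊢
    have hC : plainBraid C * σ z = σ y * plainBraid C := by
      have : plainBraid B * (σ y * plainBraid C) * σ z =
          plainBraid B * σ y * (σ y * plainBraid C) := by
        rw [hp, ← e3, ← h1, mul_assoc, hp]
      rw [mul_assoc, mul_assoc, mul_assoc, mul_right_inj, mul_right_inj] at this
      exact this
    have := (HatConn.of_move (isHurwitzMarkMove_of_zpow (A := B) (B := C) (C := []) (x := y) (y := z)
      (q := p - q) hC.symm ?_)).symm
    · simpa using this
    · rcases hq with hq | hq
      · right
        rw [← zpow_natCast] at hp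
        rw [hq] at hp
        rw [sub_eq_neg_add, zpow_add, zpow_neg, ← hp, inv_mul_cancel_left]
      · left
        rw [← zpow_natCast, ← mul_assoc, ← h1, hq] at hp
        rw [sub_eq_neg_add, zpow_add, zpow_neg, ← hp, inv_mul_cancel_left]
  · have := HatConn.of_move (isHurwitzMarkMove_of_zpow (A := A) (B := B)
      (C := C ++ [MarkedLetter.up^[p] l]) h1 hq)
    simpa [_root_.rotate] using this

theorem HatConn.rotate {p : ℕ} {W V : MarkedWord} (h : HatConn W V)
    (hp : plainBraid W = δ ^ p) : HatConn (rotate p W) (rotate p V) := by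
  induction h with
  | rel W V h => exact h.rotate hp
  | refl => exact refl _
  | symm _ _ h ih => exact (ih ((plainBraid_eq h).trans hp)).symm
  | trans _ _ _ h _ ih1 ih2 => exact (ih1 hp).trans (ih2 ((plainBraid_eq h).symm.trans hp))

theorem rotate_iterate (p : ℕ) (A C : MarkedWord) :
    (rotate p)^[A.length] (A ++ C) = C ++ twist p A := by
  induction A generalizing C with
  | nil => simp
  | cons l A ih =>
    rw [List.length_cons, Function.iterate_succ_apply]
    simp only [List.cons_append, rotate, List.append_assoc]
    rw [ih]
    simp

theorem HatConn.rotate_append {p : ℕ} {A C A' C' : MarkedWord} (h : HatConn (A ++ C) (A' ++ C'))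
    (hA : A.length = A'.length) (hp : plainBraid (A ++ C) = δ ^ p) :
    HatConn (C ++ _root_.twist p A) (C' ++ _root_.twist p A') := by
  have key : ∀ n : ℕ, HatConn ((_root_.rotate p)^[n] (A ++ C)) ((_root_.rotate p)^[n] (A' ++ C')) ∧
      plainBraid ((_root_.rotate p)^[n] (A ++ C)) = δ ^ p := by
    intro n
    induction n with
    | zero => exact ⟨h, hp⟩
    | succ n ih =>
      rw [Function.iterate_succ_apply', Function.iterate_succ_apply']
      exact ⟨ih.1.rotate ih.2, plainBraid_rotate ih.2⟩
  have := (key A.length).1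
  rw [rotate_iterate, hA, rotate_iterate] at this
  exact this

theorem plainBraid_append_twist {p : ℕ} {A C : MarkedWord} (hp : plainBraid (A ++ C) = δ ^ p) :
    plainBraid (C ++ twist p A) = δ ^ p := by
  have := plainBraid_twist p A
  simp only [plainBraid_append] at *
  rw [← hp, mul_assoc, mul_right_inj] at this
  rw [← this, hp]

theorem hatConn_append_comm_iff {p : ℕ} {A C A' C' : MarkedWord} (hA : A.length = A'.length)
    (hC : C.length = C'.length) (hp : plainBraid (A ++ C) = δ ^ p) :
    HatConn (A ++ C) (A' ++ C') ↔ HatConn (C ++ twist p A) (C' ++ twist p A') := by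
  refine ⟨fun h => h.rotate_append hA hp, fun h => ?_⟩
  have := h.rotate_append hC (plainBraid_append_twist hp)
  rw [← twist_append, ← twist_append] at this
  exact this.of_twist

/-! ### Exchanges of one marked and one unmarked letter -/

/-- `V` is obtained from `W` by moving a mark from a letter to another one on its right, without any
condition on the letters. -/
def HatExchange (W V : MarkedWord) : Prop :=
  ∃ (A B C : MarkedWord) (x y : Fin 3), W = A ++ .hat x :: (B ++ .plain y :: C) ∧
      V = A ++ .plain x :: (B ++ .hat y :: C)

theorem hatConn_of_pow {A B C : MarkedWord} {x y : Fin 3} (k : ℕ) {i : ℤ}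
    (hB : plainBraid B = σ x ^ k * δ ^ i) (h : σ x * plainBraid B = plainBraid B * σ y) :
    HatConn (A ++ .hat x :: (B ++ .plain y :: C)) (A ++ .plain x :: (B ++ .hat y :: C)) := by
  induction k generalizing A B x i with
  | zero => exact .of_move (isHurwitzMarkMove_of_zpow h (.inl (by simpa using hB)))
  | succ k ih =>
    obtain ⟨B₁, a, B₂, m, rfl, e1, e2⟩ := exists_crossing_out (g := 1) (B := B) (c := x)
      (by simp [branch_one]) (by rw [one_mul, hB, branch_pow_succ_mul_zpow])
    rw [one_mul] at e1 e2
    rw [e1] at e2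
    simp only [plainBraid_append, plainBraid_cons_plain] at hB h
    have h1 : σ x * plainBraid B₁ = plainBraid B₁ * σ a := by rw [e1, e2]
    have h2 : σ a * plainBraid B₂ = plainBraid B₂ * σ y := by
      rw [← mul_assoc, h1, mul_assoc, mul_assoc, mul_right_inj, mul_assoc, mul_right_inj] at h
      exact h
    have hc : σ x ^ k * δ ^ m = δ ^ m * σ a ^ k := by
      have : SemiconjBy (δ ^ m) (σ a) (σ x) := e2
      exact (this.pow_right k).symm
    have h3 : plainBraid B₂ = σ a ^ k * δ ^ (i - m) := by
      rw [← mul_assoc, e1, e2, pow_succ', mul_assoc, mul_assoc, mul_right_inj] at hB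
      rw [← mul_right_inj (δ ^ m), hB, ← mul_assoc, ← hc, mul_assoc, ← zpow_add]
      congr 2; ring
    have s1 := HatConn.of_move (isHurwitzMarkMove_of_zpow (A := A) (B := B₁)
      (C := B₂ ++ .plain y :: C) h1 (.inl e1))
    have s2 := ih (A := A ++ .plain x :: B₁) h3 h2
    simp only [List.append_assoc, List.cons_append] at s1 s2 ⊢
    exact s1.trans s2

/-- An exchange between two words with `W' = δ ^ p` is a composition of moves (h1), (h2). If `x B' = B' y`
with `B' = x ^ k δ ^ i`, then for `k ≥ 0` the mark proceeds along the boundary of one region of the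
tree by moves (h1). The case `k = -1` is a move (h2). If `k < -1`, then the closed walk passes at
some time through an edge to which the mark can be moved by (h2) and from which it can reach the final
position by moves (h1). -/
theorem HatExchange.hatConn {W V : MarkedWord} (h : HatExchange W V) {p : ℕ}
    (hW : plainBraid W = δ ^ p) (hV : plainBraid V = δ ^ p) : HatConn W V := by
  obtain ⟨A, B, C, x, y, rfl, rfl⟩ := h
  have hB : σ x * plainBraid B = plainBraid B * σ y := by
    rw [← hW] at hV
    simp only [plainBraid_append, plainBraid_cons_hat, plainBraid_cons_plain, mul_right_inj] at hV
    rw [← mul_assoc, ← mul_assoc, mul_left_inj] at hV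
    exact hV
  rw [hatConn_append_comm_iff rfl (by simp) hW]
  replace hW := plainBraid_append_twist hW
  simp only [List.cons_append, List.append_assoc, plainBraid_cons_hat] at hW ⊢
  generalize C ++ twist p A = D at *
  clear hV
  simp only [plainBraid_append, plainBraid_cons_plain] at hW
  obtain ⟨k, i, hk⟩ := exists_eq_zpow_mul_zpow hB
  obtain ⟨n, rfl | rfl⟩ := k.eq_nat_or_neg
  · exact hatConn_of_pow (A := []) n (by simpa using hk) hB
  rcases n with _ | _ | n
  · exact hatConn_of_pow (A := []) 0 (by simpa using hk) hB
  · exact .of_move (isHurwitzMarkMove_of_zpow (A := []) (q := i) hB (.inr (by rw [hk]; simp)))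
  · have hBy : plainBraid B * σ y = (σ x)⁻¹ ^ (n + 1) * δ ^ i := by
      rw [← hB, hk, ← mul_assoc, ← zpow_one_add, inv_pow, ← zpow_natCast, ← zpow_neg]
      congr 2
    obtain ⟨C₁, t, C₂, m, rfl, e1, e2⟩ := exists_crossing_in (g := plainBraid B * σ y) (B := D)
      (c := x + 2) (by rw [hBy, branch_inv_pow_succ_mul_zpow])
      (by rw [mul_assoc, hW, ← zpow_natCast, branch_zpow]; simp)
    have e3 : σ x * (plainBraid B * σ y * plainBraid C₁) = δ ^ (m + 1) := by
      rw [e1, ← mul_assoc, bklGen_mul_bklGen_add_two, add_comm, zpow_one_add]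
    have s1 := HatConn.of_move (isHurwitzMarkMove_of_zpow (A := []) (B := B ++ .plain y :: C₁)
      (C := C₂) (x := x) (y := t) (q := m + 1) (by simp [← mul_assoc] at e2 e3 ⊢; rw [e3, e2])
      (.inr (by simpa [mul_assoc] using e3)))
    have hyt : σ y * plainBraid C₁ = plainBraid C₁ * σ t := by
      have : plainBraid B * σ y * (σ y * plainBraid C₁) =
          plainBraid B * σ y * (plainBraid C₁ * σ t) := by
        rw [← mul_assoc (_ * _) _ (σ t), e2, ← e3, ← hB]
        simp only [mul_assoc]
        rw [← mul_assoc (plainBraid B) (σ y), ← hB, mul_assoc]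
      exact mul_left_cancel this
    have hxy : σ x * δ ^ i = δ ^ i * σ y := by
      rw [hk, ← mul_assoc, ((Commute.refl (σ x)).zpow_right _).eq, mul_assoc, mul_assoc,
        mul_right_inj] at hB
      exact hB
    have hC : plainBraid C₁ = σ y ^ n * δ ^ (m + 1 - i) := by
      have h1 : σ x ^ n * δ ^ i = δ ^ i * σ y ^ n := by
        have : SemiconjBy (δ ^ i) (σ y) (σ x) := hxy.symm
        exact (this.pow_right n).symm
      have h2 : δ ^ i * plainBraid C₁ = σ x ^ n * δ ^ (m + 1) := by
        rw [← mul_assoc, hBy, ← mul_assoc, pow_succ', ← mul_assoc, mul_inv_cancel, one_mul, mul_assoc,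
          inv_pow, inv_mul_eq_iff_eq_mul] at e3
        exact e3
      rw [← mul_right_inj (δ ^ i), h2, ← mul_assoc, ← h1, mul_assoc, ← zpow_add]
      congr 2; ring
    have s2 := hatConn_of_pow (A := .plain x :: B) (B := C₁) (C := C₂) n hC hyt
    simp only [List.append_assoc, List.cons_append, List.nil_append] at s1 s2 ⊢
    exact s1.trans s2.symm

/-! ### Marking one or two more letters -/

/-- `Z` is obtained from `W` by marking one letter. -/
def MarksOne (W Z : MarkedWord) : Prop :=
  ∃ (A : MarkedWord) (a : Fin 3) (C : MarkedWord), W = A ++ .plain a :: C ∧ Z = A ++ .hat a :: C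

theorem plain_position_cases {A C A' C' : MarkedWord} {a a' : Fin 3}
    (h : A ++ .plain a :: C = A' ++ .plain a' :: C') :
    (A = A' ∧ a = a' ∧ C = C') ∨ (∃ B, A' = A ++ .plain a :: B ∧ C = B ++ .plain a' :: C') ∨
      ∃ B, A = A' ++ .plain a' :: B ∧ C' = B ++ .plain a :: C := by
  rcases List.append_eq_append_iff.1 h with ⟨D, rfl, h2⟩ | ⟨D, rfl, h2⟩ <;>
    rcases D with _ | ⟨l, D⟩ <;> simp at h2
  · simp [h2]
  · obtain ⟨rfl, rfl⟩ := h2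
    exact .inr (.inl ⟨D, rfl, rfl⟩)
  · simp [h2]
  · obtain ⟨rfl, rfl⟩ := h2
    exact .inr (.inr ⟨D, rfl, rfl⟩)

theorem MarksOne.hatConn {W Z Z' : MarkedWord} (h : MarksOne W Z) (h' : MarksOne W Z') {p : ℕ}
    (hZ : plainBraid Z = δ ^ p) (hZ' : plainBraid Z' = δ ^ p) : HatConn Z Z' := by
  obtain ⟨A, a, C, rfl, rfl⟩ := h
  obtain ⟨A', a', C', e, rfl⟩ := h'
  rcases plain_position_cases e with ⟨rfl, rfl, rfl⟩ | ⟨B, rfl, rfl⟩ | ⟨B, rfl, rfl⟩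
  · exact .refl _
  · exact HatExchange.hatConn ⟨A, B, C', a, a', rfl, by simp⟩ hZ hZ'
  · exact (HatExchange.hatConn ⟨A', B, C, a', a, rfl, by simp⟩ hZ' hZ).symm

/-- Putting a mark on a letter. -/
def MarkedLetter.mark : MarkedLetter → MarkedLetter
  | .plain i => .hat i
  | .hat i => .hat i

/-- The letter at position `j` of `W` is unmarked and, for the prefix `A` before it, it is conjugated
by `A'` to `σ_c`. Geometrically: the edge of the walk `W'` traversed at this letter has on its left
the same region of the tree as the edge from the base vertex in direction `c`. -/
def HasLabel (W : MarkedWord) (j : ℕ) (c : Fin 3) : Prop :=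
  ∃ (A : MarkedWord) (s : Fin 3) (C : MarkedWord), W = A ++ .plain s :: C ∧ A.length = j ∧
    plainBraid A * σ s = σ c * plainBraid A

/-- The word obtained by marking the letters at positions `i` and `j`. -/
def markPair (W : MarkedWord) (i j : ℕ) : MarkedWord :=
  (W.modify i MarkedLetter.mark).modify j MarkedLetter.mark

/-- `Z` is obtained from `W` by marking two letters with labels `c` and `c + 1`, in this order, the
first of which starts at the base vertex. If `W' = δ ^ (p + 1)` then `Z' = δ ^ p`. -/
def MarksPair (W Z : MarkedWord) : Prop :=
  ∃ (i j : ℕ) (c : Fin 3) (m : ℤ), i < j ∧ HasLabel W i c ∧ HasLabel W j (c + 1) ∧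
    plainBraid (W.take i) = δ ^ m ∧ Z = markPair W i j

theorem modify_mark_append (A C : MarkedWord) (a : Fin 3) :
    (A ++ .plain a :: C).modify A.length MarkedLetter.mark = A ++ .hat a :: C := by
  induction A with
  | nil => rfl
  | cons l A ih => simpa using ih

theorem markPair_append (A B D : MarkedWord) (s t : Fin 3) :
    markPair (A ++ .plain s :: (B ++ .plain t :: D)) A.length (A.length + 1 + B.length) =
      A ++ .hat s :: (B ++ .hat t :: D) := by
  rw [markPair, modify_mark_append]
  have := modify_mark_append (A ++ .hat s :: B) D t
  simpa [add_assoc, add_comm 1] using this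

theorem HasLabel.getElem? {W : MarkedWord} {j : ℕ} {c : Fin 3} (h : HasLabel W j c) :
    ∃ s, W[j]? = some (.plain s) := by
  obtain ⟨A, s, C, rfl, rfl, -⟩ := h
  exact ⟨s, by simp⟩

theorem HasLabel.unique {W : MarkedWord} {j : ℕ} {c d : Fin 3} (h : HasLabel W j c)
    (h' : HasLabel W j d) : c = d := by
  obtain ⟨A, s, C, rfl, rfl, h⟩ := h
  obtain ⟨A', s', C', e, e', h'⟩ := h'
  obtain ⟨rfl, e⟩ := List.append_inj e e'.symm
  obtain ⟨rfl, rfl⟩ : s = s' ∧ C = C' := by simpa using e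
  rw [h, mul_left_inj] at h'
  exact bklGen_injective h'

theorem marksOne_modify {W : MarkedWord} {j : ℕ} {s : Fin 3} (h : W[j]? = some (.plain s)) :
    MarksOne W (W.modify j MarkedLetter.mark) := by
  obtain ⟨hj, h⟩ := List.getElem?_eq_some_iff.1 h
  have e : W = W.take j ++ .plain s :: W.drop (j + 1) := by
    rw [← h]; simp
  refine ⟨W.take j, s, W.drop (j + 1), e, ?_⟩
  have := modify_mark_append (W.take j) (W.drop (j + 1)) s
  rw [← e, List.length_take, min_eq_left hj.le] at this
  exact this

theorem markPair_comm (W : MarkedWord) {i j : ℕ} (h : i ≠ j) : markPair W i j = markPair W j i := by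
  rw [markPair, markPair, List.modify_modify_ne _ _ _ h]

theorem markPair_hatConn_left {W : MarkedWord} {i j k : ℕ} {c d : Fin 3} (hj : HasLabel W j c)
    (hk : HasLabel W k d) (hij : i ≠ j) (hik : i ≠ k) {p : ℕ}
    (h1 : plainBraid (markPair W i j) = δ ^ p) (h2 : plainBraid (markPair W i k) = δ ^ p) :
    HatConn (markPair W i j) (markPair W i k) := by
  obtain ⟨s, hs⟩ := hj.getElem?
  obtain ⟨t, ht⟩ := hk.getElem?
  refine MarksOne.hatConn (marksOne_modify (s := s) ?_) (marksOne_modify (s := t) ?_) h1 h2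
  · simp [hs, hij]
  · simp [ht, hik]

theorem HasLabel.exists_eq {W : MarkedWord} {i j : ℕ} {c d : Fin 3} (hi : HasLabel W i c)
    (hj : HasLabel W j d) (hij : i < j) :
    ∃ (A : MarkedWord) (s : Fin 3) (B : MarkedWord) (t : Fin 3) (D : MarkedWord),
      W = A ++ .plain s :: (B ++ .plain t :: D) ∧ A.length = i ∧ A.length + 1 + B.length = j ∧
      plainBraid A * σ s = σ c * plainBraid A ∧
      plainBraid A * σ s * plainBraid B * σ t = σ d * (plainBraid A * σ s * plainBraid B) := by
  obtain ⟨A, s, C, rfl, rfl, h⟩ := hi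
  obtain ⟨A', t, D, e, rfl, h'⟩ := hj
  rcases plain_position_cases e with ⟨rfl, rfl, rfl⟩ | ⟨B, rfl, rfl⟩ | ⟨B, rfl, rfl⟩
  · simp at hij
  · refine ⟨A, s, B, t, D, by simp, rfl, by simp; ring, h, by simpa [mul_assoc] using h'⟩
  · simp at hij

theorem plainBraid_markPair {W : MarkedWord} {i j : ℕ} {c : Fin 3} (hi : HasLabel W i c)
    (hj : HasLabel W j (c + 1)) (hij : i < j) {p : ℕ} (hW : plainBraid W = δ ^ (p + 1)) :
    plainBraid (markPair W i j) = δ ^ p := by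
  obtain ⟨A, s, B, t, D, rfl, rfl, rfl, h1, h2⟩ := hi.exists_eq hj hij
  rw [markPair_append]
  simp only [plainBraid_append, plainBraid_cons_plain, plainBraid_cons_hat] at hW ⊢
  rw [← mul_right_inj δ, ← pow_succ', ← hW]
  calc δ * (plainBraid A * (plainBraid B * plainBraid D))
      = σ (c + 1) * (σ c * plainBraid A * plainBraid B) * plainBraid D := by
        rw [← bklGen_succ_mul c]; simp only [mul_assoc]
    _ = _ := by rw [← h1, ← h2]; simp only [mul_assoc]

/-- All the words obtained by marking a pair of letters as in `MarksPair` are connected: intermediate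
pairs are found among the letters of the two given pairs, except that, if the first letters of the
earlier and of the later pair have labels `c` and `c + 2`, also the letter between them is used at
which the walk returns to the base vertex; its label is `c + 1`. -/
theorem MarksPair.hatConn {W Z Z' : MarkedWord} (h : MarksPair W Z) (h' : MarksPair W Z') {p : ℕ}
    (hW : plainBraid W = δ ^ (p + 1)) : HatConn Z Z' := by
  obtain ⟨i, j, c, m, hij, hi, hj, hm, rfl⟩ := h
  obtain ⟨i', j', d, m', hij', hi', hj', hm', rfl⟩ := h'
  have H : ∀ {i j i' j' : ℕ} {c d : Fin 3} {m m' : ℤ}, i ≤ i' → i < j → HasLabel W i c →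
      HasLabel W j (c + 1) → plainBraid (W.take i) = δ ^ m → i' < j' → HasLabel W i' d →
      HasLabel W j' (d + 1) → plainBraid (W.take i') = δ ^ m' →
      HatConn (markPair W i j) (markPair W i' j') := by
    clear hij hi hj hm hij' hi' hj' hm'
    intro i j i' j' c d m m' hii hij hi hj hm hij' hi' hj' hm'
    have h1 := plainBraid_markPair hi hj hij hW
    have h2 := plainBraid_markPair hi' hj' hij' hW
    have hfin : ∀ c d : Fin 3, d = c ∨ d = c + 1 ∨ d = c + 2 := by decide
    have hright : ∀ {a b k : ℕ} {e f : Fin 3}, HasLabel W a e → HasLabel W b f → a ≠ k → b ≠ k →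
        plainBraid (markPair W a k) = δ ^ p → plainBraid (markPair W b k) = δ ^ p →
        HatConn (markPair W a k) (markPair W b k) := by
      intro a b k e f ha hb hak hbk h1 h2
      rw [markPair_comm W hak, markPair_comm W hbk] at *
      exact markPair_hatConn_left ha hb hak.symm hbk.symm h1 h2
    have hmid : ∀ {a b k : ℕ} {e f : Fin 3}, HasLabel W a e → HasLabel W b f → a ≠ k → k ≠ b →
        plainBraid (markPair W a k) = δ ^ p → plainBraid (markPair W k b) = δ ^ p →
        HatConn (markPair W a k) (markPair W k b) := by
      intro a b k e f ha hb hak hkb h1 h2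
      rw [markPair_comm W hkb] at *
      exact hright ha hb hak hkb.symm h1 h2
    rcases hfin c d with rfl | rfl | rfl
    · have h3 := plainBraid_markPair hi hj' (by omega) hW
      exact (markPair_hatConn_left hj hj' (by omega) (by omega) h1 h3).trans
        (hright hi hi' (by omega) (by omega) h3 h2)
    · have hne : i ≠ i' := by
        rintro rfl
        have := hi.unique hi'
        simp at this
      have h3 := plainBraid_markPair hi hi' (by omega) hW
      exact (markPair_hatConn_left hj hi' (by omega) (by omega) h1 h3).trans
        (hmid hi hj' (by omega) (by omega) h3 h2)
    · have hne : i ≠ i' := by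
        rintro rfl
        have := hi.unique hi'
        simp at this
      have main : ∀ {k : ℕ}, HasLabel W k (c + 1) → i < k → k < i' →
          HatConn (markPair W i j) (markPair W i' j') := by
        intro k hk hik hki
        have h3 := plainBraid_markPair hi hk hik hW
        have h4 := plainBraid_markPair hk (c := c + 1) (by rw [add_assoc]; exact hi') hki hW
        exact (markPair_hatConn_left hj hk (by omega) (by omega) h1 h3).trans
          ((hmid hi hi' (by omega) (by omega) h3 h4).trans
          (hmid hk hj' (by omega) (by omega) h4 h2))
      obtain ⟨A, s, B, t, D, rfl, rfl, rfl, e1, e2⟩ := hi.exists_eq hi' (by omega)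
      rw [List.take_left] at hm
      rw [show A ++ .plain s :: (B ++ .plain t :: D) = (A ++ .plain s :: B) ++ .plain t :: D by simp,
        show A.length + 1 + B.length = (A ++ MarkedLetter.plain s :: B).length by simp; ring,
        List.take_left] at hm'
      simp only [plainBraid_append, plainBraid_cons_plain] at hm'
      obtain ⟨B₁, r, B₂, n, rfl, e3, e4⟩ := exists_crossing_in (g := plainBraid A * σ s) (B := B)
        (c := c) (by rw [e1, hm, branch_bklGen_mul_zpow]) (by rw [mul_assoc, hm', branch_zpow]; simp)
      refine main (k := A.length + 1 + B₁.length) ⟨A ++ .plain s :: B₁, r, B₂ ++ .plain t :: D,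
        by simp, by simp; ring, ?_⟩ (by omega) (by simp)
      simp only [plainBraid_append, plainBraid_cons_plain]
      rw [← mul_assoc (plainBraid A), e4, e3, ← mul_assoc, bklGen_succ_mul, add_comm, zpow_one_add]
  rcases le_total i i' with hii | hii
  · exact H hii hij hi hj hm hij' hi' hj' hm'
  · exact (H hii hij' hi' hj' hm' hij hi hj hm).symm

theorem marksPair_of_eq {A B D : MarkedWord} {s t c : Fin 3} {m : ℤ} (hA : plainBraid A = δ ^ m)
    (hs : plainBraid A * σ s = σ c * plainBraid A)
    (ht : plainBraid A * σ s * plainBraid B * σ t =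
      σ (c + 1) * (plainBraid A * σ s * plainBraid B)) :
    MarksPair (A ++ .plain s :: (B ++ .plain t :: D)) (A ++ .hat s :: (B ++ .hat t :: D)) :=
  ⟨A.length, A.length + 1 + B.length, c, m, by omega, ⟨A, s, _, rfl, rfl, hs⟩,
    ⟨A ++ .plain s :: B, t, D, by simp, by simp; ring, by simpa [mul_assoc] using ht⟩,
    by simpa using hA, (markPair_append A B D s t).symm⟩

theorem MarksPair.plainBraid_eq {W Z : MarkedWord} (h : MarksPair W Z) {p : ℕ}
    (hW : plainBraid W = δ ^ (p + 1)) : plainBraid Z = δ ^ p := by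
  obtain ⟨i, j, c, m, hij, hi, hj, -, rfl⟩ := h
  exact plainBraid_markPair hi hj hij hW

/-! ### Compatibility of moves with marking additional letters -/

theorem MarksOne.plainBraid_eq {A C : MarkedWord} {s c : Fin 3} {p : ℕ}
    (hW : plainBraid (A ++ .plain s :: C) = σ c * δ ^ p)
    (hs : plainBraid A * σ s = σ c * plainBraid A) : plainBraid (A ++ .hat s :: C) = δ ^ p := by
  simp only [plainBraid_append, plainBraid_cons_plain, plainBraid_cons_hat] at hW ⊢
  rwa [← mul_assoc, hs, mul_assoc, mul_right_inj] at hW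

/-- If the walk `W'` ends next to the base vertex, then a move on `W` is compatible with marking a
letter on which the walk goes from the base vertex to its end. -/
theorem IsHurwitzMarkMove.exists_marksOne {W V : MarkedWord} (h : IsHurwitzMarkMove W V)
    {c : Fin 3} {p : ℕ} (hW : plainBraid W = σ c * δ ^ p) :
    ∃ Z Z', MarksOne W Z ∧ MarksOne V Z' ∧ plainBraid Z = δ ^ p ∧ plainBraid Z' = δ ^ p ∧
      HatConn Z Z' := by
  have hV := h.plainBraid_eq.symm.trans hW
  obtain ⟨A, B, C, x, y, q, rfl, rfl, h1, hq⟩ := h.exists_eq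
  have h1' : plainBraid A * plainBraid B * σ y = plainBraid A * σ x * plainBraid B := by
    rw [mul_assoc, ← h1, mul_assoc]
  by_cases hA : branch (plainBraid A) = some c
  · obtain ⟨A₁, s, A₂, m, rfl, e1, e2⟩ := exists_crossing_out (g := 1) (B := A) (c := c)
      (by simp [branch_one]) (by simpa using hA)
    rw [one_mul] at e1 e2
    have hs : plainBraid A₁ * σ s = σ c * plainBraid A₁ := by rw [e2, e1]
    simp only [List.append_assoc, List.cons_append] at hW hV ⊢
    have z1 := MarksOne.plainBraid_eq hW hs
    have z2 := MarksOne.plainBraid_eq hV hs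
    exact ⟨_, _, ⟨A₁, s, _, rfl, rfl⟩, ⟨A₁, s, _, rfl, rfl⟩, z1, z2,
      HatExchange.hatConn ⟨A₁ ++ .hat s :: A₂, B, C, x, y, by simp, by simp⟩ z1 z2⟩
  by_cases hE : branch (plainBraid A * σ x * plainBraid B) = some c
  · have hs : plainBraid A * σ x = σ c * plainBraid A := by
      rcases hq with hq | hq
      · rw [hq, branch_mul_zpow] at hE
        rcases branch_mul_bklGen (by rw [hE]; exact fun e => hA e.symm) with
          ⟨m, d, e1, e2⟩ | ⟨m, d, _, e1⟩
        · rw [e2, branch_bklGen_mul_zpow] at hE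
          obtain rfl : d = c := by simpa using hE
          rw [e2, e1]
        · rw [e1, branch_zpow] at hE; cases hE
      · rw [mul_assoc, hq, branch_mul_zpow] at hE
        exact absurd hE hA
    have z := MarksOne.plainBraid_eq hV hs
    refine ⟨A ++ .hat x :: (B ++ .hat y :: C), A ++ .hat x :: (B ++ .hat y :: C),
      ⟨A ++ .hat x :: B, y, C, by simp, by simp⟩, ⟨A, x, _, rfl, rfl⟩, z, z, .refl _⟩
  · obtain ⟨C₁, s, C₂, m, rfl, e1, e2⟩ := exists_crossing_out (c := c) (B := C) hE (by
      simp only [plainBraid_append, plainBraid_cons_plain, plainBraid_cons_hat] at hV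
      rw [mul_assoc, mul_assoc, hV, ← zpow_natCast, branch_bklGen_mul_zpow])
    rw [← e1] at e2
    have z1 : plainBraid (A ++ .hat x :: (B ++ .plain y :: (C₁ ++ .hat s :: C₂))) = δ ^ p := by
      have := MarksOne.plainBraid_eq (A := A ++ .hat x :: (B ++ .plain y :: C₁)) (C := C₂) (s := s)
        (c := c) (p := p) (by simpa using hW)
        (by simp only [plainBraid_append, plainBraid_cons_plain, plainBraid_cons_hat]
            simp only [← mul_assoc, h1'] at e2 ⊢
            exact e2)
      simpa using this
    have z2 : plainBraid (A ++ .plain x :: (B ++ .hat y :: (C₁ ++ .hat s :: C₂))) = δ ^ p := by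
      have := MarksOne.plainBraid_eq (A := A ++ .plain x :: (B ++ .hat y :: C₁)) (C := C₂) (s := s)
        (c := c) (p := p) (by simpa using hV)
        (by simp only [plainBraid_append, plainBraid_cons_plain, plainBraid_cons_hat]
            simp only [← mul_assoc] at e2 ⊢
            exact e2)
      simpa using this
    exact ⟨_, _, ⟨A ++ .hat x :: (B ++ .plain y :: C₁), s, C₂, by simp, by simp⟩,
      ⟨A ++ .plain x :: (B ++ .hat y :: C₁), s, C₂, by simp, by simp⟩, z1, z2,
      HatExchange.hatConn ⟨A, B, _, x, y, rfl, rfl⟩ z1 z2⟩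

theorem bklGen_succ_mul_zpow (c : Fin 3) (m : ℤ) :
    σ (c + 1) * (σ c * δ ^ m) = δ ^ (m + 1) := by
  rw [← mul_assoc, bklGen_succ_mul, add_comm, zpow_one_add]

/-- A move on a word whose walk `W'` is closed is compatible with marking a pair of letters. The pair
consists of the edges by which the walk leaves the base vertex and returns to it; since the two
positions of the mark that is moved are at the same vertex or at neighbouring vertices, such a pair
can be found either away from the moved mark, or it contains the letter which the move marks or
unmarks. -/
theorem IsHurwitzMarkMove.exists_marksPair {W V : MarkedWord} (h : IsHurwitzMarkMove W V)
    {p : ℕ} (hW : plainBraid W = δ ^ (p + 1)) :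
    ∃ Z Z', MarksPair W Z ∧ MarksPair V Z' ∧ HatConn Z Z' := by
  have hV := h.plainBraid_eq.symm.trans hW
  obtain ⟨A, B, C, x, y, q, rfl, rfl, h1, hq⟩ := h.exists_eq
  have h1' : plainBraid A * plainBraid B * σ y = plainBraid A * σ x * plainBraid B := by
    rw [mul_assoc, ← h1, mul_assoc]
  have hend : plainBraid A * σ x * plainBraid B * plainBraid C = δ ^ ((p + 1 : ℕ) : ℤ) := by
    simp only [plainBraid_append, plainBraid_cons_plain, plainBraid_cons_hat] at hV
    rw [mul_assoc, mul_assoc, hV, zpow_natCast]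
  -- the label of `y` in `W` is that of `x` in `V`
  have hxy : ∀ d, plainBraid A * σ x = σ d * plainBraid A →
      plainBraid A * plainBraid B * σ y = σ d * (plainBraid A * plainBraid B) := by
    intro d hd
    rw [h1', hd, mul_assoc]
  have close : ∀ Z Z', MarksPair (A ++ .hat x :: (B ++ .plain y :: C)) Z →
      MarksPair (A ++ .plain x :: (B ++ .hat y :: C)) Z' → HatExchange Z Z' →
      ∃ Z Z', MarksPair (A ++ .hat x :: (B ++ .plain y :: C)) Z ∧
        MarksPair (A ++ .plain x :: (B ++ .hat y :: C)) Z' ∧ HatConn Z Z' :=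
    fun Z Z' hZ hZ' he => ⟨Z, Z', hZ, hZ', he.hatConn (hZ.plainBraid_eq hW) (hZ'.plainBraid_eq hV)⟩
  rcases hA : branch (plainBraid A) with _ | e
  · obtain ⟨m, hm⟩ := branch_eq_none hA
    obtain ⟨f, hf⟩ := exists_bklDelta_zpow_mul m x
    rw [← hm] at hf
    rcases hq with hq | hq
    · obtain ⟨C₁, t, C₂, n, rfl, e1, e2⟩ := exists_crossing_in (c := f) (B := C)
        (g := plainBraid A * σ x * plainBraid B)
        (by rw [hq, branch_mul_zpow, hf, hm, branch_bklGen_mul_zpow])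
        (by rw [hend, branch_zpow]; simp)
      refine ⟨A ++ .hat x :: (B ++ .hat y :: (C₁ ++ .hat t :: C₂)), _, ?_, ?_, .refl _⟩
      · have := marksPair_of_eq (A := A ++ .hat x :: B) (B := C₁) (D := C₂) (s := y) (t := t) (c := f)
          (m := m + q) (by simp [hm, hq, zpow_add]) (by simpa using hxy f hf)
          (by simp only [plainBraid_append, plainBraid_cons_hat]
              rw [h1', e2, e1, bklGen_succ_mul_zpow])
        simpa using this
      · have := marksPair_of_eq (A := A) (B := B ++ .hat y :: C₁) (D := C₂) (s := x) (t := t) (c := f)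
          (m := m) hm hf
          (by simp only [plainBraid_append, plainBraid_cons_hat]
              rw [← mul_assoc (plainBraid A * σ x), e2, e1, bklGen_succ_mul_zpow])
        simpa using this
    · obtain ⟨B₁, t, B₂, n, rfl, e1, e2⟩ := exists_crossing_in (c := f) (B := B)
        (g := plainBraid A * σ x) (by rw [hf, hm, branch_bklGen_mul_zpow])
        (by rw [mul_assoc, hq, hm, ← zpow_add, branch_zpow]; simp)
      have e3 : plainBraid A * plainBraid B₁ = δ ^ n := by
        rw [hf, mul_assoc, mul_right_inj] at e1
        exact e1
      have e4 : plainBraid A * plainBraid B₁ * σ t = σ (f + 2) * (plainBraid A * plainBraid B₁) := by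
        rw [hf, mul_assoc, mul_assoc, ← mul_assoc (plainBraid A), e3] at e2
        rw [e3, ← mul_right_inj (σ f), e2, ← mul_assoc, bklGen_mul_bklGen_add_two, add_comm,
          zpow_one_add]
      refine ⟨A ++ .hat x :: (B₁ ++ .hat t :: (B₂ ++ .hat y :: C)), _, ?_, ?_, .refl _⟩
      · have hff : f + 2 + 1 = f := by rw [add_assoc]; simp
        have := marksPair_of_eq (A := A ++ .hat x :: B₁) (B := B₂) (D := C) (s := t) (t := y)
          (c := f + 2) (m := n) (by simpa using e3) (by simpa using e4)
          (by have := hxy f hf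
              simp only [plainBraid_append, plainBraid_cons_hat, plainBraid_cons_plain] at this ⊢
              rw [hff]
              simpa only [mul_assoc] using this)
        simpa using this
      · have := marksPair_of_eq (A := A) (B := B₁) (D := B₂ ++ .hat y :: C) (s := x) (t := t) (c := f)
          (m := m) hm hf (by rw [e2, e1, bklGen_succ_mul_zpow])
        simpa using this
  · obtain ⟨A₁, s, A₂, m, rfl, e1, e2⟩ := exists_crossing_out (g := 1) (B := A) (c := e)
      (by simp [branch_one]) (by simpa using hA)
    rw [one_mul] at e1 e2
    have hs : plainBraid A₁ * σ s = σ e * plainBraid A₁ := by rw [e2, e1]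
    by_cases hE : branch (plainBraid (A₁ ++ .plain s :: A₂) * σ x * plainBraid B) = some e
    · obtain ⟨C₁, t, C₂, n, rfl, e3, e4⟩ := exists_crossing_in (B := C) hE
        (by rw [hend, branch_zpow]; simp)
      refine close (A₁ ++ .hat s :: (A₂ ++ .hat x :: (B ++ .plain y :: (C₁ ++ .hat t :: C₂))))
        (A₁ ++ .hat s :: (A₂ ++ .plain x :: (B ++ .hat y :: (C₁ ++ .hat t :: C₂)))) ?_ ?_
        ⟨A₁ ++ .hat s :: A₂, B, C₁ ++ .hat t :: C₂, x, y, by simp, by simp⟩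
      · have := marksPair_of_eq (A := A₁) (B := A₂ ++ .hat x :: (B ++ .plain y :: C₁)) (D := C₂) (s := s)
          (t := t) (c := e) (m := m) e1 hs
          (by have hc : plainBraid A₁ * σ s * plainBraid (A₂ ++ .hat x :: (B ++ .plain y :: C₁)) =
                  plainBraid (A₁ ++ .plain s :: A₂) * plainBraid B * σ y * plainBraid C₁ := by
                simp [mul_assoc]
              rw [hc, h1', e4, e3, bklGen_succ_mul_zpow])
        simpa using this
      · have := marksPair_of_eq (A := A₁) (B := A₂ ++ .plain x :: (B ++ .hat y :: C₁)) (D := C₂) (s := s)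
          (t := t) (c := e) (m := m) e1 hs
          (by have hc : plainBraid A₁ * σ s * plainBraid (A₂ ++ .plain x :: (B ++ .hat y :: C₁)) =
                  plainBraid (A₁ ++ .plain s :: A₂) * σ x * plainBraid B * plainBraid C₁ := by
                simp [mul_assoc]
              rw [hc, e4, e3, bklGen_succ_mul_zpow])
        simpa using this
    · -- the letter `x` brings the walk back to the base vertex
      have hx : plainBraid (A₁ ++ .plain s :: A₂) * σ x =
          σ (e + 1) * plainBraid (A₁ ++ .plain s :: A₂) := by
        rcases hq with hq | hq
        · rw [hq, branch_mul_zpow] at hE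
          rcases branch_mul_bklGen (by rw [hA]; exact hE) with ⟨n, d, e3, _⟩ | ⟨n, d, e3, e4⟩
          · rw [e3, branch_zpow] at hA; cases hA
          · rw [e3, branch_bklGen_mul_zpow] at hA
            obtain rfl : d = e := by simpa using hA
            rw [e4, e3, bklGen_succ_mul_zpow]
        · rw [mul_assoc, hq, branch_mul_zpow] at hE
          exact absurd hA hE
      refine ⟨A₁ ++ .hat s :: (A₂ ++ .hat x :: (B ++ .hat y :: C)), _, ?_, ?_, .refl _⟩
      · have := marksPair_of_eq (A := A₁) (B := A₂ ++ .hat x :: B) (D := C) (s := s)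
          (t := y) (c := e) (m := m) e1 hs
          (by have := hxy _ hx
              simpa [mul_assoc] using this)
        simpa using this
      · have := marksPair_of_eq (A := A₁) (B := A₂) (D := B ++ .hat y :: C) (s := s)
          (t := x) (c := e) (m := m) e1 hs (by simpa [mul_assoc] using hx)
        simpa using this

/-- The same compatibility for a move which changes one of the letters of the pair. -/
theorem exists_marksPair_marksOne {B D : MarkedWord} {x y : Fin 3} {p : ℕ} {q : ℤ}
    (hW : plainBraid (B ++ .plain y :: D) = δ ^ (p + 1))
    (h1 : σ x * plainBraid B = plainBraid B * σ y)
    (hq : plainBraid B = δ ^ q ∨ σ x * plainBraid B = δ ^ q) :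
    ∃ Z, MarksPair (B ++ .plain y :: D) Z ∧ MarksOne (B ++ .hat y :: D) Z := by
  rcases hq with hq | hq
  · obtain ⟨D₁, t, D₂, m, rfl, e1, e2⟩ := exists_crossing_in (g := plainBraid B * σ y) (B := D)
      (c := x) (by rw [← h1, hq, branch_bklGen_mul_zpow])
      (by simp only [plainBraid_append, plainBraid_cons_plain] at hW
          rw [mul_assoc, hW, ← zpow_natCast, branch_zpow]; simp)
    exact ⟨_, marksPair_of_eq hq h1.symm (by rw [e2, e1, bklGen_succ_mul_zpow]),
      ⟨B ++ .hat y :: D₁, t, D₂, by simp, by simp⟩⟩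
  · have hB : plainBraid B = σ (x + 2) * δ ^ (q - 1) := by
      rw [← mul_right_inj (σ x), hq, ← mul_assoc, bklGen_mul_bklGen_add_two, ← zpow_one_add]
      congr 1; ring
    obtain ⟨B₁, t, B₂, m, rfl, e1, e2⟩ := exists_crossing_out (g := 1) (B := B) (c := x + 2)
      (by simp [branch_one]) (by rw [one_mul, hB, branch_bklGen_mul_zpow])
    rw [one_mul] at e1 e2
    refine ⟨B₁ ++ .hat t :: (B₂ ++ .hat y :: D), ?_, ⟨B₁, t, B₂ ++ .hat y :: D, by simp, by simp⟩⟩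
    have := marksPair_of_eq (A := B₁) (B := B₂) (D := D) (s := t) (t := y) (c := x + 2) (m := m) e1
      (by rw [e2, e1]) (by
        have h3 : x + 2 + 1 = x := by rw [add_assoc]; simp
        rw [h3]
        simpa [mul_assoc] using h1.symm)
    simpa using this

theorem exists_first_plain {W : MarkedWord} {p : ℕ} (hW : plainBraid W = δ ^ (p + 1)) :
    ∃ (A : MarkedWord) (s : Fin 3) (C : MarkedWord), W = A ++ .plain s :: C ∧ plainBraid A = 1 := by
  induction W with
  | nil =>
    exfalso
    have : (δ ^ (0 : ℤ) : Braid3) = δ ^ ((p + 1 : ℕ) : ℤ) := by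
      rw [zpow_natCast, ← hW]; simp
    have := bklDelta_zpow_injective this
    omega
  | cons l W ih =>
    rcases l with s | i
    · exact ⟨[], s, W, rfl, rfl⟩
    · obtain ⟨A, s, C, rfl, h⟩ := ih hW
      exact ⟨.hat i :: A, s, C, rfl, h⟩

theorem exists_excursion {W : MarkedWord} {p : ℕ} (hW : plainBraid W = δ ^ (p + 1)) :
    ∃ (A : MarkedWord) (s : Fin 3) (B : MarkedWord) (t : Fin 3) (D : MarkedWord) (m : ℤ),
      W = A ++ .plain s :: (B ++ .plain t :: D) ∧ plainBraid A = 1 ∧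
      σ s * plainBraid B = σ s * δ ^ m ∧ σ s * plainBraid B * σ t = δ ^ (m + 1) := by
  obtain ⟨A, s, C, rfl, hA⟩ := exists_first_plain hW
  simp only [plainBraid_append, plainBraid_cons_plain, hA, one_mul] at hW
  obtain ⟨B, t, D, m, rfl, e1, e2⟩ := exists_crossing_in (g := σ s) (B := C) (c := s)
    (by simpa using branch_bklGen_mul_zpow s 0) (by rw [hW, ← zpow_natCast, branch_zpow]; simp)
  exact ⟨A, s, B, t, D, m, rfl, hA, e1, e2⟩

theorem exists_marksPair {W : MarkedWord} {p : ℕ} (hW : plainBraid W = δ ^ (p + 1)) :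
    ∃ Z, MarksPair W Z := by
  obtain ⟨A, s, B, t, D, m, rfl, hA, e1, e2⟩ := exists_excursion hW
  exact ⟨_, marksPair_of_eq (c := s) (m := 0) (by simpa using hA) (by rw [hA]; simp)
    (by rw [hA, one_mul, e2, e1, bklGen_succ_mul_zpow])⟩

theorem exists_marksOne {W : MarkedWord} {c : Fin 3} {p : ℕ} (hW : plainBraid W = σ c * δ ^ p) :
    ∃ Z, MarksOne W Z ∧ plainBraid Z = δ ^ p := by
  obtain ⟨A, s, C, m, rfl, e1, e2⟩ := exists_crossing_out (g := 1) (B := W) (c := c)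
    (by simp [branch_one]) (by rw [one_mul, hW, ← zpow_natCast, branch_bklGen_mul_zpow])
  rw [one_mul] at e1 e2
  exact ⟨_, ⟨A, s, C, rfl, rfl⟩, MarksOne.plainBraid_eq hW (by rw [e2, e1])⟩

/-! ### Deleting a subword `δ` -/

/-- `W` begins with the letters `σ_{i+1}, σ_i`, marked or not, and `Z` is obtained by deleting them and
marking as many of the remaining letters as there were marks on the two deleted ones. -/
inductive DeletesDelta (i : Fin 3) : MarkedWord → MarkedWord → Prop
  | plain_plain (Z : MarkedWord) : DeletesDelta i (.plain (i + 1) :: .plain i :: Z) Z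
  | hat_plain {W Z : MarkedWord} (h : MarksOne W Z) :
      DeletesDelta i (.hat (i + 1) :: .plain i :: W) Z
  | plain_hat {W Z : MarkedWord} (h : MarksOne W Z) :
      DeletesDelta i (.plain (i + 1) :: .hat i :: W) Z
  | hat_hat {W Z : MarkedWord} (h : MarksPair W Z) :
      DeletesDelta i (.hat (i + 1) :: .hat i :: W) Z

theorem plainBraid_of_bklGen_mul {i : Fin 3} {W : MarkedWord} {p : ℕ}
    (h : σ i * plainBraid W = δ ^ (p + 1)) : plainBraid W = σ (i + 2) * δ ^ p := by
  rw [← mul_right_inj (σ i), h, ← mul_assoc, bklGen_mul_bklGen_add_two, pow_succ']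

theorem plainBraid_of_bklGen_succ_mul {i : Fin 3} {W : MarkedWord} {p : ℕ}
    (h : σ (i + 1) * plainBraid W = δ ^ (p + 1)) : plainBraid W = σ i * δ ^ p := by
  rw [← mul_right_inj (σ (i + 1)), h, ← mul_assoc, bklGen_succ_mul, pow_succ']

theorem plainBraid_of_delta_mul {i : Fin 3} {W : MarkedWord} {p : ℕ}
    (h : σ (i + 1) * (σ i * plainBraid W) = δ ^ (p + 1)) : plainBraid W = δ ^ p := by
  rw [← mul_right_inj δ, ← pow_succ', ← h, ← mul_assoc, bklGen_succ_mul]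

theorem DeletesDelta.hatConn {i : Fin 3} {W Z Z' : MarkedWord} (h : DeletesDelta i W Z)
    (h' : DeletesDelta i W Z') {p : ℕ} (hW : plainBraid W = δ ^ (p + 1))
    (hZ : plainBraid Z = δ ^ p) (hZ' : plainBraid Z' = δ ^ p) : HatConn Z Z' := by
  rcases h with _ | h | h | h <;> rcases h' with _ | h' | h' | h'
  · exact .refl _
  · exact h.hatConn h' hZ hZ'
  · exact h.hatConn h' hZ hZ'
  · exact h.hatConn h' (by simpa using hW)

theorem exists_cons_cons_of_forgetHats {W : MarkedWord} {a b : Fin 3} {U : List (Fin 3)}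
    (h : forgetHats W = a :: b :: U) : ∃ W₀, forgetHats W₀ = U ∧
      (W = .plain a :: .plain b :: W₀ ∨ W = .hat a :: .plain b :: W₀ ∨
        W = .plain a :: .hat b :: W₀ ∨ W = .hat a :: .hat b :: W₀) := by
  rcases W with _ | ⟨l, _ | ⟨l', W⟩⟩
  · simp [forgetHats] at h
  · rcases l with l | l <;> simp [forgetHats] at h
  · refine ⟨W, ?_, ?_⟩ <;> rcases l with l | l <;> rcases l' with l' | l' <;>
      simp [forgetHats] at h <;> simp [h]

theorem exists_deletesDelta {i : Fin 3} {W : MarkedWord} {U : List (Fin 3)} {p : ℕ}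
    (hU : forgetHats W = (i + 1) :: i :: U) (hW : plainBraid W = δ ^ (p + 1)) :
    ∃ Z, DeletesDelta i W Z ∧ plainBraid Z = δ ^ p := by
  obtain ⟨W₀, -, rfl | rfl | rfl | rfl⟩ := exists_cons_cons_of_forgetHats hU
  · exact ⟨W₀, .plain_plain _, plainBraid_of_delta_mul (by simpa using hW)⟩
  · obtain ⟨Z, h, hZ⟩ := exists_marksOne (plainBraid_of_bklGen_mul (by simpa using hW))
    exact ⟨Z, .hat_plain h, hZ⟩
  · obtain ⟨Z, h, hZ⟩ := exists_marksOne (plainBraid_of_bklGen_succ_mul (by simpa using hW))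
    exact ⟨Z, .plain_hat h, hZ⟩
  · have hW' : plainBraid W₀ = δ ^ (p + 1) := by simpa using hW
    obtain ⟨Z, h⟩ := exists_marksPair hW'
    exact ⟨Z, .hat_hat h, h.plainBraid_eq hW'⟩

theorem IsHurwitzMarkMove.exists_deletesDelta {i : Fin 3} {W V : MarkedWord} {U : List (Fin 3)}
    {p : ℕ} (h : IsHurwitzMarkMove W V) (hU : forgetHats W = (i + 1) :: i :: U)
    (hW : plainBraid W = δ ^ (p + 1)) :
    ∃ Z Z', DeletesDelta i W Z ∧ DeletesDelta i V Z' ∧ plainBraid Z = δ ^ p ∧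
      plainBraid Z' = δ ^ p ∧ HatConn Z Z' := by
  have hV := h.plainBraid_eq.symm.trans hW
  obtain ⟨A, B, C, x, y, q, rfl, rfl, h1, hq⟩ := h.exists_eq
  rcases A with _ | ⟨l, _ | ⟨l', A⟩⟩
  · simp only [List.nil_append] at hU hW hV ⊢
    rcases B with _ | ⟨l, B⟩
    · exfalso
      simp [forgetHats] at hU
      obtain ⟨rfl, rfl, -⟩ := hU
      simp only [plainBraid_nil, mul_one, one_mul] at h1
      have := bklGen_injective h1
      simp at this
    · rcases l with l | l
      · simp [forgetHats] at hU
        obtain ⟨rfl, rfl, -⟩ := hU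
        have hZ : plainBraid (B ++ .hat y :: C) = δ ^ p :=
          plainBraid_of_delta_mul (i := l) (by simpa using hV)
        exact ⟨_, _, .hat_plain ⟨B, y, C, rfl, rfl⟩, .plain_plain _, hZ, hZ, .refl _⟩
      · simp [forgetHats] at hU
        obtain ⟨rfl, rfl, -⟩ := hU
        have hW' : plainBraid (B ++ .plain y :: C) = δ ^ (p + 1) := by simpa using hW
        obtain ⟨Z, hZ1, hZ2⟩ := exists_marksPair_marksOne hW' (by simpa using h1) (by simpa using hq)
        have hZ := hZ1.plainBraid_eq hW'
        exact ⟨Z, Z, .hat_hat hZ1, .plain_hat hZ2, hZ, hZ, .refl _⟩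
  · simp only [List.cons_append, List.nil_append] at hU hW hV ⊢
    rcases l with l | l
    · simp [forgetHats] at hU
      obtain ⟨rfl, rfl, -⟩ := hU
      have hZ : plainBraid (B ++ .hat y :: C) = δ ^ p :=
        plainBraid_of_delta_mul (i := x) (by simpa using hV)
      exact ⟨_, _, .plain_hat ⟨B, y, C, rfl, rfl⟩, .plain_plain _, hZ, hZ, .refl _⟩
    · simp [forgetHats] at hU
      obtain ⟨rfl, rfl, -⟩ := hU
      have hW' : plainBraid (B ++ .plain y :: C) = δ ^ (p + 1) := by simpa using hW
      obtain ⟨Z, hZ1, hZ2⟩ := exists_marksPair_marksOne hW' h1 hq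
      have hZ := hZ1.plainBraid_eq hW'
      exact ⟨Z, Z, .hat_hat hZ1, .hat_plain hZ2, hZ, hZ, .refl _⟩
  · have hm := isHurwitzMarkMove_of_zpow (A := A) (C := C) h1 hq
    simp only [List.cons_append] at hU hW hV ⊢
    generalize A ++ .hat x :: (B ++ .plain y :: C) = W₀ at *
    generalize A ++ .plain x :: (B ++ .hat y :: C) = V₀ at *
    rcases l with l | l <;> rcases l' with l' | l' <;> simp [forgetHats] at hU <;>
      obtain ⟨rfl, rfl, -⟩ := hU
    · exact ⟨W₀, V₀, .plain_plain _, .plain_plain _, plainBraid_of_delta_mul (by simpa using hW),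
        plainBraid_of_delta_mul (by simpa using hV), .of_move hm⟩
    · obtain ⟨Z, Z', e1, e2, e3⟩ :=
        hm.exists_marksOne (plainBraid_of_bklGen_succ_mul (by simpa using hW))
      exact ⟨Z, Z', .plain_hat e1, .plain_hat e2, e3⟩
    · obtain ⟨Z, Z', e1, e2, e3⟩ :=
        hm.exists_marksOne (plainBraid_of_bklGen_mul (by simpa using hW))
      exact ⟨Z, Z', .hat_plain e1, .hat_plain e2, e3⟩
    · have hW' : plainBraid W₀ = δ ^ (p + 1) := by simpa using hW
      obtain ⟨Z, Z', e1, e2, e3⟩ := hm.exists_marksPair hW'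
      exact ⟨Z, Z', .hat_hat e1, .hat_hat e2, e1.plainBraid_eq hW',
        e2.plainBraid_eq (hm.plainBraid_eq.symm.trans hW'), e3⟩

theorem HatConn.of_cons_delta {i : Fin 3} {Z Z' : MarkedWord} {p : ℕ} (hp : plainBraid Z = δ ^ p)
    (h : HatConn (.plain (i + 1) :: .plain i :: Z) (.plain (i + 1) :: .plain i :: Z')) :
    HatConn Z Z' := by
  have key : ∀ {W V : MarkedWord}, HatConn W V → ∀ {U : List (Fin 3)},
      forgetHats W = (i + 1) :: i :: U → plainBraid W = δ ^ (p + 1) →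
      ∀ Z Z', DeletesDelta i W Z → DeletesDelta i V Z' → plainBraid Z = δ ^ p →
      plainBraid Z' = δ ^ p → HatConn Z Z' := by
    intro W V h
    induction h with
    | rel W V h =>
      intro U hU hW Z Z' d d' hZ hZ'
      obtain ⟨Y, Y', e, e', hY, hY', hc⟩ := h.exists_deletesDelta hU hW
      exact (d.hatConn e hW hZ hY).trans
        (hc.trans (e'.hatConn d' (h.plainBraid_eq.symm.trans hW) hY' hZ'))
    | refl W =>
      intro U hU hW Z Z' d d' hZ hZ'
      exact d.hatConn d' hW hZ hZ'
    | symm W V h ih =>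
      intro U hU hW Z Z' d d' hZ hZ'
      exact (ih ((forgetHats_eq h).trans hU) ((plainBraid_eq h).trans hW) Z' Z d' d hZ' hZ).symm
    | trans W V Y h _ ih1 ih2 =>
      intro U hU hW Z Z' d d' hZ hZ'
      have hU' := (forgetHats_eq h).symm.trans hU
      have hW' := (plainBraid_eq h).symm.trans hW
      obtain ⟨X, e, hX⟩ := _root_.exists_deletesDelta hU' hW'
      exact (ih1 hU hW Z X d e hZ hX).trans (ih2 hU' hW' X Z' e d' hX hZ')
  have hW : plainBraid (.plain (i + 1) :: .plain i :: Z) = δ ^ (p + 1) := by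
    simp only [plainBraid_cons_plain, hp]
    rw [← mul_assoc, bklGen_succ_mul, pow_succ']
  refine key h (U := forgetHats Z) rfl hW Z Z' (.plain_plain _) (.plain_plain _) hp ?_
  have hV := h.plainBraid_eq.symm.trans hW
  exact plainBraid_of_delta_mul (by simpa using hV)

theorem exists_hatConn_cons_delta {i : Fin 3} {W : MarkedWord} {U : List (Fin 3)} {p : ℕ}
    (hU : forgetHats W = (i + 1) :: i :: U) (hW : plainBraid W = δ ^ (p + 1)) :
    ∃ Z, HatConn W (.plain (i + 1) :: .plain i :: Z) := by
  have hat_plain : ∀ W₀ : MarkedWord, σ i * plainBraid W₀ = δ ^ (p + 1) →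
      ∃ Z, HatConn (.hat (i + 1) :: .plain i :: W₀) (.plain (i + 1) :: .plain i :: Z) := by
    intro W₀ h
    obtain ⟨B, t, D, m, rfl, e1, e2⟩ := exists_crossing_in (g := σ i) (B := W₀) (c := i)
      (by simpa using branch_bklGen_mul_zpow i 0) (by rw [h, ← zpow_natCast, branch_zpow]; simp)
    have e3 : σ (i + 1) * (σ i * plainBraid B) = δ ^ (m + 1) := by rw [e1, bklGen_succ_mul_zpow]
    exact ⟨_, .of_move (isHurwitzMarkMove_of_zpow (A := []) (B := .plain i :: B) (y := t) (C := D)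
      (q := m + 1) (by simpa [e2] using e3) (.inr (by simpa using e3)))⟩
  have plain_hat : ∀ W₀ : MarkedWord, σ (i + 1) * plainBraid W₀ = δ ^ (p + 1) →
      ∃ Z, HatConn (.plain (i + 1) :: .hat i :: W₀) (.plain (i + 1) :: .plain i :: Z) := by
    intro W₀ h
    obtain ⟨B, t, D, m, rfl, e1, e2⟩ := exists_crossing_in (g := σ (i + 1)) (B := W₀) (c := i + 1)
      (by simpa using branch_bklGen_mul_zpow (i + 1) 0)
      (by rw [h, ← zpow_natCast, branch_zpow]; simp)
    have e3 : plainBraid B = δ ^ m := mul_left_cancel e1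
    have e4 : σ i * plainBraid B = plainBraid B * σ t := by
      rw [← mul_right_inj (σ (i + 1)), ← mul_assoc _ _ (σ t), e2, e3, bklGen_succ_mul_zpow]
    exact ⟨_, .of_move (isHurwitzMarkMove_of_zpow (A := [.plain (i + 1)]) (B := B) (y := t) (C := D)
      (q := m) e4 (.inl e3))⟩
  obtain ⟨W₀, -, rfl | rfl | rfl | rfl⟩ := exists_cons_cons_of_forgetHats hU
  · exact ⟨W₀, .refl _⟩
  · exact hat_plain W₀ (by simpa using hW)
  · exact plain_hat W₀ (by simpa using hW)
  · have hW' : plainBraid W₀ = δ ^ (p + 1) := by simpa using hW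
    obtain ⟨A, s, B, t, D, m, rfl, hA, e1, e2⟩ := exists_excursion hW'
    have hfin : ∀ i s : Fin 3, s = i ∨ s = i + 1 ∨ s = i + 2 := by decide
    rcases hfin i s with rfl | rfl | rfl
    · have h1 := HatConn.of_move (isHurwitzMarkMove_of_zpow (A := [.hat (s + 1)]) (B := A) (x := s)
        (y := s) (C := B ++ .plain t :: D) (q := 0) (by rw [hA]; simp) (.inl (by rw [hA]; simp)))
      obtain ⟨Z, h2⟩ := hat_plain (A ++ .hat s :: (B ++ .plain t :: D)) (by
        have := h1.plainBraid_eq.symm.trans hW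
        simpa using this)
      exact ⟨Z, h1.trans h2⟩
    · have h1 := HatConn.of_move (isHurwitzMarkMove_of_zpow (A := []) (B := .hat i :: A) (x := i + 1)
        (y := i + 1) (C := B ++ .plain t :: D) (q := 0) (by simp [hA]) (.inl (by simp [hA])))
      obtain ⟨Z, h2⟩ := plain_hat (A ++ .hat (i + 1) :: (B ++ .plain t :: D)) (by
        have := h1.plainBraid_eq.symm.trans hW
        simpa using this)
      exact ⟨Z, h1.trans h2⟩
    · have e3 : σ i * (σ (i + 2) * plainBraid B) = δ ^ (m + 1) := by
        rw [e1, ← mul_assoc, bklGen_mul_bklGen_add_two, add_comm, zpow_one_add]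
      have h1 := HatConn.of_move (isHurwitzMarkMove_of_zpow (A := [.hat (i + 1)])
        (B := A ++ .plain (i + 2) :: B) (x := i) (y := t) (C := D) (q := m + 1)
        (by simp only [plainBraid_append, plainBraid_cons_plain, hA, one_mul]; rw [e3, e2])
        (.inr (by simp only [plainBraid_append, plainBraid_cons_plain, hA, one_mul]; rw [e3])))
      simp only [List.append_assoc, List.cons_append, List.nil_append] at h1
      obtain ⟨Z, h2⟩ := hat_plain (A ++ .plain (i + 2) :: (B ++ .hat t :: D)) (by
        have := h1.plainBraid_eq.symm.trans hW
        simpa using this)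
      exact ⟨Z, h1.trans h2⟩

theorem hatConn_twist_iff {W V : MarkedWord} (n : ℕ) :
    HatConn (twist n W) (twist n V) ↔ HatConn W V := ⟨HatConn.of_twist, fun h => h.twist n⟩

/-- Connectedness does not change when an unmarked subword `δ` is deleted. -/
theorem hatConn_delta_iff {i : Fin 3} {A C A' C' : MarkedWord} {p : ℕ} (hA : A.length = A'.length)
    (hC : C.length = C'.length)
    (hp : plainBraid (A ++ .plain (i + 1) :: .plain i :: C) = δ ^ (p + 1)) :
    HatConn (A ++ .plain (i + 1) :: .plain i :: C) (A' ++ .plain (i + 1) :: .plain i :: C') ↔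
      HatConn (A ++ twist 2 C) (A' ++ twist 2 C') := by
  rw [hatConn_append_comm_iff hA (by simpa using hC) hp]
  have h1 := plainBraid_append_twist hp
  have h2 : plainBraid (C ++ twist (p + 1) A) = δ ^ p := by
    refine plainBraid_of_delta_mul (i := i) ?_
    simpa [mul_assoc] using h1
  have h3 : HatConn (.plain (i + 1) :: .plain i :: C ++ twist (p + 1) A)
      (.plain (i + 1) :: .plain i :: C' ++ twist (p + 1) A') ↔
      HatConn (C ++ twist (p + 1) A) (C' ++ twist (p + 1) A') :=
    ⟨fun h => HatConn.of_cons_delta h2 h,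
      fun h => h.append_left [.plain (i + 1), .plain i]⟩
  rw [h3, hatConn_append_comm_iff hC (by simpa using hA) h2]
  have e : ∀ C, twist p C = twist (p + 1) (twist 2 C) := by
    intro C
    have := twist_three_mul 1 C
    rw [twist_twist, show p + 1 + 2 = p + 3 * 1 by ring, ← twist_twist, this]
  rw [e, e, ← twist_append, ← twist_append, hatConn_twist_iff]

theorem exists_append_of_forgetHats {W : MarkedWord} {U V : List (Fin 3)}
    (h : forgetHats W = U ++ V) : ∃ A B, W = A ++ B ∧ forgetHats A = U ∧ forgetHats B = V := by
  refine ⟨W.take U.length, W.drop U.length, (List.take_append_drop _ _).symm, ?_⟩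
  have hl : U.length ≤ W.length := by rw [← forgetHats_length, h]; simp
  rw [← List.take_append_drop U.length W, forgetHats_append] at h
  exact List.append_inj h (by simpa using hl)

/-- The marks can be moved away from a subword `δ` of a word with `W' = δ ^ (p + 1)`. -/
theorem exists_hatConn_delta {i : Fin 3} {W : MarkedWord} {U V : List (Fin 3)} {p : ℕ}
    (hU : forgetHats W = U ++ (i + 1) :: i :: V) (hW : plainBraid W = δ ^ (p + 1)) :
    ∃ A C : MarkedWord, A.length = U.length ∧ C.length = V.length ∧
      HatConn W (A ++ .plain (i + 1) :: .plain i :: C) := by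
  obtain ⟨A₀, W₁, rfl, rfl, hW₁⟩ := exists_append_of_forgetHats hU
  have h1 := plainBraid_append_twist hW
  obtain ⟨Z, hZ⟩ := exists_hatConn_cons_delta (i := i)
    (U := V ++ forgetHats (twist (p + 1) A₀)) (by simp [hW₁]) h1
  have hlW : W₁.length = V.length + 2 := by rw [← forgetHats_length, hW₁]; simp
  have hl := hZ.length_eq
  simp [hlW] at hl
  have hZ' : HatConn (W₁ ++ twist (p + 1) A₀)
      ((.plain (i + 1) :: .plain i :: Z.take V.length) ++ Z.drop V.length) := by simpa using hZ
  have hlen : (Z.take V.length).length = V.length := by simp; omega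
  have h2 := (hZ'.rotate_append (by simp [hlW, hlen]) h1).twist (2 * (p + 1))
  simp only [twist_append, twist_twist] at h2
  rw [show 2 * (p + 1) + (p + 1) = 3 * (p + 1) by ring, twist_three_mul, twist_three_mul,
    twist_three_mul] at h2
  exact ⟨twist (2 * (p + 1)) (Z.drop V.length), Z.take V.length, by simp; omega, hlen, h2⟩

/-! ### Reduction of marked words and its confluence -/

/-- The braid represented by a marked word when the marks are forgotten. -/
def totalBraid (W : MarkedWord) : Braid3 := braidOf (forgetHats W)

theorem totalBraid_append (V W : MarkedWord) :
    totalBraid (V ++ W) = totalBraid V * totalBraid W := by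
  simp [totalBraid, braidOf_append]

theorem totalBraid_cons_plain (i : Fin 3) (W : MarkedWord) :
    totalBraid (.plain i :: W) = σ i * totalBraid W := by
  simp [totalBraid, forgetHats, braidOf_cons]

theorem totalBraid_cons_hat (i : Fin 3) (W : MarkedWord) :
    totalBraid (.hat i :: W) = σ i * totalBraid W := by
  simp [totalBraid, forgetHats, braidOf_cons]

theorem forgetHats_twist_two (W : MarkedWord) :
    forgetHats (twist 2 W) = (forgetHats W).map (· + 2) := by
  rw [← twist_twist 1 1 W, forgetHats_twist_one, forgetHats_twist_one, List.map_map]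
  apply List.map_congr_left
  intro a _
  simp [add_assoc]

theorem bklDelta_mul_plainBraid (W : MarkedWord) :
    δ * plainBraid W = plainBraid (twist 2 W) * δ := by
  have h := plainBraid_twist 1 (twist 2 W)
  have h3 := twist_three_mul 1 W
  rw [twist_twist, show 1 + 2 = 3 * 1 from rfl, h3, pow_one] at h
  exact h.symm

theorem bklDelta_mul_totalBraid (W : MarkedWord) :
    δ * totalBraid W = totalBraid (twist 2 W) * δ := by
  rw [totalBraid, bklDelta_mul_braidOf, totalBraid, forgetHats_twist_two]

theorem plainBraid_delta (i : Fin 3) (A C : MarkedWord) :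
    plainBraid (A ++ .plain (i + 1) :: .plain i :: C) = plainBraid (A ++ twist 2 C) * δ := by
  simp only [plainBraid_append, plainBraid_cons_plain]
  rw [← mul_assoc (σ _), bklGen_succ_mul, bklDelta_mul_plainBraid, mul_assoc]

theorem totalBraid_delta (i : Fin 3) (A C : MarkedWord) :
    totalBraid (A ++ .plain (i + 1) :: .plain i :: C) = totalBraid (A ++ twist 2 C) * δ := by
  simp only [totalBraid_append, totalBraid_cons_plain]
  rw [← mul_assoc (σ _), bklGen_succ_mul, bklDelta_mul_totalBraid, mul_assoc]

theorem garsideExponent_mul_zpow (g : Braid3) (m : ℤ) :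
    garsideExponent (g * δ ^ m) = garsideExponent g + m := by
  obtain ⟨U, p, hU, rfl⟩ := exists_deltaFree_eq g
  rw [mul_assoc, ← zpow_add, garsideExponent_eq hU, garsideExponent_eq hU]

theorem exists_delta_of_not_deltaFree {U : List (Fin 3)} (h : ¬ DeltaFree U) :
    ∃ U₁ i U₂, U = U₁ ++ (i + 1) :: i :: U₂ := by
  induction U with
  | nil => exact absurd List.isChain_nil h
  | cons u U ih =>
    by_cases hU : DeltaFree U
    · rcases U with _ | ⟨v, U⟩
      · exact absurd (List.isChain_singleton _) h
      · by_cases huv : u = v + 1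
        · exact ⟨[], v, U, by rw [huv]; rfl⟩
        · exact absurd (List.isChain_cons_cons.2 ⟨huv, hU⟩) h
    · obtain ⟨U₁, i, U₂, rfl⟩ := ih hU
      exact ⟨u :: U₁, i, U₂, rfl⟩

theorem not_deltaFree_append {U₁ U₂ : List (Fin 3)} {i : Fin 3} :
    ¬ DeltaFree (U₁ ++ (i + 1) :: i :: U₂) := by
  intro h
  exact (List.isChain_cons_cons.1 (List.isChain_append.1 h).2.1).1 rfl

theorem braidOf_delta (i : Fin 3) (U₁ U₂ : List (Fin 3)) :
    braidOf (U₁ ++ (i + 1) :: i :: U₂) = braidOf (U₁ ++ U₂.map (· + 2)) * δ := by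
  rw [braidOf_append, braidOf_cons, braidOf_cons, ← mul_assoc (σ _), bklGen_succ_mul,
    bklDelta_mul_braidOf, braidOf_append, mul_assoc]

theorem garsideExponent_braidOf_nonneg (U : List (Fin 3)) : 0 ≤ garsideExponent (braidOf U) := by
  induction hn : U.length using Nat.strong_induction_on generalizing U with
  | _ n ih =>
    by_cases h : DeltaFree U
    · have := garsideExponent_eq h 0
      rw [zpow_zero, mul_one] at this
      rw [this]
    · obtain ⟨U₁, i, U₂, rfl⟩ := exists_delta_of_not_deltaFree h
      rw [braidOf_delta, ← zpow_one δ, garsideExponent_mul_zpow]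
      have := ih _ (by subst hn; simp) (U₁ ++ U₂.map (· + 2)) rfl
      omega

theorem garsideExponent_braidOf_pos {U : List (Fin 3)} (h : ¬ DeltaFree U) :
    0 < garsideExponent (braidOf U) := by
  obtain ⟨U₁, i, U₂, rfl⟩ := exists_delta_of_not_deltaFree h
  rw [braidOf_delta, ← zpow_one δ, garsideExponent_mul_zpow]
  have := garsideExponent_braidOf_nonneg (U₁ ++ U₂.map (· + 2))
  omega

/-- `W'` is a power of `δ`, and the braid `X` factorized by `W` has normal form `U δ ^ (-p)` with
`p ≥ 0`. -/
def Admissible (W : MarkedWord) : Prop :=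
  ∃ p : ℕ, plainBraid W = δ ^ p ∧ garsideExponent (totalBraid W * (plainBraid W)⁻¹) ≤ 0

theorem HatConn.totalBraid_eq {W V : MarkedWord} (h : HatConn W V) :
    totalBraid W = totalBraid V := by
  rw [totalBraid, h.forgetHats_eq, totalBraid]

theorem HatConn.admissible {W V : MarkedWord} (h : HatConn W V) (hW : Admissible W) :
    Admissible V := by
  obtain ⟨p, h1, h2⟩ := hW
  exact ⟨p, by rw [← h.plainBraid_eq, h1], by rw [← h.totalBraid_eq, ← h.plainBraid_eq]; exact h2⟩

theorem admissible_delta_iff {i : Fin 3} {A C : MarkedWord} :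
    Admissible (A ++ .plain (i + 1) :: .plain i :: C) ↔ Admissible (A ++ twist 2 C) := by
  have e : totalBraid (A ++ .plain (i + 1) :: .plain i :: C) *
      (plainBraid (A ++ .plain (i + 1) :: .plain i :: C))⁻¹ =
      totalBraid (A ++ twist 2 C) * (plainBraid (A ++ twist 2 C))⁻¹ := by
    rw [plainBraid_delta, totalBraid_delta]; group
  constructor
  · rintro ⟨p, h1, h2⟩
    rw [e] at h2
    rw [plainBraid_delta] at h1
    have h3 : plainBraid (A ++ twist 2 C) = δ ^ ((p : ℤ) - 1) := by
      rw [zpow_sub_one, zpow_natCast, ← h1, mul_inv_cancel_right]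
    have h4 := plainBraid_eq_zpow_nonneg h3
    obtain ⟨q, hq⟩ := Int.eq_ofNat_of_zero_le h4
    exact ⟨q, by rw [h3, hq, zpow_natCast], h2⟩
  · rintro ⟨p, h1, h2⟩
    rw [← e] at h2
    exact ⟨p + 1, by rw [plainBraid_delta, h1, pow_succ], h2⟩

theorem Admissible.exists_pow_succ {W : MarkedWord} (h : Admissible W)
    (hW : ¬ DeltaFree (forgetHats W)) : ∃ p : ℕ, plainBraid W = δ ^ (p + 1) := by
  obtain ⟨_ | p, h1, h2⟩ := h
  · have := garsideExponent_braidOf_pos hW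
    rw [h1, pow_zero, inv_one, mul_one, totalBraid] at h2
    omega
  · exact ⟨p, h1⟩

/-- `Z` is obtained from `W` by moving marks and deleting unmarked subwords `δ`, and no subword of
the word underlying `Z` is equal to `δ`. -/
inductive Reduces : MarkedWord → MarkedWord → Prop
  | done {W Z : MarkedWord} (h : DeltaFree (forgetHats Z)) (hc : HatConn W Z) : Reduces W Z
  | delta {W A C Z : MarkedWord} {i : Fin 3}
      (hc : HatConn W (A ++ .plain (i + 1) :: .plain i :: C))
      (h : Reduces (A ++ twist 2 C) Z) : Reduces W Z

theorem Reduces.of_hatConn {W V Z : MarkedWord} (h : Reduces V Z) (hc : HatConn W V) :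
    Reduces W Z := by
  rcases h with ⟨h, hc'⟩ | ⟨hc', h⟩
  · exact .done h (hc.trans hc')
  · exact .delta (hc.trans hc') h

theorem Reduces.trans_hatConn {W Z Z' : MarkedWord} (h : Reduces W Z) (hc : HatConn Z Z') :
    Reduces W Z' := by
  induction h with
  | done h hc' => exact .done (by rwa [← hc.forgetHats_eq]) (hc'.trans hc)
  | delta hc' _ ih => exact .delta hc' (ih hc)

theorem Admissible.exists_reduces {W : MarkedWord} (h : Admissible W) : ∃ Z, Reduces W Z := by
  induction hn : W.length using Nat.strong_induction_on generalizing W with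
  | _ n ih =>
    by_cases hW : DeltaFree (forgetHats W)
    · exact ⟨W, .done hW (.refl W)⟩
    · obtain ⟨p, hp⟩ := h.exists_pow_succ hW
      obtain ⟨U₁, i, U₂, hU⟩ := exists_delta_of_not_deltaFree hW
      obtain ⟨A, C, -, -, hc⟩ := exists_hatConn_delta hU hp
      have hl := hc.length_eq
      obtain ⟨Z, hZ⟩ := ih (A ++ twist 2 C).length (by subst hn; rw [hl]; simp)
        (admissible_delta_iff.1 (hc.admissible h)) rfl
      exact ⟨Z, .delta hc hZ⟩

/-- Local confluence: deletions of `δ` at two positions have a common reduction. -/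
theorem exists_reduces_reduces {i i' : Fin 3} {A C A' C' : MarkedWord}
    (hadm : Admissible (A ++ .plain (i + 1) :: .plain i :: C))
    (hc : HatConn (A ++ .plain (i + 1) :: .plain i :: C) (A' ++ .plain (i' + 1) :: .plain i' :: C'))
    (hle : A.length ≤ A'.length) :
    ∃ Y, Reduces (A ++ twist 2 C) Y ∧ Reduces (A' ++ twist 2 C') Y := by
  obtain ⟨p, hp⟩ := hadm.exists_pow_succ (by simpa [forgetHats] using not_deltaFree_append)
  have hadm2 := admissible_delta_iff.1 hadm
  have hf := hc.forgetHats_eq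
  have hl := hc.length_eq
  simp at hl
  simp only [forgetHats_append, forgetHats] at hf
  obtain ⟨k, hk⟩ := Nat.exists_eq_add_of_le hle
  rcases k with _ | _ | k
  · have hlen : A.length = A'.length := by omega
    obtain ⟨-, hf2⟩ := List.append_inj hf (by simpa using hlen)
    obtain ⟨rfl, -⟩ : i = i' ∧ forgetHats C = forgetHats C' := by simpa using hf2
    have h := (hatConn_delta_iff hlen (by omega) hp).1 hc
    obtain ⟨Y, hY⟩ := hadm2.exists_reduces
    exact ⟨Y, hY, hY.of_hatConn h.symm⟩
  · have hlen : A'.length = A.length + 1 := by omega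
    -- the two subwords overlap in one letter
    have hf' : forgetHats A ++ ([i + 1] ++ (i :: forgetHats C)) =
        forgetHats A' ++ ((i' + 1) :: i' :: forgetHats C') := hf
    rw [← List.append_assoc] at hf'
    obtain ⟨-, hf2⟩ := List.append_inj hf' (by simp [hlen])
    obtain ⟨rfl, hf3⟩ : i = i' + 1 ∧ forgetHats C = i' :: forgetHats C' := by simpa using hf2
    rcases C with _ | ⟨l, C₂⟩
    · simp [forgetHats] at hf3
    obtain ⟨Y, hY⟩ := hadm2.exists_reduces
    refine ⟨Y, hY, hY.of_hatConn ?_⟩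
    have e2 : i' + 1 + 1 = i' + 2 := by rw [add_assoc]; rfl
    rcases l with j | j
    · obtain ⟨rfl, hf4⟩ : j = i' ∧ forgetHats C₂ = forgetHats C' := by simpa [forgetHats] using hf3
      have h := (hatConn_delta_iff (A := A ++ [.plain (j + 1 + 1)]) (C := C₂) (A' := A') (C' := C')
        (by simp [hlen]) (by rw [← forgetHats_length, hf4, forgetHats_length]) (by simpa using hp)).1
        (by simpa using hc)
      simpa [MarkedLetter.up, add_assoc, e2] using h.symm
    · obtain ⟨rfl, hf4⟩ : j = i' ∧ forgetHats C₂ = forgetHats C' := by simpa [forgetHats] using hf3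
      have hm := HatConn.of_move (isHurwitzMarkMove_of_zpow (A := A) (B := [.plain (j + 1)]) (C := C₂)
        (x := j + 1 + 1) (y := j) (q := 1) (by simp [bklGen_succ_mul])
        (.inr (by simp [bklGen_succ_mul])))
      have h := (hatConn_delta_iff (A := A ++ [.hat (j + 1 + 1)]) (C := C₂) (A' := A') (C' := C')
        (p := p) (by simp [hlen])
        (by rw [← forgetHats_length, hf4, forgetHats_length])
        (by have := hm.plainBraid_eq.trans hp; simpa using this)).1
        (by have := hm.trans hc; simpa using this)
      simpa [MarkedLetter.up, add_assoc, e2] using h.symm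
  · have hlen : A'.length = A.length + (k + 2) := by omega
    obtain ⟨E, hE1, hE2⟩ : ∃ E, forgetHats A' = forgetHats A ++ (i + 1) :: i :: E ∧
        forgetHats C = E ++ (i' + 1) :: i' :: forgetHats C' := by
      rcases List.append_eq_append_iff.1 hf with ⟨D, h1, h2⟩ | ⟨D, h1, -⟩
      · have hD := congrArg List.length h1
        rcases D with _ | ⟨a, _ | ⟨b, D⟩⟩
        · simp at hD; omega
        · simp at hD; omega
        · obtain ⟨rfl, rfl, h3⟩ : i + 1 = a ∧ i = b ∧ _ := by simpa using h2
          exact ⟨D, h1, h3⟩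
      · have hD := congrArg List.length h1
        simp at hD; omega
    have hW2 : forgetHats (A ++ twist 2 C) = (forgetHats A ++ E.map (· + 2)) ++
        (i' + 2 + 1) :: (i' + 2) :: (forgetHats C').map (· + 2) := by
      rw [forgetHats_append, forgetHats_twist_two, hE2]
      simp [add_right_comm]
    obtain ⟨q, hq⟩ := hadm2.exists_pow_succ (by rw [hW2]; exact not_deltaFree_append)
    obtain ⟨A₂, C₂, hA₂, hC₂, hc₂⟩ := exists_hatConn_delta hW2 hq
    simp at hA₂ hC₂
    obtain ⟨A₁, D, rfl, hA₁⟩ : ∃ A₁ D, A₂ = A₁ ++ D ∧ A₁.length = A.length :=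
      ⟨A₂.take A.length, A₂.drop A.length, (List.take_append_drop _ _).symm, by simp; omega⟩
    have hD : D.length = E.length := by simp at hA₂; omega
    have hEl := congrArg List.length hE2
    simp at hEl
    have e1 : MarkedLetter.up^[2] (.plain (i' + 1)) = .plain (i' + 2 + 1) := by
      simp [up_iterate_two_plain, -Function.iterate_succ, add_right_comm]
    have e2 : MarkedLetter.up^[2] (.plain i') = .plain (i' + 2) := up_iterate_two_plain i'
    have e3 : ∀ V, twist 2 (twist 1 V) = V := fun V => by
      rw [twist_twist]; exact twist_three_mul 1 V
    have h3 : HatConn (A ++ .plain (i + 1) :: .plain i :: C) (A₁ ++ .plain (i + 1) :: .plain i ::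
        (twist 1 D ++ .plain (i' + 1) :: .plain i' :: twist 1 C₂)) := by
      refine (hatConn_delta_iff hA₁.symm (by simp; omega) hp).2 ?_
      rw [twist_append, twist_cons, twist_cons, e1, e2, e3, e3]
      simpa using hc₂
    have h4 := h3.symm.trans hc
    have h5 := (hatConn_delta_iff (i := i') (A := A₁ ++ .plain (i + 1) :: .plain i :: twist 1 D)
      (C := twist 1 C₂) (A' := A') (C' := C') (p := p) (by simp; omega) (by simp; omega)
      (by have := h3.plainBraid_eq.symm.trans hp; simpa using this)).1 (by simpa using h4)
    rw [e3] at h5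
    obtain ⟨Y, hY⟩ := (admissible_delta_iff.1 (hc₂.admissible hadm2)).exists_reduces
    refine ⟨Y, .delta hc₂ hY, ?_⟩
    refine .delta (A := A₁) (C := twist 1 D ++ C₂) (i := i) (by simpa using h5.symm) ?_
    rw [twist_append, e3, ← List.append_assoc]
    exact hY

theorem Reduces.hatConn {W Z Z' : MarkedWord} (h : Reduces W Z) (h' : Reduces W Z')
    (hadm : Admissible W) : HatConn Z Z' := by
  induction hn : W.length using Nat.strong_induction_on generalizing W Z Z' with
  | _ n ih =>
    rcases h with ⟨h, hc⟩ | @⟨_, A, C, _, i, hc, h⟩ <;>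
      rcases h' with ⟨h', hc'⟩ | @⟨_, A', C', _, i', hc', h'⟩
    · exact hc.symm.trans hc'
    · rw [← hc.forgetHats_eq, hc'.forgetHats_eq] at h
      exact absurd h (by simpa [forgetHats] using not_deltaFree_append)
    · rw [← hc'.forgetHats_eq, hc.forgetHats_eq] at h'
      exact absurd h' (by simpa [forgetHats] using not_deltaFree_append)
    · have ha := hc.admissible hadm
      have ha' := hc'.admissible hadm
      have hl := hc.length_eq
      have hl' := hc'.length_eq
      obtain ⟨Y, hY, hY'⟩ : ∃ Y, Reduces (A ++ twist 2 C) Y ∧ Reduces (A' ++ twist 2 C') Y := by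
        rcases le_total A.length A'.length with hle | hle
        · exact exists_reduces_reduces ha (hc.symm.trans hc') hle
        · obtain ⟨Y, h1, h2⟩ := exists_reduces_reduces ha' (hc'.symm.trans hc) hle
          exact ⟨Y, h2, h1⟩
      exact (ih _ (by subst hn; rw [hl]; simp) h hY (admissible_delta_iff.1 ha) rfl).trans
        (ih _ (by subst hn; rw [hl']; simp) hY' h' (admissible_delta_iff.1 ha') rfl)

/-! ### Stable equivalence -/

/-- The equivalence relation on marked words generated by the moves (h1), (h2) and the deletion of
unmarked subwords `δ`. -/
def StableEquiv : MarkedWord → MarkedWord → Prop :=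
  Relation.EqvGen fun W V => IsHurwitzMarkMove W V ∨
    ∃ (A C : MarkedWord) (i : Fin 3), W = A ++ .plain (i + 1) :: .plain i :: C ∧ V = A ++ twist 2 C

namespace StableEquiv

theorem refl (W : MarkedWord) : StableEquiv W W := Relation.EqvGen.refl W

theorem symm {W V : MarkedWord} (h : StableEquiv W V) : StableEquiv V W :=
  Relation.EqvGen.symm _ _ h

theorem trans {W V Z : MarkedWord} (h : StableEquiv W V) (h' : StableEquiv V Z) :
    StableEquiv W Z := Relation.EqvGen.trans _ _ _ h h'

theorem of_move {W V : MarkedWord} (h : IsHurwitzMarkMove W V) : StableEquiv W V :=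
  .rel _ _ (.inl h)

theorem delta (A C : MarkedWord) (i : Fin 3) :
    StableEquiv (A ++ .plain (i + 1) :: .plain i :: C) (A ++ twist 2 C) :=
  .rel _ _ (.inr ⟨A, C, i, rfl, rfl⟩)

theorem admissible_iff {W V : MarkedWord} (h : StableEquiv W V) : Admissible W ↔ Admissible V := by
  induction h with
  | rel W V h =>
    rcases h with h | ⟨A, C, i, rfl, rfl⟩
    · exact ⟨(HatConn.of_move h).admissible, (HatConn.of_move h).symm.admissible⟩
    · exact admissible_delta_iff
  | refl => rfl
  | symm _ _ _ ih => exact ih.symm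
  | trans _ _ _ _ _ ih1 ih2 => exact ih1.trans ih2

theorem exists_reduces {W V : MarkedWord} (h : StableEquiv W V) (hW : Admissible W) :
    ∃ Y, Reduces W Y ∧ Reduces V Y := by
  induction h with
  | rel W V h =>
    rcases h with h | ⟨A, C, i, rfl, rfl⟩
    · obtain ⟨Y, hY⟩ := hW.exists_reduces
      exact ⟨Y, hY, hY.of_hatConn (HatConn.of_move h).symm⟩
    · obtain ⟨Y, hY⟩ := (admissible_delta_iff.1 hW).exists_reduces
      exact ⟨Y, .delta (.refl _) hY, hY⟩
  | refl W =>
    obtain ⟨Y, hY⟩ := hW.exists_reduces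
    exact ⟨Y, hY, hY⟩
  | symm _ _ h ih =>
    obtain ⟨Y, h1, h2⟩ := ih ((admissible_iff h).2 hW)
    exact ⟨Y, h2, h1⟩
  | trans _ _ _ h _ ih1 ih2 =>
    have hV := (admissible_iff h).1 hW
    obtain ⟨Y, h1, h2⟩ := ih1 hW
    obtain ⟨Y', h3, h4⟩ := ih2 hV
    exact ⟨Y, h1, h4.trans_hatConn (h3.hatConn h2 hV)⟩

/-- Stably equivalent words without subwords `δ` are connected by moves of marks. -/
theorem hatConn {W V : MarkedWord} (h : StableEquiv W V) (hadm : Admissible W)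
    (hW : DeltaFree (forgetHats W)) (hV : DeltaFree (forgetHats V)) : HatConn W V := by
  obtain ⟨Y, h1, h2⟩ := h.exists_reduces hadm
  exact ((Reduces.done hW (.refl W)).hatConn h1 hadm).trans
    (h2.hatConn (.done hV (.refl V)) (h.admissible_iff.1 hadm))

end StableEquiv

/-! ### Unmarked words up to stable equivalence -/

/-- A positive word as a marked word without marks. -/
def plains (U : List (Fin 3)) : MarkedWord := U.map .plain

@[simp] theorem plains_nil : plains [] = [] := rfl

@[simp] theorem plains_cons (i : Fin 3) (U : List (Fin 3)) :
    plains (i :: U) = .plain i :: plains U := rfl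

@[simp] theorem plains_append (U V : List (Fin 3)) : plains (U ++ V) = plains U ++ plains V :=
  List.map_append

@[simp] theorem plainBraid_plains (U : List (Fin 3)) : plainBraid (plains U) = braidOf U := by
  induction U with
  | nil => rfl
  | cons i U ih => rw [plains_cons, plainBraid_cons_plain, ih, braidOf_cons]

theorem exists_twist_plains (n : ℕ) (U : List (Fin 3)) :
    ∃ V, twist n (plains U) = plains V ∧ braidOf U * δ ^ n = δ ^ n * braidOf V := by
  have : ∃ V, twist n (plains U) = plains V := by
    induction U with
    | nil => exact ⟨[], rfl⟩
    | cons i U ih =>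
      obtain ⟨V, hV⟩ := ih
      obtain ⟨j, hj, -, -⟩ := up_iterate_plain n i
      exact ⟨j :: V, by rw [plains_cons, twist_cons, hj, hV, plains_cons]⟩
  obtain ⟨V, hV⟩ := this
  refine ⟨V, hV, ?_⟩
  rw [← plainBraid_plains V, ← hV, ← plainBraid_twist, plainBraid_plains]

theorem bklDelta_zpow_three_mul_comm (m : ℤ) (g : Braid3) : δ ^ (3 * m) * g = g * δ ^ (3 * m) := by
  have h1 : ∀ U, δ ^ 3 * braidOf U = braidOf U * δ ^ 3 := by
    intro U
    have := plainBraid_twist (3 * 1) (plains U)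
    rw [twist_three_mul, plainBraid_plains] at this
    exact this.symm
  have h2 : Commute (δ ^ 3) g := by
    obtain ⟨U, p, -, rfl⟩ := exists_deltaFree_eq g
    have : Commute (δ ^ 3) (braidOf U) := h1 U
    exact this.mul_right (((Commute.refl δ).pow_left 3).zpow_right p)
  have h3 := h2.zpow_left m
  rw [← zpow_natCast, ← zpow_mul] at h3
  exact h3

theorem exists_braidOf_eq_pow (n : ℕ) : ∃ U, braidOf U = δ ^ n := by
  induction n with
  | zero => exact ⟨[], rfl⟩
  | succ n ih =>
    obtain ⟨U, hU⟩ := ih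
    exact ⟨U ++ [2, 1], by
      rw [braidOf_append, hU, pow_succ, braidOf_cons, braidOf_cons, braidOf_nil, mul_one]; rfl⟩

/-- Modulo the central element `δ ^ 3`, every braid is positive. -/
theorem exists_braidOf_mul (g : Braid3) :
    ∃ (U : List (Fin 3)) (m : ℤ), g = braidOf U * δ ^ (3 * m) := by
  obtain ⟨U, p, -, rfl⟩ := exists_deltaFree_eq g
  obtain ⟨V, hV⟩ := exists_braidOf_eq_pow (p % 3).toNat
  refine ⟨U ++ V, p / 3, ?_⟩
  rw [braidOf_append, hV, ← zpow_natCast, mul_assoc, ← zpow_add]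
  congr 2
  omega

theorem exists_braidOf_mul_eq (g : Braid3) :
    ∃ (U : List (Fin 3)) (m : ℤ), g * braidOf U = δ ^ (3 * m) := by
  obtain ⟨U, m, h⟩ := exists_braidOf_mul g⁻¹
  refine ⟨U, -m, ?_⟩
  rw [mul_neg, zpow_neg, eq_inv_iff_mul_eq_one, mul_assoc, ← h, mul_inv_cancel]

namespace StableEquiv

theorem append_left {W V : MarkedWord} (h : StableEquiv W V) (P : MarkedWord) :
    StableEquiv (P ++ W) (P ++ V) := by
  induction h with
  | rel W V h =>
    rcases h with h | ⟨A, C, i, rfl, rfl⟩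
    · exact of_move (h.append_left P)
    · have := delta (P ++ A) C i
      simpa using this
  | refl => exact refl _
  | symm _ _ _ ih => exact ih.symm
  | trans _ _ _ _ _ ih1 ih2 => exact ih1.trans ih2

/-- Deleting subwords `δ` brings an unmarked subword to its normal form, and the powers of `δ`
moved to the right conjugate what follows. -/
theorem exists_plains (U : List (Fin 3)) : ∃ (V : List (Fin 3)) (n : ℕ), DeltaFree V ∧
    braidOf U = braidOf V * δ ^ n ∧
    ∀ C, StableEquiv (plains U ++ C) (plains V ++ twist (2 * n) C) := by
  induction hn : U.length using Nat.strong_induction_on generalizing U with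
  | _ n ih =>
    by_cases h : DeltaFree U
    · exact ⟨U, 0, h, by simp, fun C => by simpa using refl _⟩
    · obtain ⟨U₁, i, U₂, rfl⟩ := exists_delta_of_not_deltaFree h
      obtain ⟨V, n, h1, h2, h3⟩ := ih _ (by subst hn; simp) (U₁ ++ U₂.map (· + 2)) rfl
      refine ⟨V, n + 1, h1, by rw [braidOf_delta, h2, pow_succ, mul_assoc], fun C => ?_⟩
      have e : plains (U₂.map (· + 2)) = twist 2 (plains U₂) := by
        simp only [plains, twist, List.map_map]
        exact List.map_congr_left fun a _ => (up_iterate_two_plain a).symm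
      have h4 := delta (plains U₁) (plains U₂ ++ C) i
      have h5 := h3 (twist 2 C)
      rw [twist_twist, plains_append, e] at h5
      rw [mul_add, mul_one]
      refine trans ?_ h5
      simpa using h4

theorem plains_of_pow {U : List (Fin 3)} {n : ℕ} (h : braidOf U = δ ^ n) (C : MarkedWord) :
    StableEquiv (plains U ++ C) (twist (2 * n) C) := by
  obtain ⟨V, m, h1, h2, h3⟩ := exists_plains U
  have h4 : braidOf V * δ ^ (m : ℤ) = braidOf [] * δ ^ (n : ℤ) := by
    rw [zpow_natCast, ← h2, h, zpow_natCast, braidOf_nil, one_mul]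
  obtain ⟨rfl, h5⟩ := h1.eq_and_eq List.isChain_nil h4
  obtain rfl : m = n := by omega
  simpa using h3 C

/-- Unmarked subwords may be replaced if they represent the same braid modulo the center. -/
theorem plains_congr {U V : List (Fin 3)} {m : ℤ} (h : braidOf U = braidOf V * δ ^ (3 * m))
    (C : MarkedWord) : StableEquiv (plains U ++ C) (plains V ++ C) := by
  obtain ⟨U', a, h1, h2, h3⟩ := exists_plains U
  obtain ⟨V', b, h1', h2', h3'⟩ := exists_plains V
  rw [h2, h2', mul_assoc, ← zpow_natCast, ← zpow_natCast, ← zpow_add] at h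
  obtain ⟨rfl, h4⟩ := h1.eq_and_eq h1' h
  have e : twist (2 * a) C = twist (2 * b) C := by
    obtain ⟨m, rfl | rfl⟩ := m.eq_nat_or_neg
    · obtain rfl : a = b + 3 * m := by omega
      rw [mul_add, ← twist_twist, show 2 * (3 * m) = 3 * (2 * m) by ring, twist_three_mul]
    · obtain rfl : b = a + 3 * m := by omega
      rw [mul_add, ← twist_twist, show 2 * (3 * m) = 3 * (2 * m) by ring, twist_three_mul]
  have h5 := h3 C
  rw [e] at h5
  exact h5.trans (h3' C).symm

theorem plains_of_central {U : List (Fin 3)} {m : ℤ} (h : braidOf U = δ ^ (3 * m))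
    (C : MarkedWord) : StableEquiv (plains U ++ C) C :=
  plains_congr (V := []) (m := m) (by rw [h, braidOf_nil, one_mul]) C

end StableEquiv

/-! ### Words representing a given factorization -/

theorem hat_replicate (x : Fin 3) (k : ℕ) (C : MarkedWord) :
    StableEquiv (.hat x :: (plains (List.replicate k x) ++ C))
      (plains (List.replicate k x) ++ .hat x :: C) := by
  induction k with
  | zero => exact .refl _
  | succ k ih =>
    have h1 := isHurwitzMarkMove_of_zpow (A := []) (B := []) (C := plains (List.replicate k x) ++ C)
      (x := x) (y := x) (q := 0) (by simp) (.inl (by simp))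
    have h2 := ih.append_left [.plain x]
    exact (StableEquiv.of_move (by simpa [List.replicate_succ] using h1)).trans
      (by simpa [List.replicate_succ] using h2)

theorem braidOf_replicate (k : ℕ) (x : Fin 3) : braidOf (List.replicate k x) = σ x ^ k := by
  simp [braidOf]

/-- Two blocks of one conjugate, with `A' = A x ^ k δ ^ i` and `k ≥ 0`. The mark moves over the letters
of `x ^ k` by (h1), and `δ ^ i` is inserted before the mark and compensated after the block. -/
theorem hat_block_of_pow {A D A' D' : List (Fin 3)} {x x' : Fin 3} {m m' i : ℤ} (k : ℕ)
    (h : braidOf A * braidOf D = δ ^ (3 * m)) (h' : braidOf A' * braidOf D' = δ ^ (3 * m'))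
    (hk : braidOf A' = braidOf A * σ x ^ k * δ ^ i) (hx : σ x * δ ^ i = δ ^ i * σ x')
    (C : MarkedWord) :
    StableEquiv (plains A ++ .hat x :: (plains D ++ C))
      (plains A' ++ .hat x' :: (plains D' ++ C)) := by
  obtain ⟨E, n, hE⟩ := exists_braidOf_mul_eq (σ x ^ k)
  have s1 : StableEquiv (plains A ++ .hat x :: (plains D ++ C))
      (plains (A ++ List.replicate k x) ++ .hat x :: (plains (E ++ D) ++ C)) := by
    have t1 := (StableEquiv.plains_of_central (U := List.replicate k x ++ E) (m := n)
      (by rw [braidOf_append, braidOf_replicate, hE]) (plains D ++ C)).symm.append_left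
        (plains A ++ [.hat x])
    have t2 := (hat_replicate x k (plains (E ++ D) ++ C)).append_left (plains A)
    simp only [plains_append, List.append_assoc, List.cons_append, List.nil_append] at t1 t2 ⊢
    exact t1.trans t2
  -- the exponent of `δ` matters only modulo `3`
  obtain ⟨e, r, rfl⟩ : ∃ (e : ℕ) (r : ℤ), i = e + 3 * r :=
    ⟨(i % 3).toNat, i / 3, by omega⟩
  obtain ⟨j, -, hj, hxj⟩ := up_iterate_plain e x
  obtain rfl : j = x' := by
    apply bklGen_injective
    rw [zpow_add, ← mul_assoc, zpow_natCast, hxj, mul_assoc, mul_assoc,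
      bklDelta_zpow_three_mul_comm, mul_right_inj, mul_left_inj] at hx
    exact hx
  obtain ⟨T, hT⟩ := exists_braidOf_eq_pow e
  obtain ⟨T₂, hT₂⟩ := exists_braidOf_eq_pow (2 * e)
  obtain ⟨V, hV, hV'⟩ := exists_twist_plains e (E ++ D)
  have s2 : StableEquiv (.hat x :: (plains (E ++ D) ++ C))
      (plains T ++ .hat j :: (plains (V ++ T₂) ++ C)) := by
    have t1 := (StableEquiv.plains_of_pow hT₂ C).append_left (plains T ++ .hat j :: plains V)
    have t2 := StableEquiv.plains_of_pow hT (twist e (.hat x :: (plains (E ++ D) ++ C)))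
    rw [twist_twist, show 2 * e + e = 3 * e by ring, twist_three_mul, twist_cons, hj, twist_append,
      hV] at t2
    rw [show 2 * (2 * e) = 3 * e + e by ring, ← twist_twist, twist_three_mul] at t1
    simp only [plains_append, List.append_assoc, List.cons_append] at t1 t2 ⊢
    exact t2.symm.trans t1.symm
  have s3 := s2.append_left (plains (A ++ List.replicate k x))
  have e1 : braidOf A' = braidOf (A ++ List.replicate k x ++ T) * δ ^ (3 * r) := by
    rw [braidOf_append, braidOf_append, braidOf_replicate, hk, hT, zpow_add, zpow_natCast]
    simp only [mul_assoc]
  have e2 : braidOf D' = braidOf (V ++ T₂) * δ ^ (3 * (m' - m - n - r - e)) := by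
    rw [← mul_right_inj (braidOf A'), h', braidOf_append, hT₂, e1, braidOf_append, braidOf_append,
      braidOf_replicate, hT]
    rw [braidOf_append] at hV'
    have : braidOf A * σ x ^ k * δ ^ e * braidOf V = δ ^ (3 * m) * δ ^ (3 * n) * δ ^ e := by
      rw [mul_assoc, ← hV', mul_assoc, ← mul_assoc (σ x ^ k), ← mul_assoc (σ x ^ k), hE,
        bklDelta_zpow_three_mul_comm, ← mul_assoc, ← mul_assoc, h]
    rw [mul_assoc _ (δ ^ (3 * r)), bklDelta_zpow_three_mul_comm, ← mul_assoc, ← mul_assoc,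
      ← mul_assoc, this, ← zpow_natCast, ← zpow_natCast]
    simp only [← zpow_add]
    congr 1
    push_cast
    ring
  have s4 := (StableEquiv.plains_congr e2 C).append_left (plains A' ++ [.hat j])
  have s5 := StableEquiv.plains_congr e1 (.hat j :: (plains (V ++ T₂) ++ C))
  simp only [plains_append, List.append_assoc, List.cons_append, List.nil_append] at s1 s3 s4 s5 ⊢
  exact s1.trans (s3.trans (s5.symm.trans s4.symm))

/-- Blocks `A x̂ D` with `A D` central and the same conjugate `A x A⁻¹` are stably equivalent in each
context. -/
theorem hat_block {A D A' D' : List (Fin 3)} {x x' : Fin 3} {m m' : ℤ}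
    (h : braidOf A * braidOf D = δ ^ (3 * m)) (h' : braidOf A' * braidOf D' = δ ^ (3 * m'))
    (hx : braidOf A * σ x * (braidOf A)⁻¹ = braidOf A' * σ x' * (braidOf A')⁻¹) (C : MarkedWord) :
    StableEquiv (plains A ++ .hat x :: (plains D ++ C))
      (plains A' ++ .hat x' :: (plains D' ++ C)) := by
  have hg : σ x * ((braidOf A)⁻¹ * braidOf A') = (braidOf A)⁻¹ * braidOf A' * σ x' := by
    rw [mul_inv_eq_iff_eq_mul, mul_assoc, mul_assoc] at hx
    rw [← mul_right_inj (braidOf A), mul_assoc, mul_inv_cancel_left,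
      ← mul_left_inj (braidOf A')⁻¹, ← mul_assoc]
    rw [← mul_right_inj (braidOf A)⁻¹, inv_mul_cancel_left] at hx
    rw [hx]; group
  obtain ⟨k, i, hk⟩ := exists_eq_zpow_mul_zpow hg
  rw [hk, ← mul_assoc, ((Commute.refl (σ x)).zpow_right k).eq, mul_assoc, mul_assoc, mul_right_inj]
    at hg
  rw [inv_mul_eq_iff_eq_mul, ← mul_assoc] at hk
  obtain ⟨n, rfl | rfl⟩ := k.eq_nat_or_neg
  · exact hat_block_of_pow n h h' (by rw [hk, zpow_natCast]) hg C
  -- the blocks exchange their roles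
  · have hs : SemiconjBy (δ ^ i) (σ x') (σ x) := hg.symm
    refine (hat_block_of_pow (i := -i) n h' h ?_ ?_ C).symm
    · rw [hk, mul_assoc (braidOf A * _), (hs.pow_right n).eq, ← mul_assoc, mul_assoc (braidOf A),
        zpow_neg, zpow_natCast, inv_mul_cancel, zpow_neg]
      simp
    · rw [zpow_neg, eq_inv_mul_iff_mul_eq, ← mul_assoc, hs.eq, mul_inv_cancel_right]

/-- A concatenation of blocks `A x̂ D` with `A D` central, one for each entry `A x A⁻¹` of the
factorization. -/
inductive IsBlockWord : List Braid3 → MarkedWord → Prop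
  | nil : IsBlockWord [] []
  | cons {X : Braid3} {F : List Braid3} {N : MarkedWord} {A D : List (Fin 3)} {x : Fin 3} {m : ℤ}
      (hX : X = braidOf A * σ x * (braidOf A)⁻¹) (h : braidOf A * braidOf D = δ ^ (3 * m))
      (hN : IsBlockWord F N) : IsBlockWord (X :: F) (plains A ++ .hat x :: (plains D ++ N))

theorem IsBlockWord.stableEquiv {F : List Braid3} {N N' : MarkedWord} (h : IsBlockWord F N)
    (h' : IsBlockWord F N') : StableEquiv N N' := by
  induction h generalizing N' with
  | nil => cases h'; exact .refl _
  | @cons X F N A D x m hX hm hN ih =>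
    obtain _ | @⟨_, _, N', A', D', x', m', hX', hm', hN'⟩ := h'
    have h1 := (ih hN').append_left (plains A ++ .hat x :: plains D)
    have h2 := hat_block hm hm' (hX.symm.trans hX') N'
    exact StableEquiv.trans (by simpa using h1) h2

theorem markedConjugates_append (g : Braid3) (V W : MarkedWord) :
    markedConjugates g (V ++ W) = markedConjugates g V ++ markedConjugates (g * plainBraid V) W := by
  induction V generalizing g with
  | nil => simp [markedConjugates]
  | cons l V ih => cases l <;> simp [markedConjugates, ih, mul_assoc]

@[simp] theorem markedConjugates_plains (g : Braid3) (U : List (Fin 3)) :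
    markedConjugates g (plains U) = [] := by
  induction U generalizing g with
  | nil => rfl
  | cons i U ih => simp [markedConjugates, ih]

theorem markedConjugates_mul (h g : Braid3) (W : MarkedWord) :
    markedConjugates (h * g) W = (markedConjugates g W).map (MulAut.conj h) := by
  induction W generalizing g with
  | nil => rfl
  | cons l W ih => cases l <;> simp [markedConjugates, ih, mul_assoc]

theorem markedConjugates_central (m : ℤ) (g : Braid3) (W : MarkedWord) :
    markedConjugates (g * δ ^ (3 * m)) W = markedConjugates g W := by
  rw [← bklDelta_zpow_three_mul_comm, markedConjugates_mul]
  refine (List.map_congr_left fun a _ => ?_).trans (List.map_id _)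
  rw [MulAut.conj_apply, bklDelta_zpow_three_mul_comm, mul_inv_cancel_right, id]

theorem prod_markedConjugates (g : Braid3) (W : MarkedWord) :
    (markedConjugates g W).prod = g * (totalBraid W * (plainBraid W)⁻¹) * g⁻¹ := by
  induction W generalizing g with
  | nil => simp [markedConjugates, totalBraid, forgetHats, braidOf_nil]
  | cons l W ih =>
    cases l <;> simp [markedConjugates, totalBraid_cons_plain, totalBraid_cons_hat, ih, mul_assoc]

theorem prod_markedFactorization (W : MarkedWord) :
    (markedFactorization W).prod = totalBraid W * (plainBraid W)⁻¹ := by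
  rw [markedFactorization, prod_markedConjugates]; simp

theorem isConj_bklGen (i j : Fin 3) : IsConj (σ i) (σ j) := by
  have h : ∀ i, IsConj (σ i) (σ (i + 1)) := fun i => by
    refine isConj_iff.2 ⟨δ⁻¹, ?_⟩
    rw [mul_assoc, inv_mul_eq_iff_eq_mul, inv_inv, bklGen_mul_bklDelta]
  have h0 := h 0
  have h1 := h 1
  have h2 := h 2
  fin_cases i <;> fin_cases j <;>
    first
    | exact IsConj.refl _ | exact h0 | exact h1 | exact h2
    | exact h0.symm | exact h1.symm | exact h2.symm

theorem isConj_of_mem_markedConjugates {g Y : Braid3} {W : MarkedWord}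
    (h : Y ∈ markedConjugates g W) : IsConj (σ 1) Y := by
  induction W generalizing g with
  | nil => simp [markedConjugates] at h
  | cons l W ih =>
    cases l with
    | plain i => exact ih h
    | hat i =>
      rcases List.mem_cons.1 h with rfl | h
      · exact (isConj_bklGen 1 i).trans (isConj_iff.2 ⟨g, rfl⟩)
      · exact ih h

/-- Every marked word is stably equivalent to the block word of its factorization, followed by an
unmarked word. -/
theorem exists_isBlockWord (P : List (Fin 3)) (W : MarkedWord) :
    ∃ N, IsBlockWord (markedConjugates (braidOf P) W) N ∧
      StableEquiv (plains P ++ W) (N ++ plains (P ++ eraseHats W)) := by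
  induction W generalizing P with
  | nil => exact ⟨[], .nil, by simpa [eraseHats] using StableEquiv.refl _⟩
  | cons l W ih =>
    cases l with
    | plain i =>
      obtain ⟨N, h1, h2⟩ := ih (P ++ [i])
      refine ⟨N, ?_, by simpa [eraseHats] using h2⟩
      rwa [braidOf_append, braidOf_cons, braidOf_nil, mul_one] at h1
    | hat x =>
      obtain ⟨N, h1, h2⟩ := ih P
      obtain ⟨D, m, hD⟩ := exists_braidOf_mul_eq (braidOf P)
      refine ⟨_, .cons rfl hD h1, ?_⟩
      have hDP : braidOf (D ++ P) = δ ^ (3 * m) := by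
        rw [braidOf_append, ← mul_right_inj (braidOf P), ← mul_assoc, hD,
          bklDelta_zpow_three_mul_comm]
      have h3 := (StableEquiv.plains_of_central hDP W).symm.append_left (plains P ++ [.hat x])
      have h4 := h2.append_left (plains P ++ .hat x :: plains D)
      simp only [plains_append, List.append_assoc, List.cons_append, List.nil_append, eraseHats]
        at h3 h4 ⊢
      exact h3.trans h4

/-- Words `W` with `W'` a power of `δ` are determined up to stable equivalence by `[W]`. -/
theorem stableEquiv_of_markedFactorization_eq {W V : MarkedWord} {p q : ℕ}
    (hW : plainBraid W = δ ^ p) (hV : plainBraid V = δ ^ q)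
    (h : markedFactorization W = markedFactorization V) : StableEquiv W V := by
  have key : ∀ {W : MarkedWord} {p : ℕ}, plainBraid W = δ ^ p →
      ∃ N, IsBlockWord (markedFactorization W) N ∧ StableEquiv W N := by
    intro W p hp
    obtain ⟨N, h1, h2⟩ := exists_isBlockWord [] W
    refine ⟨N, h1, h2.trans ?_⟩
    have := (StableEquiv.plains_of_pow (U := [] ++ eraseHats W) (n := p)
      (by simpa [plainBraid] using hp) []).append_left N
    simpa using this
  obtain ⟨N, h1, h2⟩ := key hW
  obtain ⟨N', h1', h2'⟩ := key hV
  rw [← h] at h1'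
  exact h2.trans ((h1.stableEquiv h1').trans h2'.symm)

theorem exists_conj_eq {X : Braid3} (h : IsConj (σ 1) X) : ∃ (A D : List (Fin 3)) (m : ℤ),
    X = braidOf A * σ 1 * (braidOf A)⁻¹ ∧ braidOf A * braidOf D = δ ^ (3 * m) := by
  obtain ⟨c, hc⟩ := isConj_iff.1 h
  obtain ⟨A, n, hA⟩ := exists_braidOf_mul c
  obtain ⟨D, m, hD⟩ := exists_braidOf_mul_eq (braidOf A)
  refine ⟨A, D, m, ?_, hD⟩
  rw [← hc, hA, mul_inv_rev, mul_assoc (braidOf A), bklDelta_zpow_three_mul_comm]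
  group

/-- Every sequence of conjugates of `σ₁` is of the form `[W]`, where `W'` is a power of `δ ^ 3`. -/
theorem exists_markedFactorization_eq {F : List Braid3} (hF : ∀ Y ∈ F, IsConj (σ 1) Y) :
    ∃ (W : MarkedWord) (m : ℕ), plainBraid W = δ ^ (3 * m) ∧ markedFactorization W = F := by
  suffices h : ∃ (W : MarkedWord) (m : ℤ), plainBraid W = δ ^ (3 * m) ∧ markedFactorization W = F by
    obtain ⟨W, m, h1, h2⟩ := h
    have := plainBraid_eq_zpow_nonneg h1
    lift m to ℕ using by omega
    exact ⟨W, m, by exact_mod_cast h1, h2⟩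
  induction F with
  | nil => exact ⟨[], 0, rfl, rfl⟩
  | cons X F ih =>
    obtain ⟨W, m, h1, h2⟩ := ih fun Y hY => hF Y (List.mem_cons_of_mem _ hY)
    obtain ⟨A, D, r, e, hD⟩ := exists_conj_eq (hF X List.mem_cons_self)
    refine ⟨plains A ++ .hat 1 :: (plains D ++ W), r + m, ?_, ?_⟩
    · simp only [plainBraid_append, plainBraid_plains, plainBraid_cons_hat]
      rw [h1, ← mul_assoc, hD, mul_add, zpow_add]
    · rw [markedFactorization, markedConjugates_append, markedConjugates_plains]
      simp only [markedConjugates, List.nil_append, markedConjugates_append, markedConjugates_plains,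
        one_mul, plainBraid_plains, hD]
      rw [← one_mul (δ ^ (3 * r)), markedConjugates_central, e]
      rw [markedFactorization] at h2
      rw [h2]

/-! ### The Hurwitz action on lists -/

/-- An elementary Hurwitz move on a list. -/
def HurwitzStep {G : Type*} [Group G] (L M : List G) : Prop :=
  ∃ (P Q : List G) (a b : G), L = P ++ a :: b :: Q ∧ M = P ++ (a * b * a⁻¹) :: a :: Q

/-- Lists in the same orbit of the Hurwitz action. -/
def HurwitzEquiv {G : Type*} [Group G] : List G → List G → Prop := Relation.EqvGen HurwitzStep

namespace HurwitzEquiv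

variable {G : Type*} [Group G] {L M N : List G}

theorem refl (L : List G) : HurwitzEquiv L L := Relation.EqvGen.refl L

theorem symm (h : HurwitzEquiv L M) : HurwitzEquiv M L := Relation.EqvGen.symm _ _ h

theorem trans (h : HurwitzEquiv L M) (h' : HurwitzEquiv M N) : HurwitzEquiv L N :=
  Relation.EqvGen.trans _ _ _ h h'

theorem of_step (h : HurwitzStep L M) : HurwitzEquiv L M := .rel _ _ h

end HurwitzEquiv

theorem hurwitzStep_ofFn {G : Type*} [Group G] {k : ℕ} (i : Fin (k - 1)) (X : Fin k → G) :
    HurwitzStep (List.ofFn X) (List.ofFn (hurwitzMove i X)) := by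
  have hi := i.isLt
  refine ⟨(List.ofFn X).take i, (List.ofFn X).drop (i + 2), X (posLeft i), X (posRight i), ?_, ?_⟩
  · apply List.ext_getElem
    · simp; omega
    · intro n h1 h2
      simp only [List.length_ofFn] at h1
      simp only [List.getElem_ofFn, List.getElem_append, List.getElem_cons, List.length_take,
        List.length_ofFn, List.getElem_take, List.getElem_drop]
      have hm : min i.val k = i := by omega
      split_ifs with h3 h4 h5
      · rfl
      · congr 1; simp [posLeft]; omega
      · congr 1; simp [posRight]; omega
      · congr 1; simp; omega
  · apply List.ext_getElem
    · simp; omega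
    · intro n h1 h2
      simp only [List.length_ofFn] at h1
      have hm : min i.val k = i := by omega
      simp only [List.getElem_ofFn, List.getElem_append, List.getElem_cons, List.length_take,
        List.length_ofFn, List.getElem_take, List.getElem_drop, hurwitzMove, Equiv.coe_fn_mk]
      simp only [posLeft, posRight, Fin.mk.injEq]
      split_ifs <;> first | rfl | omega | (congr 1; simp; omega)

theorem HurwitzStep.exists_hurwitzMove {G : Type*} [Group G] {k : ℕ} {X Y : Fin k → G}
    (h : HurwitzStep (List.ofFn X) (List.ofFn Y)) : ∃ i, hurwitzMove i X = Y := by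
  obtain ⟨P, Q, a, b, hX, hY⟩ := h
  have hl := congrArg List.length hX
  simp at hl
  have hX' : ∀ j : Fin k, X j = (P ++ a :: b :: Q)[j.val]'(by simp; omega) := fun j => by
    simp [← hX]
  have hY' : ∀ j : Fin k, Y j = (P ++ (a * b * a⁻¹) :: a :: Q)[j.val]'(by simp; omega) := fun j => by
    simp [← hY]
  refine ⟨⟨P.length, by omega⟩, funext fun j => ?_⟩
  rw [hY' j]
  simp only [hurwitzMove, Equiv.coe_fn_mk, hX', posLeft, posRight, Fin.ext_iff]
  simp only [List.getElem_append, List.getElem_cons]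
  split_ifs <;> first | rfl | omega

theorem hurwitzEquiv_hurwitzAction {G : Type*} [Group G] {k : ℕ} (β : ArtinBraidGroup k)
    (X : Fin k → G) : HurwitzEquiv (List.ofFn X) (List.ofFn (hurwitzAction G k β X)) := by
  obtain ⟨w, rfl⟩ := PresentedGroup.mk_surjective _ β
  induction w using FreeGroup.induction_on generalizing X with
  | C1 => simpa using HurwitzEquiv.refl _
  | of i =>
    have e : hurwitzAction G k (PresentedGroup.mk _ (FreeGroup.of i)) = hurwitzMove i :=
      PresentedGroup.toGroup.of _
    rw [e]
    exact .of_step (hurwitzStep_ofFn i X)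
  | inv_of i h =>
    have := (h ((hurwitzAction G k (PresentedGroup.mk _ (FreeGroup.of i)))⁻¹ X)).symm
    rw [map_inv, map_inv]
    rwa [← Equiv.Perm.mul_apply, mul_inv_cancel, Equiv.Perm.one_apply] at this
  | mul x y hx hy =>
    rw [map_mul, map_mul, Equiv.Perm.mul_apply]
    exact (hy X).trans (hx _)

theorem mem_hurwitzOrbit_ofFn {G : Type*} [Group G] {k : ℕ} {X Y : Fin k → G}
    {β : ArtinBraidGroup k} (h : hurwitzAction G k β X = Y) :
    List.ofFn Y ∈ hurwitzOrbit (List.ofFn X) := by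
  obtain ⟨L, hL⟩ : ∃ L, L = List.ofFn X := ⟨_, rfl⟩
  rw [← hL]
  obtain rfl : L.length = k := by rw [hL, List.length_ofFn]
  obtain rfl : L.get = X := by
    apply List.ofFn_injective
    rw [← hL, List.ofFn_get]
  exact ⟨β, by rw [h]⟩

theorem HurwitzEquiv.length_eq {G : Type*} [Group G] {L M : List G} (h : HurwitzEquiv L M) :
    L.length = M.length := by
  induction h with
  | rel L M h => obtain ⟨P, Q, a, b, rfl, rfl⟩ := h; simp
  | refl => rfl
  | symm _ _ _ ih => exact ih.symm
  | trans _ _ _ _ _ ih1 ih2 => exact ih1.trans ih2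

/-- The orbits of the Hurwitz action are generated by the elementary moves. -/
theorem mem_hurwitzOrbit_iff {G : Type*} [Group G] {L M : List G} :
    M ∈ hurwitzOrbit L ↔ HurwitzEquiv L M := by
  constructor
  · rintro ⟨β, rfl⟩
    have := hurwitzEquiv_hurwitzAction β L.get
    rwa [List.ofFn_get] at this
  · intro h
    have key : ∀ {k : ℕ} {X Y : Fin k → G}, List.ofFn X = L → List.ofFn Y = M →
        ∃ β : ArtinBraidGroup k, hurwitzAction G k β X = Y := by
      induction h with
      | rel L M h =>
        rintro k X Y rfl rfl
        obtain ⟨i, hi⟩ := h.exists_hurwitzMove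
        refine ⟨PresentedGroup.of i, ?_⟩
        rw [hurwitzAction, PresentedGroup.toGroup.of, hi]
      | refl L =>
        rintro k X Y rfl h
        exact ⟨1, by rw [map_one, Equiv.Perm.one_apply, List.ofFn_injective h]⟩
      | symm L M _ ih =>
        intro k X Y h1 h2
        obtain ⟨β, rfl⟩ := ih h2 h1
        exact ⟨β⁻¹, by rw [map_inv, ← Equiv.Perm.mul_apply, inv_mul_cancel, Equiv.Perm.one_apply]⟩
      | trans L M N h1 h2 ih1 ih2 =>
        intro k X Y hX hY
        have hl := HurwitzEquiv.length_eq h1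
        obtain rfl : M.length = k := by rw [← hl, ← hX, List.length_ofFn]
        obtain ⟨β, hβ⟩ := ih1 hX (List.ofFn_get M)
        obtain ⟨γ, hγ⟩ := ih2 (List.ofFn_get M) hY
        exact ⟨γ * β, by rw [map_mul, Equiv.Perm.mul_apply, hβ, hγ]⟩
    obtain ⟨β, hβ⟩ := key (List.ofFn_get L) (Y := fun i => M.get (i.cast (HurwitzEquiv.length_eq h)))
      (by apply List.ext_getElem <;> simp [HurwitzEquiv.length_eq h])
    have hM := mem_hurwitzOrbit_ofFn hβ
    have e : List.ofFn (fun i => M.get (i.cast (HurwitzEquiv.length_eq h))) = M := by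
      apply List.ext_getElem <;> simp [HurwitzEquiv.length_eq h]
    rwa [e, List.ofFn_get] at hM

theorem HurwitzEquiv.prod_eq {G : Type*} [Group G] {L M : List G} (h : HurwitzEquiv L M) :
    L.prod = M.prod := by
  induction h with
  | rel L M h => obtain ⟨P, Q, a, b, rfl, rfl⟩ := h; simp [mul_assoc]
  | refl => rfl
  | symm _ _ _ ih => exact ih.symm
  | trans _ _ _ _ _ ih1 ih2 => exact ih1.trans ih2

theorem HurwitzEquiv.isConj_iff {G : Type*} [Group G] {s : G} {L M : List G}
    (h : HurwitzEquiv L M) : (∀ Y ∈ L, IsConj s Y) ↔ ∀ Y ∈ M, IsConj s Y := by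
  induction h with
  | rel L M h =>
    obtain ⟨P, Q, a, b, rfl, rfl⟩ := h
    have hab : IsConj b (a * b * a⁻¹) := _root_.isConj_iff.2 ⟨a, rfl⟩
    have : IsConj s (a * b * a⁻¹) ↔ IsConj s b := ⟨fun h => h.trans hab.symm, fun h => h.trans hab⟩
    simp only [List.mem_append, List.mem_cons, or_imp, forall_and, forall_eq, this]
    tauto
  | refl => rfl
  | symm _ _ _ ih => exact ih.symm
  | trans _ _ _ _ _ ih1 ih2 => exact ih1.trans ih2

theorem hurwitzEquiv_map_conj {G : Type*} [Group G] (P Q L : List G) (a : G) :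
    HurwitzEquiv (P ++ a :: (L ++ Q)) (P ++ (L.map (MulAut.conj a) ++ a :: Q)) := by
  induction L generalizing P with
  | nil => exact .refl _
  | cons b L ih =>
    have h1 : HurwitzStep (P ++ a :: (b :: L ++ Q)) (P ++ (a * b * a⁻¹) :: a :: (L ++ Q)) :=
      ⟨P, L ++ Q, a, b, rfl, rfl⟩
    have h2 := ih (P ++ [a * b * a⁻¹])
    exact (HurwitzEquiv.of_step h1).trans (by simpa using h2)

/-! ### Stable equivalence and the Hurwitz action -/

/-- Moving a mark from `x` to `y` over `B` moves one entry of the factorization over the entries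
coming from `B`. -/
theorem IsHurwitzMarkMove.hurwitzEquiv {W V : MarkedWord} (h : IsHurwitzMarkMove W V) :
    HurwitzEquiv (markedFactorization W) (markedFactorization V) := by
  obtain ⟨A, B, C, x, y, q, rfl, rfl, h1, -⟩ := h.exists_eq
  simp only [markedFactorization, markedConjugates_append, markedConjugates, one_mul]
  generalize plainBraid A = g
  have e1 : g * σ x * plainBraid B = g * plainBraid B * σ y := by rw [mul_assoc, h1, mul_assoc]
  have e2 : g * plainBraid B * σ y * σ y * (g * plainBraid B * σ y)⁻¹ = g * σ x * g⁻¹ := by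
    rw [mul_inv_rev, ← mul_assoc, mul_inv_cancel_right, ← e1]
    group
  have e3 : markedConjugates (g * σ x) B =
      (markedConjugates g B).map (MulAut.conj (g * σ x * g⁻¹)) := by
    rw [← markedConjugates_mul, inv_mul_cancel_right]
  rw [e1, e2, e3]
  exact hurwitzEquiv_map_conj _ _ _ _

theorem markedConjugates_mul_bklDelta (g : Braid3) (W : MarkedWord) :
    markedConjugates (g * δ) W = markedConjugates g (twist 2 W) := by
  induction W generalizing g with
  | nil => rfl
  | cons l W ih =>
    rw [twist_cons]
    cases l with
    | plain i =>
      rw [up_iterate_two_plain, markedConjugates, markedConjugates, ← ih, mul_assoc,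
        bklDelta_mul_bklGen, mul_assoc]
    | hat i =>
      rw [up_iterate_two_hat, markedConjugates, markedConjugates, ← ih]
      congr 1
      rw [mul_assoc g, bklDelta_mul_bklGen]
      group

/-- Deletion of an unmarked subword `δ` preserves the factorization. -/
theorem markedFactorization_delta (i : Fin 3) (A C : MarkedWord) :
    markedFactorization (A ++ .plain (i + 1) :: .plain i :: C) =
      markedFactorization (A ++ twist 2 C) := by
  simp only [markedFactorization, markedConjugates_append, markedConjugates]
  rw [mul_assoc _ (σ _), bklGen_succ_mul, markedConjugates_mul_bklDelta]

theorem HatConn.hurwitzEquiv {W V : MarkedWord} (h : HatConn W V) :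
    HurwitzEquiv (markedFactorization W) (markedFactorization V) := by
  induction h with
  | rel W V h => exact h.hurwitzEquiv
  | refl => exact .refl _
  | symm _ _ _ ih => exact ih.symm
  | trans _ _ _ _ _ ih1 ih2 => exact ih1.trans ih2

theorem Reduces.hurwitzEquiv {W Z : MarkedWord} (h : Reduces W Z) :
    HurwitzEquiv (markedFactorization W) (markedFactorization Z) := by
  induction h with
  | done h hc => exact hc.hurwitzEquiv
  | delta hc _ ih =>
    rw [← markedFactorization_delta] at ih
    exact hc.hurwitzEquiv.trans ih

theorem Reduces.deltaFree {W Z : MarkedWord} (h : Reduces W Z) : DeltaFree (forgetHats Z) := by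
  induction h with
  | done h _ => exact h
  | delta _ _ ih => exact ih

theorem Reduces.admissible {W Z : MarkedWord} (h : Reduces W Z) (hW : Admissible W) :
    Admissible Z := by
  induction h with
  | done h hc => exact hc.admissible hW
  | delta hc _ ih => exact ih (admissible_delta_iff.1 (hc.admissible hW))

/-- An elementary Hurwitz move is realized by moving a mark in a suitable pair of words. -/
theorem HurwitzStep.exists_move {L M : List Braid3} (h : HurwitzStep L M)
    (hL : ∀ Y ∈ L, IsConj (σ 1) Y) :
    ∃ (W V : MarkedWord) (p : ℕ), plainBraid W = δ ^ p ∧ IsHurwitzMarkMove W V ∧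
      markedFactorization W = L ∧ markedFactorization V = M := by
  obtain ⟨P, Q, a, b, rfl, rfl⟩ := h
  simp only [List.mem_append, List.mem_cons, or_imp, forall_and, forall_eq] at hL
  obtain ⟨hP, ha, hb, hQ⟩ := hL
  obtain ⟨W₁, m₁, hW₁, rfl⟩ := exists_markedFactorization_eq hP
  obtain ⟨W₂, m₂, hW₂, rfl⟩ := exists_markedFactorization_eq hQ
  obtain ⟨A, D, m, rfl, hD⟩ := exists_conj_eq ha
  obtain ⟨E, H, n, rfl, hH⟩ := exists_conj_eq hb
  obtain ⟨K, r, hK⟩ := exists_braidOf_mul_eq (braidOf A * σ 1)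
  have hDA : braidOf D * braidOf A = δ ^ (3 * m) := by
    rw [← mul_right_inj (braidOf A), ← mul_assoc, hD, bklDelta_zpow_three_mul_comm]
  -- in `A x̂ D E ŷ H A x K`, the first mark is moved over `D E ŷ H A`, whose unmarked part is
  -- central, to the second `x`
  have hB : braidOf D * braidOf E * (braidOf H * braidOf A) = δ ^ (3 * (n + m)) := by
    rw [mul_assoc, ← mul_assoc (braidOf E), hH, bklDelta_zpow_three_mul_comm, ← mul_assoc, hDA,
      ← zpow_add]
    congr 1; ring
  set B : MarkedWord := plains (D ++ E) ++ .hat 1 :: plains (H ++ A) with hBdef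
  have hpB : plainBraid B = δ ^ (3 * (n + m)) := by
    rw [hBdef]
    rw [← hB]
    simp [mul_assoc]
  have hmove := isHurwitzMarkMove_of_zpow (A := W₁ ++ plains A) (B := B) (C := plains K ++ W₂)
    (x := 1) (y := 1) (by rw [hpB, bklDelta_zpow_three_mul_comm]) (.inl hpB)
  have hplain : plainBraid (W₁ ++ plains A ++ .hat 1 :: (B ++ .plain 1 :: (plains K ++ W₂))) =
      δ ^ (3 * (m₁ + (n + m) + r + m₂)) := by
    simp only [plainBraid_append, plainBraid_cons_hat, plainBraid_cons_plain, plainBraid_plains,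
      hpB, hW₁, hW₂]
    rw [mul_assoc, ← mul_assoc (braidOf A), ← bklDelta_zpow_three_mul_comm _ (braidOf A),
      mul_assoc _ (braidOf A), ← mul_assoc (σ 1), ← mul_assoc (braidOf A), ← mul_assoc (braidOf A),
      hK, ← zpow_natCast, ← zpow_natCast, ← zpow_add, ← zpow_add, ← zpow_add]
    congr 1; push_cast; ring
  have hnn := plainBraid_eq_zpow_nonneg hplain
  obtain ⟨p, hp⟩ := Int.eq_ofNat_of_zero_le hnn
  rw [hp, zpow_natCast] at hplain
  have hconj : ∀ (k : ℤ) (g x : Braid3),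
      g * δ ^ (3 * k) * x * (g * δ ^ (3 * k))⁻¹ = g * x * g⁻¹ := fun k g x => by
    rw [mul_assoc g, bklDelta_zpow_three_mul_comm]; group
  have hpre : ∀ T, markedFactorization (W₁ ++ T) = markedFactorization W₁ ++ markedConjugates 1 T := by
    intro T
    have := markedConjugates_central m₁ 1 T
    rw [markedFactorization, markedConjugates_append, hW₁, ← this]
    exact_mod_cast rfl
  refine ⟨_, _, p, hplain, hmove, ?_, ?_⟩
  · have e1 : braidOf A * (braidOf D * braidOf E) = braidOf E * δ ^ (3 * m) := by
      rw [← mul_assoc, hD, bklDelta_zpow_three_mul_comm]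
    have e2 : braidOf E * δ ^ (3 * m) * (braidOf H * braidOf A) * σ 1 * braidOf K =
        1 * δ ^ (3 * (n + m + r)) := by
      rw [← e1, mul_assoc (braidOf A), hB, ← bklDelta_zpow_three_mul_comm, mul_assoc, mul_assoc,
        ← mul_assoc (braidOf A), hK, ← zpow_add, one_mul]
      congr 1; ring
    rw [List.append_assoc, hpre]
    simp only [markedConjugates_append, markedConjugates, one_mul, hBdef,
      plainBraid_plains, braidOf_append,
      List.append_assoc, List.cons_append, List.nil_append, markedConjugates_plains, e1]
    rw [e2, markedConjugates_central, hconj, markedFactorization, markedFactorization]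
  · have e1 : braidOf A * σ 1 * (braidOf D * braidOf E) =
        braidOf A * σ 1 * (braidOf A)⁻¹ * braidOf E * δ ^ (3 * m) := by
      rw [mul_assoc _ (braidOf E), ← bklDelta_zpow_three_mul_comm, ← hD]
      group
    have e2 : braidOf A * σ 1 * (braidOf A)⁻¹ * braidOf E * δ ^ (3 * m) *
        (braidOf H * braidOf A) = braidOf A * σ 1 * δ ^ (3 * (n + m)) := by
      rw [← e1, mul_assoc _ _ (braidOf H * _), hB]
    have e3 : braidOf A * σ 1 * δ ^ (3 * (n + m)) * braidOf K = 1 * δ ^ (3 * (n + m + r)) := by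
      rw [mul_assoc, bklDelta_zpow_three_mul_comm, ← mul_assoc, hK, ← zpow_add, one_mul]
      congr 1; ring
    rw [List.append_assoc, hpre]
    simp only [markedConjugates_append, markedConjugates, one_mul, hBdef,
      plainBraid_plains, braidOf_append,
      List.append_assoc, List.cons_append, List.nil_append, markedConjugates_plains, e1]
    rw [e2, e3, markedConjugates_central, hconj, hconj, markedFactorization, markedFactorization]
    group

/-- Words whose factorizations are in the same orbit are stably equivalent. -/
theorem HurwitzEquiv.stableEquiv {L M : List Braid3} (h : HurwitzEquiv L M) {W V : MarkedWord}
    {p q : ℕ} (hW : plainBraid W = δ ^ p) (hV : plainBraid V = δ ^ q)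
    (hL : markedFactorization W = L) (hM : markedFactorization V = M) : StableEquiv W V := by
  induction h generalizing W V p q with
  | rel L M h =>
    obtain ⟨W', V', r, h1, h2, h3, h4⟩ := h.exists_move
      (by rw [← hL]; exact fun Y hY => isConj_of_mem_markedConjugates hY)
    exact (stableEquiv_of_markedFactorization_eq hW h1 (hL.trans h3.symm)).trans
      ((StableEquiv.of_move h2).trans (stableEquiv_of_markedFactorization_eq
        (h2.plainBraid_eq.symm.trans h1) hV (h4.trans hM.symm)))
  | refl L => exact stableEquiv_of_markedFactorization_eq hW hV (hL.trans hM.symm)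
  | symm L M _ ih => exact (ih hV hW hM hL).symm
  | trans L M N h1 _ ih1 ih2 =>
    have hc : ∀ Y ∈ M, IsConj (σ 1) Y := (HurwitzEquiv.isConj_iff h1).1
      (by rw [← hL]; exact fun Y hY => isConj_of_mem_markedConjugates hY)
    obtain ⟨Z, m, h3, h4⟩ := exists_markedFactorization_eq hc
    exact (ih1 hW h3 hL h4).trans (ih2 h3 hV h4 hM)

/-! ### The graph of marked words -/

theorem IsRightGarsideNormalForm.deltaFree {X : Braid3} {U : List (Fin 3)} {p : ℤ}
    (h : IsRightGarsideNormalForm X U p) : DeltaFree U := by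
  by_contra hU
  obtain ⟨U₁, i, U₂, rfl⟩ := exists_delta_of_not_deltaFree hU
  refine h.2 [i + 1, i] ⟨U₁, U₂, by simp⟩ ?_
  rw [braidOf_cons, braidOf_cons, braidOf_nil, mul_one, bklGen_succ_mul]

theorem DeltaFree.eq_of_braidOf_eq {U V : List (Fin 3)} (hU : DeltaFree U)
    (h : braidOf V = braidOf U) : V = U := by
  have h0 : garsideExponent (braidOf U) = 0 := by
    have := garsideExponent_eq hU 0
    rwa [zpow_zero, mul_one] at this
  have hV : DeltaFree V := by
    by_contra hV
    have := garsideExponent_braidOf_pos hV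
    rw [h] at this
    omega
  exact (hV.eq_and_eq hU (p := 0) (q := 0) (by rw [h])).1

theorem finite_forgetHats_eq (U : List (Fin 3)) : {W | forgetHats W = U}.Finite := by
  induction U with
  | nil =>
    refine (Set.finite_singleton []).subset fun W hW => ?_
    rcases W with _ | ⟨_ | _, W⟩
    · rfl
    · simp [forgetHats] at hW
    · simp [forgetHats] at hW
  | cons u U ih =>
    refine ((ih.image (.plain u :: ·)).union (ih.image (.hat u :: ·))).subset fun W hW => ?_
    rcases W with _ | ⟨i | i, W⟩
    · simp [forgetHats] at hW
    · obtain ⟨rfl, h⟩ := List.cons_eq_cons.1 hW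
      exact .inl ⟨W, h, rfl⟩
    · obtain ⟨rfl, h⟩ := List.cons_eq_cons.1 hW
      exact .inr ⟨W, h, rfl⟩

theorem HatConn.mem_graphVertices {W V : MarkedWord} (h : HatConn W V) {U : List (Fin 3)} {p : ℤ}
    (hW : W ∈ graphVertices U p) : V ∈ graphVertices U p :=
  ⟨h.plainBraid_eq.symm.trans hW.1, by rw [← h.forgetHats_eq]; exact hW.2⟩

theorem HatConn.reachable {U : List (Fin 3)} {p : ℤ} {W V : MarkedWord} (h : HatConn W V)
    (hW : W ∈ graphVertices U p) (hV : V ∈ graphVertices U p) :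
    (markedGraph U p).Reachable ⟨W, hW⟩ ⟨V, hV⟩ := by
  induction h with
  | rel W V h =>
    by_cases hne : W = V
    · subst hne; exact .refl _
    · refine SimpleGraph.Adj.reachable ?_
      exact (SimpleGraph.fromRel_adj _ _ _).2 ⟨fun h => hne (congrArg Subtype.val h), .inl h⟩
  | refl => exact .refl _
  | symm _ _ _ ih => exact (ih hV hW).symm
  | trans _ Z _ h1 _ ih1 ih2 =>
    have hZ := HatConn.mem_graphVertices h1 hW
    exact (ih1 hW hZ).trans (ih2 hZ hV)

theorem hatConn_of_reachable {U : List (Fin 3)} {p : ℤ} {W V : graphVertices U p}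
    (h : (markedGraph U p).Reachable W V) : HatConn W.1 V.1 := by
  obtain ⟨w⟩ := h
  induction w with
  | nil => exact .refl _
  | cons h _ ih =>
    rcases ((SimpleGraph.fromRel_adj _ _ _).1 h).2 with h | h
    · exact (HatConn.of_move h).trans ih
    · exact (HatConn.of_move h).symm.trans ih

theorem theorem1 (X : Braid3) (U : List (Fin 3)) (p : ℤ)
    (hX : IsRightGarsideNormalForm X U p) (hp : 0 ≤ p) :
    (graphVertices U p).Finite ∧
    (∀ W ∈ graphVertices U p, markedFactorization W ∈ quasipositiveFactorizations X) ∧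
    (∀ F ∈ quasipositiveFactorizations X,
      ∃ W ∈ graphVertices U p, markedFactorization W ∈ hurwitzOrbit F) ∧
    (∀ W V : graphVertices U p,
      markedFactorization V.1 ∈ hurwitzOrbit (markedFactorization W.1) ↔
        (markedGraph U p).connectedComponentMk W = (markedGraph U p).connectedComponentMk V) := by
  have hU := hX.deltaFree
  have hforget : ∀ W ∈ graphVertices U p, forgetHats W = U := fun W hW =>
    hU.eq_of_braidOf_eq hW.2
  have hprod : ∀ W ∈ graphVertices U p, totalBraid W * (plainBraid W)⁻¹ = X := fun W hW => by
    rw [totalBraid, plainBraid, hW.1, hW.2, hX.1, zpow_neg]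
  have hexp : garsideExponent X ≤ 0 := by
    rw [hX.1, garsideExponent_eq hU]; omega
  lift p to ℕ using hp
  have hplain : ∀ W ∈ graphVertices U p, plainBraid W = δ ^ p := fun W hW => by
    rw [plainBraid, hW.1, zpow_natCast]
  refine ⟨(finite_forgetHats_eq U).subset hforget, fun W hW => ⟨?_, fun Y hY =>
    isConj_of_mem_markedConjugates hY⟩, ?_, ?_⟩
  · rw [prod_markedFactorization, hprod W hW]
  · rintro F ⟨hF, hconj⟩
    obtain ⟨W, m, hW, rfl⟩ := exists_markedFactorization_eq hconj
    have hadm : Admissible W := ⟨3 * m, hW, by rw [← prod_markedFactorization, hF]; exact hexp⟩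
    obtain ⟨Z, hZ⟩ := hadm.exists_reduces
    obtain ⟨q, hq, -⟩ := hZ.admissible hadm
    have hZX : totalBraid Z * (plainBraid Z)⁻¹ = X := by
      rw [← prod_markedFactorization, ← hZ.hurwitzEquiv.prod_eq, hF]
    rw [hX.1, hq, totalBraid, ← zpow_natCast, ← zpow_neg] at hZX
    obtain ⟨h1, h2⟩ := hZ.deltaFree.eq_and_eq hU hZX
    refine ⟨Z, ⟨?_, by rw [h1]⟩, mem_hurwitzOrbit_iff.2 hZ.hurwitzEquiv⟩
    obtain rfl : q = p := by omega
    rw [zpow_natCast]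
    exact hq
  · rintro ⟨W, hW⟩ ⟨V, hV⟩
    rw [mem_hurwitzOrbit_iff, SimpleGraph.ConnectedComponent.eq]
    constructor
    · intro h
      have hadm : Admissible W := ⟨p, hplain W hW, by rw [hprod W hW]; exact hexp⟩
      refine HatConn.reachable ?_ hW hV
      exact (h.stableEquiv (hplain W hW) (hplain V hV) rfl rfl).hatConn hadm
        (by rw [hforget W hW]; exact hU) (by rw [hforget V hV]; exact hU)
    · exact fun h => (hatConn_of_reachable h).hurwitzEquiv
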